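/- **Setting.** A non-recursive structured DTD $D=(Ele,Rg,rt)$ consists of a finite set $Ele$ of labels (labels are bit strings), a root type $rt\in Ele$, and for each $A\in Ele$ a right-hand side $Rg(A)$ of one of the forms $\mathsf{str}$, $\epsilon$, $B_1,\dots,B_n$, $B_1+\dots+B_n$, $B_1{*}$, with $n\ge 1$ and distinct $B_i\in Ele$, such that the subelement relation ($B$ occurs in $Rg(A)$) is acyclic. An XML tree is a finite rooted unordered tree whose nodes are labeled by labels or by $\mathsf{str}$, with string values at the $\mathsf{str}$-nodes. It belongs to $I_D(A)$ if its root has label $A$, all labels lie in $Ele\cup\{\mathsf{str}\}$, the children of each node labeled $B\in Ele$ can be ordered so that their labels form a word of the language of $Rg(B)$, and each $\mathsf{str}$-node is a leaf that has a string value. The tree conforms to $D$ if it is in $I_D(rt)$. The updates of a tree $t$ are $\mathrm{insert}(n,t')$ (add $t'$ as a child subtree of $n$), $\mathrm{delete}(n)$ (remove the subtree at $n$), $\mathrm{replace}(n,t')$ (replace the subtree at $n$ by $t'$) and $\mathrm{replace}(n,s)$ (set the string value of $n$ to $s$); they are valid on $t$ if $n$ is a node of $t$ and $t'$ is node-disjoint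 from $t$. Write $[\![op]\!](t)$ for the result and $\equiv$ for isomorphism of XML trees. The valid update access types of $D$ are $(A,\mathrm{insert}(B))$ and $(A,\mathrm{delete}(B))$ when $Rg(A)=B{*}$; $(A,\mathrm{replace}(B_i,B_j))$ with $i\ne j$ when $Rg(A)=B_1+\dots+B_n$; and $(A,\mathrm{replace}(\mathsf{str},\mathsf{str}))$ when $Rg(A)=\mathsf{str}$. On $t$, $\mathrm{insert}(n,t')$ matches $(A,\mathrm{insert}(B))$ if $n$ has label $A$ and $t'\in I_D(B)$; $\mathrm{delete}(n)$ matches $(A,\mathrm{delete}(B))$ if $n$ has label $B$ and its parent has label $A$; $\mathrm{replace}(n,t')$ matches $(A,\mathrm{replace}(B,B'))$ if moreover $t'\in I_D(B')$ and $B\ne B'$; $\mathrm{replace}(n,s)$ matches $(A,\mathrm{replace}(\mathsf{str},\mathsf{str}))$ if $n$ has label $\mathsf{str}$ and its parent has label $A$. A (total or partial) policy over $D$ is a pair $P=(\mathcal A,\mathcal F)$ of disjoint sets of valid update access types of $D$. A sequence $op_1;\dots;op_n$ is allowed on $t$ if each $op_i$ is valid on, and matches some element of $\mathcal A$ on, the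 tree produced by $op_1;\dots;op_{i-1}$ from $t$. The policy $P$ is *consistent* if there are no tree $t$ conforming to $D$, no update $op_0$ that is valid on $t$, matches some element of $\mathcal F$ on $t$ and changes $t$ (that is, $[\![op_0]\!](t)\not\equiv t$), and no sequence $op_1;\dots;op_n$ allowed on $t$ with $[\![op_1;\dots;op_n]\!](t)\equiv[\![op_0]\!](t)$. **Proposition.** The problem of deciding policy consistency is in $\mathrm{PTIME}$: let a DTD $D$ and a policy $P=(\mathcal A,\mathcal F)$ over $D$ be presented as a word over a fixed finite alphabet, by listing the root type, the production rules $A\to Rg(A)$, the elements of $\mathcal A$ and the elements of $\mathcal F$. Then the language of all words that present a consistent policy over some DTD is decided by a deterministic multi-stack Turing machine in a number of steps that is polynomial in the length of the input word. -/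

import Mathlib

namespace XMLPolicy

/-! ### Document type definitions -/

/-- Labels are bit strings: an infinite set of names that can be written on a machine's tape. -/
abbrev Label := List Bool

/-- The right-hand sides of production rules: `str`, `ε`, `B₁,…,Bₙ`, `B₁+…+Bₙ`, `B*`. -/
inductive Content
  | text
  | empty
  | seq (Bs : List Label)
  | alt (Bs : List Label)
  | star (B : Label)

/-- The subelement types occurring in a right-hand side. -/
def Content.subs : Content → List Label
  | .text => []
  | .empty => []
  | .seq Bs => Bs
  | .alt Bs => Bs
  | .star B => [B]

/-- Syntactic restrictions: `n ≥ 1` and `B₁,…,Bₙ` distinct in `B₁,…,Bₙ` and `B₁+…+Bₙ`. -/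
def Content.WellFormed : Content → Prop
  | .text => True
  | .empty => True
  | .seq Bs => Bs ≠ [] ∧ Bs.Nodup
  | .alt Bs => Bs ≠ [] ∧ Bs.Nodup
  | .star _ => True

/-- The language of a right-hand side, over the alphabet of labels together with `str`
(written `none`). -/
def Content.language : Content → Language (Option Label)
  | .text => {[none]}
  | .empty => {[]}
  | .seq Bs => {Bs.map some}
  | .alt Bs => {w | ∃ B ∈ Bs, w = [some B]}
  | .star B => {w | ∀ x ∈ w, x = some B}

/-- A non-recursive structured DTD `(Ele, Rg, rt)`. The values of `rg` outside `ele` are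
irrelevant. -/
structure DTD where
  ele : Finset Label
  rg : Label → Content
  rt : Label
  rt_mem : rt ∈ ele
  rg_wf : ∀ A ∈ ele, (rg A).WellFormed
  subs_mem : ∀ A ∈ ele, ∀ B ∈ (rg A).subs, B ∈ ele
  /-- The DTD graph is acyclic. -/
  acyclic : ∀ A, ¬ Relation.TransGen (fun A B => A ∈ ele ∧ B ∈ (rg A).subs) A A

/-! ### XML trees -/

/-- The data `(N, E, λ, r, v)` of an unordered XML tree. Nodes are natural numbers, the label
`str` is `none`, and `lab`, `val` are only meaningful on `nodes`. -/
structure XMLTree where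
  nodes : Set ℕ
  edges : Set (ℕ × ℕ)
  lab : ℕ → Option Label
  root : ℕ
  val : ℕ → Option String

namespace XMLTree

/-- `t` is a finite rooted tree. -/
structure IsTree (t : XMLTree) : Prop where
  finite : t.nodes.Finite
  root_mem : t.root ∈ t.nodes
  edges_mem : ∀ x y, (x, y) ∈ t.edges → x ∈ t.nodes ∧ y ∈ t.nodes
  root_no_parent : ∀ x, (x, t.root) ∉ t.edges
  unique_parent : ∀ y ∈ t.nodes, y ≠ t.root → ∃! x, (x, y) ∈ t.edges
  reachable : ∀ y ∈ t.nodes, Relation.ReflTransGen (fun x y => (x, y) ∈ t.edges) t.root y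

/-- The descendants of `n` in `t`, including `n` itself. -/
def desc (t : XMLTree) (n : ℕ) : Set ℕ :=
  {m | Relation.ReflTransGen (fun x y => (x, y) ∈ t.edges) n m}

/-- Isomorphism of XML trees. -/
def Iso (t₁ t₂ : XMLTree) : Prop :=
  ∃ h : ℕ → ℕ, Set.BijOn h t₁.nodes t₂.nodes ∧ h t₁.root = t₂.root ∧
    (∀ x ∈ t₁.nodes, ∀ y ∈ t₁.nodes, (x, y) ∈ t₁.edges ↔ (h x, h y) ∈ t₂.edges) ∧
    (∀ x ∈ t₁.nodes, t₁.lab x = t₂.lab (h x)) ∧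
    (∀ x ∈ t₁.nodes, t₁.lab x = none → t₁.val x = t₂.val (h x))

end XMLTree

/-- `t` conforms to `D` at element type `A`, that is `t ∈ I_D(A)`. -/
structure DTD.ConformsAt (D : DTD) (A : Label) (t : XMLTree) : Prop where
  isTree : t.IsTree
  root_lab : t.lab t.root = some A
  lab_mem : ∀ n ∈ t.nodes, ∀ B, t.lab n = some B → B ∈ D.ele
  /-- The children of a node labeled `B` can be listed so that their labels form a word of the
  language of `Rg(B)`. -/
  children : ∀ n ∈ t.nodes, ∀ B, t.lab n = some B →
    ∃ l : List ℕ, l.Nodup ∧ (∀ m, m ∈ l ↔ (n, m) ∈ t.edges) ∧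
      l.map t.lab ∈ (D.rg B).language
  text_leaf : ∀ n ∈ t.nodes, t.lab n = none → (t.val n).isSome ∧ ∀ m, (n, m) ∉ t.edges

/-- `t` is a valid instance of `D`, that is `t ∈ I_D`. -/
def DTD.Conforms (D : DTD) (t : XMLTree) : Prop := D.ConformsAt D.rt t

/-! ### Updates -/

/-- Atomic updates `insert(n,t)`, `delete(n)`, `replace(n,t)`, `replace(n,s)`. -/
inductive Update
  | insert (n : ℕ) (u : XMLTree)
  | delete (n : ℕ)
  | replace (n : ℕ) (u : XMLTree)
  | replaceText (n : ℕ) (s : String)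

namespace Update

/-- `op` is valid with respect to `t`: its node is in `t`, and its tree does not overlap `t`. -/
def ValidOn (t : XMLTree) : Update → Prop
  | insert n u => n ∈ t.nodes ∧ Disjoint t.nodes u.nodes
  | delete n => n ∈ t.nodes
  | replace n u => n ∈ t.nodes ∧ Disjoint t.nodes u.nodes
  | replaceText n _ => n ∈ t.nodes

open Classical in
/-- The result of an update on a tree. Deleting or replacing at `n` removes all of `desc n`
together with every edge that touches it. -/
noncomputable def apply (t : XMLTree) : Update → XMLTree
  | insert n u =>
    { nodes := t.nodes ∪ u.nodes
      edges := t.edges ∪ u.edges ∪ {(n, u.root)}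
      lab := fun m => if m ∈ u.nodes then u.lab m else t.lab m
      root := t.root
      val := fun m => if m ∈ u.nodes then u.val m else t.val m }
  | delete n =>
    { nodes := t.nodes \ t.desc n
      edges := {e ∈ t.edges | e.1 ∉ t.desc n ∧ e.2 ∉ t.desc n}
      lab := t.lab
      root := t.root
      val := t.val }
  | replace n u =>
    { nodes := (t.nodes \ t.desc n) ∪ u.nodes
      edges := {e ∈ t.edges | e.1 ∉ t.desc n ∧ e.2 ∉ t.desc n} ∪ u.edges ∪
        {e | (e.1, n) ∈ t.edges ∧ e.2 = u.root}
      lab := fun m => if m ∈ u.nodes then u.lab m else t.lab m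
      root := t.root
      val := fun m => if m ∈ u.nodes then u.val m else t.val m }
  | replaceText n s =>
    { t with val := Function.update t.val n (some s) }

/-- The result of `op₁; …; opₙ` on a tree. -/
noncomputable def applySeq : XMLTree → List Update → XMLTree
  | t, [] => t
  | t, op :: ops => applySeq (op.apply t) ops

end Update

/-! ### Update access types and policies -/

/-- Update access types `(A, insert(B))`, `(A, delete(B))`, `(A, replace(B,B'))`,
`(A, replace(str,str))`. -/
inductive UAT
  | insert (A B : Label)
  | delete (A B : Label)
  | replace (A B B' : Label)
  | replaceText (A : Label)

/-- The update access types that are valid for `D`. -/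
def DTD.validUATs (D : DTD) : Set UAT :=
  {u | match u with
    | .insert A B => A ∈ D.ele ∧ D.rg A = .star B
    | .delete A B => A ∈ D.ele ∧ D.rg A = .star B
    | .replace A B B' => A ∈ D.ele ∧ ∃ Bs, D.rg A = .alt Bs ∧ B ∈ Bs ∧ B' ∈ Bs ∧ B ≠ B'
    | .replaceText A => A ∈ D.ele ∧ D.rg A = .text}

/-- `D.Matches t op u`: the update `op` matches the update access type `u` on `t`. -/
def DTD.Matches (D : DTD) (t : XMLTree) : Update → UAT → Prop
  | .insert n u, .insert A B => t.lab n = some A ∧ D.ConformsAt B u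
  | .delete n, .delete A B =>
      t.lab n = some B ∧ ∃ p, (p, n) ∈ t.edges ∧ t.lab p = some A
  | .replace n u, .replace A B B' =>
      t.lab n = some B ∧ D.ConformsAt B' u ∧ B ≠ B' ∧
        ∃ p, (p, n) ∈ t.edges ∧ t.lab p = some A
  | .replaceText n _, .replaceText A =>
      t.lab n = none ∧ ∃ p, (p, n) ∈ t.edges ∧ t.lab p = some A
  | _, _ => False

/-- A (total or partial) security policy over `D`. -/
structure Policy (D : DTD) where
  allowed : Set UAT
  forbidden : Set UAT
  allowed_valid : allowed ⊆ D.validUATs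
  forbidden_valid : forbidden ⊆ D.validUATs
  disjoint : Disjoint allowed forbidden

namespace Policy

variable {D : DTD}

/-- The update sequence is valid and allowed by the policy on the given tree. -/
def AllowedSeq (P : Policy D) : XMLTree → List Update → Prop
  | _, [] => True
  | t, op :: ops =>
    op.ValidOn t ∧ (∃ u ∈ P.allowed, D.Matches t op u) ∧ P.AllowedSeq (op.apply t) ops

/-- The policy is consistent: on no instance of the DTD can a forbidden update that changes the
tree be simulated by an allowed sequence of updates. -/
def Consistent (P : Policy D) : Prop :=
  ∀ t : XMLTree, D.Conforms t →
    ¬ ∃ (op₀ : Update) (ops : List Update),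
      op₀.ValidOn t ∧ (∃ u ∈ P.forbidden, D.Matches t op₀ u) ∧
      ¬ (op₀.apply t).Iso t ∧
      P.AllowedSeq t ops ∧
      (Update.applySeq t ops).Iso (op₀.apply t)

end Policy

/-! ### Policies as input words -/

/-- A listing of a DTD and a policy over it. -/
structure Presentation where
  rt : Label
  rules : List (Label × Content)
  allowed : List UAT
  forbidden : List UAT

/-- `I` lists the root type and the production rules of `D` and the allowed and forbidden update
access types of `P` (in any order, possibly with repetitions). -/
structure Presentation.Describes (I : Presentation) (D : DTD) (P : Policy D) : Prop where
  rt_eq : I.rt = D.rt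
  rules_iff : ∀ A c, (A, c) ∈ I.rules ↔ A ∈ D.ele ∧ D.rg A = c
  allowed_iff : ∀ u, u ∈ I.allowed ↔ u ∈ P.allowed
  forbidden_iff : ∀ u, u ∈ I.forbidden ↔ u ∈ P.forbidden

/-- The input alphabet. -/
inductive Sym
  | bit (b : Bool)
  | endLabel
  | endList
  | text
  | empty
  | seq
  | alt
  | star
  | insert
  | delete
  | replace
  | replaceText
  deriving DecidableEq, Fintype

def encodeLabel (l : Label) : List Sym := l.map Sym.bit ++ [Sym.endLabel]

/-- A list is written item by item and closed by `endList`. -/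
def encodeList {α : Type} (f : α → List Sym) (l : List α) : List Sym :=
  l.flatMap f ++ [Sym.endList]

def encodeContent : Content → List Sym
  | .text => [Sym.text]
  | .empty => [Sym.empty]
  | .seq Bs => Sym.seq :: encodeList encodeLabel Bs
  | .alt Bs => Sym.alt :: encodeList encodeLabel Bs
  | .star B => Sym.star :: encodeLabel B

def encodeRule (r : Label × Content) : List Sym := encodeLabel r.1 ++ encodeContent r.2

def encodeUAT : UAT → List Sym
  | .insert A B => Sym.insert :: (encodeLabel A ++ encodeLabel B)
  | .delete A B => Sym.delete :: (encodeLabel A ++ encodeLabel B)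
  | .replace A B B' => Sym.replace :: (encodeLabel A ++ (encodeLabel B ++ encodeLabel B'))
  | .replaceText A => Sym.replaceText :: encodeLabel A

def Presentation.encode (I : Presentation) : List Sym :=
  encodeLabel I.rt ++ (encodeList encodeRule I.rules ++
    (encodeList encodeUAT I.allowed ++ encodeList encodeUAT I.forbidden))

/-- The decision problem: the words that present a policy over some DTD that is consistent. -/
def consistencyProblem : Language Sym :=
  {w | ∃ (I : Presentation) (D : DTD) (P : Policy D),
    I.encode = w ∧ I.Describes D P ∧ P.Consistent}

/-! The encoding is injective, so that an input word presents at most one policy. -/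

theorem encodeLabel_cancel (a b : Label) (r s : List Sym)
    (h : encodeLabel a ++ r = encodeLabel b ++ s) : a = b ∧ r = s := by
  induction a generalizing b with
  | nil => cases b <;> simp_all [encodeLabel]
  | cons x a ih =>
    cases b with
    | nil => simp [encodeLabel] at h
    | cons y b =>
      simp only [encodeLabel, List.map_cons, List.cons_append, List.cons.injEq,
        Sym.bit.injEq] at h
      obtain ⟨rfl, h⟩ := h
      obtain ⟨rfl, rfl⟩ := ih b h
      exact ⟨rfl, rfl⟩

theorem encodeLabel_ne (a : Label) (r s : List Sym) :
    encodeLabel a ++ r ≠ Sym.endList :: s := by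
  cases a <;> simp [encodeLabel]

theorem encodeList_cancel {α : Type} (f : α → List Sym)
    (hf : ∀ a b r s, f a ++ r = f b ++ s → a = b ∧ r = s)
    (hn : ∀ a r s, f a ++ r ≠ Sym.endList :: s) (l m : List α) (r s : List Sym)
    (h : encodeList f l ++ r = encodeList f m ++ s) : l = m ∧ r = s := by
  induction l generalizing m with
  | nil =>
    cases m with
    | nil => simpa [encodeList] using h
    | cons y m =>
      simp only [encodeList, List.flatMap_nil, List.flatMap_cons, List.nil_append,
        List.append_assoc, List.cons_append] at h
      exact absurd h.symm (hn _ _ _)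
  | cons x l ih =>
    cases m with
    | nil =>
      simp only [encodeList, List.flatMap_nil, List.flatMap_cons, List.nil_append,
        List.append_assoc, List.cons_append] at h
      exact absurd h (hn _ _ _)
    | cons y m =>
      simp only [encodeList, List.flatMap_cons, List.append_assoc] at h
      obtain ⟨rfl, h⟩ := hf _ _ _ _ h
      obtain ⟨rfl, rfl⟩ := ih m (by simpa [encodeList] using h)
      exact ⟨rfl, rfl⟩

theorem encodeContent_cancel (a b : Content) (r s : List Sym)
    (h : encodeContent a ++ r = encodeContent b ++ s) : a = b ∧ r = s := by
  cases a <;> cases b <;> simp [encodeContent] at h ⊢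
  · exact h
  · exact h
  · exact encodeList_cancel _ encodeLabel_cancel encodeLabel_ne _ _ _ _ h
  · exact encodeList_cancel _ encodeLabel_cancel encodeLabel_ne _ _ _ _ h
  · exact encodeLabel_cancel _ _ _ _ h

theorem encodeRule_cancel (a b : Label × Content) (r s : List Sym)
    (h : encodeRule a ++ r = encodeRule b ++ s) : a = b ∧ r = s := by
  simp only [encodeRule, List.append_assoc] at h
  obtain ⟨h₁, h⟩ := encodeLabel_cancel _ _ _ _ h
  obtain ⟨h₂, h⟩ := encodeContent_cancel _ _ _ _ h
  exact ⟨Prod.ext h₁ h₂, h⟩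

theorem encodeUAT_cancel (a b : UAT) (r s : List Sym)
    (h : encodeUAT a ++ r = encodeUAT b ++ s) : a = b ∧ r = s := by
  cases a <;> cases b <;> simp [encodeUAT] at h ⊢
  · obtain ⟨h₁, h⟩ := encodeLabel_cancel _ _ _ _ h
    obtain ⟨h₂, h⟩ := encodeLabel_cancel _ _ _ _ h
    exact ⟨⟨h₁, h₂⟩, h⟩
  · obtain ⟨h₁, h⟩ := encodeLabel_cancel _ _ _ _ h
    obtain ⟨h₂, h⟩ := encodeLabel_cancel _ _ _ _ h
    exact ⟨⟨h₁, h₂⟩, h⟩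
  · obtain ⟨h₁, h⟩ := encodeLabel_cancel _ _ _ _ h
    obtain ⟨h₂, h⟩ := encodeLabel_cancel _ _ _ _ h
    obtain ⟨h₃, h⟩ := encodeLabel_cancel _ _ _ _ h
    exact ⟨⟨h₁, h₂, h₃⟩, h⟩
  · exact encodeLabel_cancel _ _ _ _ h

theorem Presentation.encode_injective : Function.Injective Presentation.encode := by
  intro I J h
  have hU : ∀ a r s, encodeUAT a ++ r ≠ Sym.endList :: s := by
    intro a r s
    cases a <;> simp [encodeUAT]
  have hR : ∀ a r s, encodeRule a ++ r ≠ Sym.endList :: s := by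
    intro a r s
    simp only [encodeRule, List.append_assoc]
    exact encodeLabel_ne _ _ _
  simp only [Presentation.encode] at h
  obtain ⟨h₁, h⟩ := encodeLabel_cancel _ _ _ _ h
  obtain ⟨h₂, h⟩ := encodeList_cancel _ encodeRule_cancel hR _ _ _ _ h
  obtain ⟨h₃, h⟩ := encodeList_cancel _ encodeUAT_cancel hU _ _ _ _ h
  obtain ⟨h₄, -⟩ := encodeList_cancel _ encodeUAT_cancel hU I.forbidden J.forbidden [] []
    (by simpa using h)
  cases I; cases J; simp_all

/-! ### Polynomial time -/

open Classical in
/-- The language `L` is in `PTIME`: a Turing machine decides, for every word over the alphabet,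
whether it belongs to `L`, in a number of steps polynomial in the length of the word. -/
def InPTIME {Γ : Type} (L : Language Γ) : Prop :=
  Nonempty (Turing.TM2ComputableInPolyTime (id : List Γ → List Γ) Computability.encodeBool
    (fun w => decide (w ∈ L)))

end XMLPolicy

/-! # Policy consistency is decidable in polynomial time

**The criterion.** A policy is inconsistent exactly if it has a bypass (`Policy.Bypass`): a
forbidden update type at a type `A` which occurs in instances of the DTD, such that the update
either is a replacement composed of allowed replacements at `A`, or takes place inside an `E`-tree
below a `C`-node which can be exchanged for any other `E`-tree (`Policy.Resets`), because the policy
allows both to insert and to delete `E`-children of `C`-nodes, or because allowed replacements at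
`C` lead in a cycle from `E` back to `E`.

A bypass is easily turned into an inconsistency: every type has instances, which can be put into a
context and exchanged there (`Policy.not_consistent_of_bypass`). Conversely, consider for a type
`C` and a condition `Q` the number of edges from `C`-nodes to children that satisfy `Q`, where a
condition refers to the label or the text of the child. These numbers are invariant under
isomorphism. An update changes them by exchanging one child of one node, apart from those at types
that may occur inside the subtrees which it adds or removes (`DTD.Sound.effect`). Suppose that an
allowed sequence simulates a forbidden update at `A`, without a bypass. Then no step of the
sequence moves a subtree that may contain `A`-nodes (`Policy.not_reach_of_balance`): for the
topmost type `C` at which this happens, the relevant numbers at `C` would change in one direction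
only, since inserting and deleting are not both allowed, or since the labels that allowed
replacements can make of a given one form an up-set which is entered and never left; but the
forbidden update leaves the numbers at `C` as they are. So the numbers at `A` change by the steps
at `A` only, and, the forbidden type not being allowed nor a composition of allowed replacements,
these cannot have its effect (`Policy.consistent_of_not_bypass`).

**The algorithm.** The criterion (`Policy.consistent_iff`) and the well-formedness of the input
amount to finitely bounded quantifiers over the lists of a presentation and reachability in two
finite graphs, the DTD graph and the graph of allowed replacements. Reachability takes one round
of expansion for each edge (`mem_closure`).

**The machine.** Structured programs over finitely many stacks are compiled to multi-stack Turing
machines (`Prog.Run.iterate_step`). Data are binary trees, written in prefix code on one stack,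
where a tree can be removed, duplicated or moved by counting its pending subtrees. Functions
computed by such programs in polynomial time (`Poly`) are closed under composition, pairing, case
distinction and loops over lists whose state stays polynomially bounded (`Poly.foldl_of_bounded`),
which covers the decoding of input words (`exists_parse`), the closure computation and all bounded
quantifiers. A language with a polynomial-time test in this sense is in `PTIME`
(`inPTIME_of_polyPred`). -/

namespace XMLPolicy

/-! ### Structured stack programs -/

/-- While-programs over a family `Γ` of stack alphabets and a finite register of type `σ`. -/
inductive Prog {K : Type} (Γ : K → Type) (σ : Type)
  | push (k : K) (f : σ → Γ k)
  | pop (k : K) (f : σ → Option (Γ k) → σ)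
  | load (f : σ → σ)
  | seq (p q : Prog Γ σ)
  | ite (c : σ → Bool) (p q : Prog Γ σ)
  | loop (c : σ → Bool) (p : Prog Γ σ)

namespace Prog

variable {K : Type} [DecidableEq K] {Γ : K → Type} {σ : Type}

/-- `Run p r S n r' S'`: started with register `r` and stacks `S`, the program `p` stops after
exactly `n` machine steps with register `r'` and stacks `S'`. -/
inductive Run : Prog Γ σ → σ → (∀ k, List (Γ k)) → ℕ → σ → (∀ k, List (Γ k)) → Prop
  | push {k f r S} : Run (.push k f) r S 1 r (Function.update S k (f r :: S k))
  | pop {k f r S} : Run (.pop k f) r S 1 (f r (S k).head?) (Function.update S k (S k).tail)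
  | load {f r S} : Run (.load f) r S 1 (f r) S
  | seq {p q r S n r' S' m r'' S''} (hp : Run p r S n r' S') (hq : Run q r' S' m r'' S'') :
      Run (.seq p q) r S (n + m) r'' S''
  | ite_true {c p q r S n r' S'} (hc : c r = true) (hp : Run p r S n r' S') :
      Run (.ite c p q) r S (n + 1) r' S'
  | ite_false {c p q r S n r' S'} (hc : c r = false) (hq : Run q r S n r' S') :
      Run (.ite c p q) r S (n + 1) r' S'
  | loop_done {c p r S} (hc : c r = false) : Run (.loop c p) r S 1 r S
  | loop_step {c p r S n r' S' m r'' S''} (hc : c r = true) (hp : Run p r S n r' S')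
      (hl : Run (.loop c p) r' S' m r'' S'') : Run (.loop c p) r S (n + m + 1) r'' S''

/-- The control points of a program. -/
@[reducible] def Lab : Prog Γ σ → Type
  | .push _ _ => Unit
  | .pop _ _ => Unit
  | .load _ => Unit
  | .seq p q => Lab p ⊕ Lab q
  | .ite _ p q => Unit ⊕ (Lab p ⊕ Lab q)
  | .loop _ p => Unit ⊕ Lab p

/-- A program has finitely many control points. -/
@[reducible] def labFintype : (p : Prog Γ σ) → Fintype (Lab p)
  | .push _ _ => inferInstanceAs (Fintype Unit)
  | .pop _ _ => inferInstanceAs (Fintype Unit)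
  | .load _ => inferInstanceAs (Fintype Unit)
  | .seq p q =>
    letI := labFintype p
    letI := labFintype q
    inferInstanceAs (Fintype (Lab p ⊕ Lab q))
  | .ite _ p q =>
    letI := labFintype p
    letI := labFintype q
    inferInstanceAs (Fintype (Unit ⊕ (Lab p ⊕ Lab q)))
  | .loop _ p =>
    letI := labFintype p
    inferInstanceAs (Fintype (Unit ⊕ Lab p))

/-- The control point at which a program starts. -/
def entry : (p : Prog Γ σ) → Lab p
  | .push _ _ => ()
  | .pop _ _ => ()
  | .load _ => ()
  | .seq p _ => Sum.inl (entry p)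
  | .ite _ _ _ => Sum.inl ()
  | .loop _ _ => Sum.inl ()

/-- The machine code of a program whose control points are embedded into the labels `Λ` of a
machine by `e`, and which continues at the label `exit`. -/
def code {Λ : Type} : (p : Prog Γ σ) → (Lab p → Λ) → Λ → Lab p → Turing.TM2.Stmt Γ Λ σ
  | .push k f, _, exit, _ => .push k f (.goto fun _ => exit)
  | .pop k f, _, exit, _ => .pop k f (.goto fun _ => exit)
  | .load f, _, exit, _ => .load f (.goto fun _ => exit)
  | .seq p q, e, _, Sum.inl l => code p (fun l => e (Sum.inl l)) (e (Sum.inr (entry q))) l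
  | .seq _ q, e, exit, Sum.inr l => code q (fun l => e (Sum.inr l)) exit l
  | .ite c p q, e, _, Sum.inl _ =>
    .branch c (.goto fun _ => e (Sum.inr (Sum.inl (entry p))))
      (.goto fun _ => e (Sum.inr (Sum.inr (entry q))))
  | .ite _ p _, e, exit, Sum.inr (Sum.inl l) => code p (fun l => e (Sum.inr (Sum.inl l))) exit l
  | .ite _ _ q, e, exit, Sum.inr (Sum.inr l) => code q (fun l => e (Sum.inr (Sum.inr l))) exit l
  | .loop c p, e, exit, Sum.inl _ =>
    .branch c (.goto fun _ => e (Sum.inr (entry p))) (.goto fun _ => exit)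
  | .loop _ p, e, _, Sum.inr l => code p (fun l => e (Sum.inr l)) (e (Sum.inl ())) l

/-- A machine that contains the code of `p` simulates the runs of `p` step by step. -/
theorem Run.iterate_step {p : Prog Γ σ} {r S n r' S'} (h : Run p r S n r' S') {Λ : Type}
    (M : Λ → Turing.TM2.Stmt Γ Λ σ) (e : Lab p → Λ) (exit : Λ)
    (hM : ∀ l, M (e l) = code p e exit l) :
    (flip bind (Turing.TM2.step M))^[n] (some ⟨some (e (entry p)), r, S⟩) =
      some ⟨some exit, r', S'⟩ := by
  induction h generalizing exit with
  | push | pop | load =>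
    have := hM ()
    simp only [code] at this
    simp [flip, entry, this]
  | @seq p q _ _ n _ _ m _ _ _ _ ih₁ ih₂ =>
    rw [Nat.add_comm, Function.iterate_add_apply]
    have h₁ := ih₁ (fun l => e (Sum.inl l)) (e (Sum.inr (entry q)))
      (fun l => hM (Sum.inl l))
    have h₂ := ih₂ (fun l => e (Sum.inr l)) exit (fun l => hM (Sum.inr l))
    simp only [entry]
    rw [h₁, h₂]
  | @ite_true c p q r S n r' S' hc _ ih =>
    have h₁ := ih (fun l => e (Sum.inr (Sum.inl l))) exit (fun l => hM (Sum.inr (Sum.inl l)))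
    rw [Function.iterate_succ_apply, ← h₁]
    have := hM (Sum.inl ())
    simp only [code] at this
    simp [flip, entry, this, hc]
  | @ite_false c p q r S n r' S' hc _ ih =>
    have h₁ := ih (fun l => e (Sum.inr (Sum.inr l))) exit (fun l => hM (Sum.inr (Sum.inr l)))
    rw [Function.iterate_succ_apply, ← h₁]
    have := hM (Sum.inl ())
    simp only [code] at this
    simp [flip, entry, this, hc]
  | loop_done hc =>
    have := hM (Sum.inl ())
    simp only [code] at this
    simp [flip, entry, this, hc]
  | @loop_step c p r S n r' S' m r'' S'' hc _ _ ih₁ ih₂ =>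
    have h₁ := ih₁ (fun l => e (Sum.inr l)) (e (Sum.inl ())) (fun l => hM (Sum.inr l))
    have h₂ := ih₂ e exit hM
    rw [show n + m + 1 = m + n + 1 by omega, Function.iterate_succ_apply,
      Function.iterate_add_apply, ← h₂]
    simp only [entry] at h₁ ⊢
    rw [← h₁]
    have := hM (Sum.inl ())
    simp only [code] at this
    simp [flip, this, hc]

end Prog

/-! ### Binary trees on a stack -/

/-- Binary trees: the data on which programs compute. -/
inductive Bin
  | nil
  | cons (a b : Bin)

/-- The prefix code of a binary tree. -/
def Bin.code : Bin → List Bool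
  | .nil => [false]
  | .cons a b => true :: (a.code ++ b.code)

/-- The number of nodes of a binary tree. -/
def Bin.size : Bin → ℕ
  | .nil => 1
  | .cons a b => a.size + b.size + 1

theorem Bin.size_pos (a : Bin) : 1 ≤ a.size := by cases a <;> simp [Bin.size]

/-- The stacks of the machine: the input, the main stack `val`, two stacks `aux` and `tmp` on which
trees are put aside, and a stack `cnt` used as a counter. -/
inductive Stk
  | inp
  | val
  | aux
  | tmp
  | cnt
  deriving DecidableEq

instance : Fintype Stk := ⟨{.inp, .val, .aux, .tmp, .cnt}, fun k => by cases k <;> simp⟩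

/-- The stack alphabets. On `aux` and `tmp` the symbol `none` marks the end of a tree. -/
@[reducible] def Stk.Alph : Stk → Type
  | .inp => Sym
  | .val => Bool
  | .aux => Option Bool
  | .tmp => Option Bool
  | .cnt => Bool

/-- The register: the last bit and the last input symbol that were read. -/
abbrev Reg := Option Bool × Option Sym

/-- The contents of all stacks. -/
abbrev Store := ∀ k : Stk, List k.Alph

/-- The store with given stacks. -/
def mkStore (i : List Sym) (v : List Bool) (u x : List (Option Bool)) (w : List Bool) : Store
  | .inp => i
  | .val => v
  | .aux => u
  | .tmp => x
  | .cnt => w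

section update

variable (i : List Sym) (v : List Bool) (u x : List (Option Bool)) (w : List Bool)

theorem update_mkStore_inp (i') : Function.update (mkStore i v u x w) .inp i' =
    mkStore i' v u x w := by
  funext k; cases k <;> simp [mkStore]

theorem update_mkStore_v (v') : Function.update (mkStore i v u x w) .val v' =
    mkStore i v' u x w := by
  funext k; cases k <;> simp [mkStore]

theorem update_mkStore_u (u') : Function.update (mkStore i v u x w) .aux u' =
    mkStore i v u' x w := by
  funext k; cases k <;> simp [mkStore]

theorem update_mkStore_x (x') : Function.update (mkStore i v u x w) .tmp x' =
    mkStore i v u x' w := by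
  funext k; cases k <;> simp [mkStore]

theorem update_mkStore_w (w') : Function.update (mkStore i v u x w) .cnt w' =
    mkStore i v u x w' := by
  funext k; cases k <;> simp [mkStore]

end update

/-- Programs for the machine. -/
abbrev Program := Prog Stk.Alph Reg

namespace Program

open Prog

variable {i : List Sym} {v : List Bool} {u x : List (Option Bool)} {w : List Bool}
variable {r r' : Reg}

-- Single steps. A step that pops a symbol stores it in the register, where an end mark is not
-- distinguished from an empty stack.
abbrev pushV (f : Reg → Bool) : Program := .push .val f
abbrev pushU (f : Reg → Option Bool) : Program := .push .aux f
abbrev pushX (f : Reg → Option Bool) : Program := .push .tmp f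
abbrev pushW (f : Reg → Bool) : Program := .push .cnt f
abbrev popV : Program := .pop .val fun r b => (b, r.2)
abbrev popU : Program := .pop .aux fun r b => (b.join, r.2)
abbrev popX : Program := .pop .tmp fun r b => (b.join, r.2)
abbrev popW : Program := .pop .cnt fun r b => (b, r.2)
abbrev skip : Program := .load id

theorem run_pushV (f) : Run (pushV f) r (mkStore i v u x w) 1 r (mkStore i (f r :: v) u x w) := by
  have := @Run.push _ _ Stk.Alph Reg .val f r (mkStore i v u x w)
  rwa [update_mkStore_v] at this

theorem run_pushU (f) : Run (pushU f) r (mkStore i v u x w) 1 r (mkStore i v (f r :: u) x w) := by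
  have := @Run.push _ _ Stk.Alph Reg .aux f r (mkStore i v u x w)
  rwa [update_mkStore_u] at this

theorem run_pushX (f) : Run (pushX f) r (mkStore i v u x w) 1 r (mkStore i v u (f r :: x) w) := by
  have := @Run.push _ _ Stk.Alph Reg .tmp f r (mkStore i v u x w)
  rwa [update_mkStore_x] at this

theorem run_pushW (f) : Run (pushW f) r (mkStore i v u x w) 1 r (mkStore i v u x (f r :: w)) := by
  have := @Run.push _ _ Stk.Alph Reg .cnt f r (mkStore i v u x w)
  rwa [update_mkStore_w] at this

theorem run_popV : Run popV r (mkStore i v u x w) 1 (v.head?, r.2) (mkStore i v.tail u x w) := by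
  have := @Run.pop _ _ Stk.Alph Reg .val (fun r b => (b, r.2)) r (mkStore i v u x w)
  rwa [update_mkStore_v] at this

theorem run_popU : Run popU r (mkStore i v u x w) 1 (u.head?.join, r.2)
    (mkStore i v u.tail x w) := by
  have := @Run.pop _ _ Stk.Alph Reg .aux (fun r b => (b.join, r.2)) r (mkStore i v u x w)
  rwa [update_mkStore_u] at this

theorem run_popX : Run popX r (mkStore i v u x w) 1 (x.head?.join, r.2)
    (mkStore i v u x.tail w) := by
  have := @Run.pop _ _ Stk.Alph Reg .tmp (fun r b => (b.join, r.2)) r (mkStore i v u x w)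
  rwa [update_mkStore_x] at this

theorem run_popW : Run popW r (mkStore i v u x w) 1 (w.head?, r.2) (mkStore i v u x w.tail) := by
  have := @Run.pop _ _ Stk.Alph Reg .cnt (fun r b => (b, r.2)) r (mkStore i v u x w)
  rwa [update_mkStore_w] at this

theorem run_load (f) {S} : Run (.load f : Program) r S 1 (f r) S := Run.load

theorem run_skip {S} : Run skip r S 1 r S := Run.load

end Program

end XMLPolicy

namespace XMLPolicy

theorem Bin.length_code (t : Bin) : t.code.length = t.size := by
  induction t with
  | nil => rfl
  | cons a b iha ihb => simp [Bin.code, Bin.size, iha, ihb]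

namespace Program

open Prog

variable {i : List Sym} {v : List Bool} {u x : List (Option Bool)} {w : List Bool}
variable {r r' : Reg}

/-- Push the bit in the register on `aux` if `a`, and on `tmp` if `b`. -/
def record (a b : Bool) : Program :=
  .seq (if a then pushU Prod.fst else skip) (if b then pushX Prod.fst else skip)

/-- A stack after a list of bits has been recorded on it, or not, depending on the flag. -/
def recorded (a : Bool) (c : List Bool) (u : List (Option Bool)) : List (Option Bool) :=
  if a then (c.map some).reverse ++ u else u

theorem recorded_append (a : Bool) (c d : List Bool) (u) :
    recorded a d (recorded a c u) = recorded a (c ++ d) u := by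
  cases a <;> simp [recorded]

theorem run_record (a b : Bool) (e : Bool) (s) : Run (record a b) (some e, s)
    (mkStore i v u x w) 2 (some e, s) (mkStore i v (recorded a [e] u) (recorded b [e] x) w) := by
  unfold record
  refine Run.seq (n := 1) (m := 1) (r' := (some e, s))
    (S' := mkStore i v (recorded a [e] u) x w) ?_ ?_
  · cases a
    · exact run_skip
    · exact run_pushU _
  · cases b
    · exact run_skip
    · exact run_pushX _

/-- The loop that removes a tree from `val`. The counter stack holds one symbol `true` for every
pending subtree but one, above a symbol `false`; the loop ends when `false` is popped. -/
def moveLoop (a b : Bool) : Program :=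
  .loop (fun r => r.1 == some true) <| .seq popV <| .seq (record a b) <|
    .ite (fun r => r.1 == some true) (pushW fun _ => true) popW

/-- Reading a tree from `val` shrinks the counter stack by exactly one symbol: every inner node
adds one pending subtree, and every leaf completes one. -/
theorem run_moveLoop (a b : Bool) (t : Bin) {v u x m w s n r'' S''}
    (h : Run (moveLoop a b) (some m, s)
      (mkStore i v (recorded a t.code u) (recorded b t.code x) w) n r'' S'') :
    Run (moveLoop a b) (some true, s) (mkStore i (t.code ++ v) u x (m :: w))
      (n + 6 * t.size) r'' S'' := by
  induction t generalizing v u x m w n r'' S'' with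
  | nil =>
    have h₁ : Run popV (some true, s) (mkStore i (Bin.nil.code ++ v) u x (m :: w)) 1
      (some false, s) (mkStore i v u x (m :: w)) := run_popV
    have h₂ := run_record (i := i) (v := v) (u := u) (x := x) (w := m :: w) a b false s
    have h₃ : Run popW (some false, s)
      (mkStore i v (recorded a [false] u) (recorded b [false] x) (m :: w)) 1
      (some m, s) (mkStore i v (recorded a [false] u) (recorded b [false] x) w) := run_popW
    have h₄ := Run.loop_step (c := fun r : Reg => r.1 == some true) (r := (some true, s)) rfl
      (Run.seq h₁ (Run.seq h₂ (Run.ite_false (c := fun r : Reg => r.1 == some true)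
        (p := pushW fun _ => true) rfl h₃))) h
    convert h₄ using 1
    · rfl
    · simp [Bin.size]; omega
  | cons t₁ t₂ ih₁ ih₂ =>
    have h₁ : Run popV (some true, s) (mkStore i ((Bin.cons t₁ t₂).code ++ v) u x (m :: w)) 1
      (some true, s) (mkStore i (t₁.code ++ (t₂.code ++ v)) u x (m :: w)) := by
      rw [← List.append_assoc]; exact run_popV
    have h₂ := run_record (i := i) (v := t₁.code ++ (t₂.code ++ v)) (u := u) (x := x)
      (w := m :: w) a b true s
    have h₃ := run_pushW (i := i) (v := t₁.code ++ (t₂.code ++ v)) (u := recorded a [true] u)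
      (x := recorded b [true] x) (w := m :: w) (r := (some true, s)) (fun _ => true)
    have hc : (Bin.cons t₁ t₂).code = [true] ++ t₁.code ++ t₂.code := by simp [Bin.code]
    rw [hc, ← recorded_append, ← recorded_append, ← recorded_append, ← recorded_append] at h
    have h₄ := Run.loop_step (c := fun r : Reg => r.1 == some true) (r := (some true, s)) rfl
      (Run.seq h₁ (Run.seq h₂ (Run.ite_true (c := fun r : Reg => r.1 == some true)
        (q := popW) rfl h₃))) (ih₁ (ih₂ h))
    convert h₄ using 1
    · rfl
    · simp [Bin.size]; omega

/-- Remove the top tree from `val`, recording its code in reverse on `aux` and `tmp` as the flags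
say. -/
def move (a b : Bool) : Program :=
  .seq (pushW fun _ => false) <| .seq (.load fun r => (some true, r.2)) (moveLoop a b)

theorem run_move (a b : Bool) (t : Bin) :
    Run (move a b) r (mkStore i (t.code ++ v) u x w) (6 * t.size + 3) (some false, r.2)
      (mkStore i v (recorded a t.code u) (recorded b t.code x) w) := by
  have h₁ : Run (moveLoop a b) (some false, r.2)
    (mkStore i v (recorded a t.code u) (recorded b t.code x) w) 1 _ _ := Run.loop_done rfl
  have h₂ := Run.seq (run_pushW (r := r) (fun _ => false))
    (Run.seq (run_load fun r => (some true, r.2)) (run_moveLoop a b t h₁))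
  convert h₂ using 1
  · rfl
  · omega

/-- Move a marked word from `aux` to `val`. -/
def restoreU : Program :=
  .seq popU <| .loop (fun r => r.1.isSome) <| .seq (pushV fun r => r.1.getD false) popU

/-- Move a marked word from `tmp` to `val`. -/
def restoreX : Program :=
  .seq popX <| .loop (fun r => r.1.isSome) <| .seq (pushV fun r => r.1.getD false) popX

theorem run_restoreU (c : List Bool) :
    ∃ n ≤ 3 * c.length + 2, Run restoreU r (mkStore i v (recorded true c (none :: u)) x w) n
      (none, r.2) (mkStore i (c ++ v) u x w) := by
  have key : ∀ (d : List Bool) (b : Bool) (v : List Bool),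
      Run (.loop (fun r => r.1.isSome) <| .seq (pushV fun r => r.1.getD false) popU : Program)
        (some b, r.2) (mkStore i v (d.map some ++ none :: u) x w) (3 * d.length + 4)
        (none, r.2) (mkStore i (d.reverse ++ b :: v) u x w) := by
    intro d
    induction d with
    | nil =>
      intro b v
      exact Run.loop_step (n := 2) rfl (Run.seq (run_pushV _) run_popU) (Run.loop_done rfl)
    | cons e d ih =>
      intro b v
      have := Run.loop_step (c := fun r : Reg => r.1.isSome) (r := (some b, r.2)) rfl
        (Run.seq (run_pushV (v := v) (u := (e :: d).map some ++ none :: u) (x := x) (w := w)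
          (i := i) (fun r => r.1.getD false)) run_popU) (ih e (b :: v))
      convert this using 1
      · simp; omega
      · simp
  obtain ⟨d, rfl⟩ : ∃ d, c = d.reverse := ⟨c.reverse, by simp⟩
  cases d with
  | nil => exact ⟨2, by simp, Run.seq (n := 1) (m := 1) run_popU (Run.loop_done rfl)⟩
  | cons b d =>
    refine ⟨1 + (3 * d.length + 4), by simp; omega, Run.seq (r' := (some b, r.2))
      (S' := mkStore i v (d.map some ++ none :: u) x w) ?_ ?_⟩
    · have := run_popU (i := i) (v := v) (u := recorded true (b :: d).reverse (none :: u)) (x := x)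
        (w := w) (r := r)
      simpa [recorded] using this
    · simpa using key d b v

theorem run_restoreX (c : List Bool) :
    ∃ n ≤ 3 * c.length + 2, Run restoreX r (mkStore i v u (recorded true c (none :: x)) w) n
      (none, r.2) (mkStore i (c ++ v) u x w) := by
  have key : ∀ (d : List Bool) (b : Bool) (v : List Bool),
      Run (.loop (fun r => r.1.isSome) <| .seq (pushV fun r => r.1.getD false) popX : Program)
        (some b, r.2) (mkStore i v u (d.map some ++ none :: x) w) (3 * d.length + 4)
        (none, r.2) (mkStore i (d.reverse ++ b :: v) u x w) := by
    intro d
    induction d with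
    | nil =>
      intro b v
      exact Run.loop_step (n := 2) rfl (Run.seq (run_pushV _) run_popX) (Run.loop_done rfl)
    | cons e d ih =>
      intro b v
      have := Run.loop_step (c := fun r : Reg => r.1.isSome) (r := (some b, r.2)) rfl
        (Run.seq (run_pushV (v := v) (u := u) (x := (e :: d).map some ++ none :: x) (w := w)
          (i := i) (fun r => r.1.getD false)) run_popX) (ih e (b :: v))
      convert this using 1
      · simp; omega
      · simp
  obtain ⟨d, rfl⟩ : ∃ d, c = d.reverse := ⟨c.reverse, by simp⟩
  cases d with
  | nil => exact ⟨2, by simp, Run.seq (n := 1) (m := 1) run_popX (Run.loop_done rfl)⟩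
  | cons b d =>
    refine ⟨1 + (3 * d.length + 4), by simp; omega, Run.seq (r' := (some b, r.2))
      (S' := mkStore i v u (d.map some ++ none :: x) w) ?_ ?_⟩
    · have := run_popX (i := i) (v := v) (x := recorded true (b :: d).reverse (none :: x)) (u := u)
        (w := w) (r := r)
      simpa [recorded] using this
    · simpa using key d b v

/-! ### Programs that rewrite the top of the main stack -/

/-- `Maps p a b n`: within `n` steps `p` replaces the word `a` on top of `val` by `b`, and changes
nothing else but the register. -/
def Maps (p : Program) (a b : List Bool) (n : ℕ) : Prop :=
  ∀ r i v u x w, ∃ m ≤ n, ∃ r', Run p r (mkStore i (a ++ v) u x w) m r' (mkStore i (b ++ v) u x w)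

theorem Maps.mono {p a b n n'} (h : Maps p a b n) (hn : n ≤ n') : Maps p a b n' :=
  fun r i v u x w =>
    let ⟨m, hm, hr⟩ := h r i v u x w
    ⟨m, hm.trans hn, hr⟩

theorem Maps.seq {p q a b c n m} (hp : Maps p a b n) (hq : Maps q b c m) :
    Maps (.seq p q) a c (n + m) := by
  intro r i v u x w
  obtain ⟨k, hk, r', h⟩ := hp r i v u x w
  obtain ⟨l, hl, r'', h'⟩ := hq r' i v u x w
  exact ⟨k + l, Nat.add_le_add hk hl, r'', h.seq h'⟩

theorem Maps.append {p a b n} (h : Maps p a b n) (d : List Bool) :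
    Maps p (a ++ d) (b ++ d) n := by
  intro r i v u x w
  simpa using h r i (d ++ v) u x w

theorem maps_skip (a) : Maps skip a a 1 := fun r _ _ _ _ _ => ⟨1, le_rfl, r, run_skip⟩

/-- Push a word on `val`. -/
def emit : List Bool → Program
  | [] => skip
  | b :: c => .seq (emit c) (pushV fun _ => b)

theorem maps_emit (c) : Maps (emit c) [] c (c.length + 1) := by
  induction c with
  | nil => exact maps_skip _
  | cons b c ih =>
    refine Maps.seq ih (m := 1) ?_
    exact fun r _ _ _ _ _ => ⟨1, le_rfl, r, run_pushV _⟩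

/-- Remove the top tree. -/
def drop : Program := move false false

theorem maps_drop (t : Bin) : Maps drop t.code [] (9 * t.size) := by
  intro r i v u x w
  have := t.size_pos
  exact ⟨6 * t.size + 3, by omega, _, run_move false false t⟩

/-- Duplicate the top tree. -/
def dup : Program :=
  .seq (pushU fun _ => none) <| .seq (pushX fun _ => none) <| .seq (move true true) <|
    .seq restoreU restoreX

theorem maps_dup (t : Bin) : Maps dup t.code (t.code ++ t.code) (21 * t.size) := by
  intro r i v u x w
  have h₁ := run_pushU (i := i) (v := t.code ++ v) (u := u) (x := x) (w := w) (r := r)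
    (fun _ => none)
  have h₂ := run_pushX (i := i) (v := t.code ++ v) (u := none :: u) (x := x) (w := w) (r := r)
    (fun _ => none)
  have h₃ := run_move (i := i) (v := v) (u := none :: u) (x := none :: x) (w := w) (r := r)
    true true t
  obtain ⟨n, hn, h₄⟩ := run_restoreU (i := i) (v := v) (u := u)
    (x := recorded true t.code (none :: x)) (w := w) (r := (some false, r.2)) t.code
  obtain ⟨m, hm, h₅⟩ := run_restoreX (i := i) (v := t.code ++ v) (u := u)
    (x := x) (w := w) (r := (none, r.2)) t.code
  rw [t.length_code] at hn hm
  have := t.size_pos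
  refine ⟨_, ?_, _, by simpa [dup] using h₁.seq (h₂.seq (h₃.seq (h₄.seq h₅)))⟩
  omega

/-- Exchange the two top trees. -/
def swap : Program :=
  .seq (pushU fun _ => none) <| .seq (move true false) <| .seq (pushX fun _ => none) <|
    .seq (move false true) <| .seq restoreU restoreX

theorem maps_swap (s t : Bin) :
    Maps swap (s.code ++ t.code) (t.code ++ s.code) (15 * (s.size + t.size)) := by
  intro r i v u x w
  have h₁ := run_pushU (i := i) (v := s.code ++ (t.code ++ v)) (u := u) (x := x) (w := w) (r := r)
    (fun _ => none)
  have h₂ := run_move (i := i) (v := t.code ++ v) (u := none :: u) (x := x) (w := w) (r := r)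
    true false s
  have h₃ := run_pushX (i := i) (v := t.code ++ v) (u := recorded true s.code (none :: u)) (x := x)
    (w := w) (r := (some false, r.2)) (fun _ => none)
  have h₄ := run_move (i := i) (v := v) (u := recorded true s.code (none :: u)) (x := none :: x)
    (w := w) (r := (some false, r.2)) false true t
  obtain ⟨n, hn, h₅⟩ := run_restoreU (i := i) (v := v) (u := u)
    (x := recorded true t.code (none :: x)) (w := w) (r := (some false, r.2)) s.code
  obtain ⟨m, hm, h₆⟩ := run_restoreX (i := i) (v := s.code ++ v) (u := u)
    (x := x) (w := w) (r := (none, r.2)) t.code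
  rw [Bin.length_code] at hn hm
  have := t.size_pos
  have := s.size_pos
  refine ⟨_, ?_, _, by simpa [swap] using h₁.seq (h₂.seq (h₃.seq (h₄.seq (h₅.seq h₆))))⟩
  omega

/-- Run `p` below the top tree. -/
def dip (p : Program) : Program :=
  .seq (pushU fun _ => none) <| .seq (move true false) <| .seq p restoreU

theorem Maps.dip {p a b n} (h : Maps p a b n) (t : Bin) :
    Maps (dip p) (t.code ++ a) (t.code ++ b) (15 * t.size + n) := by
  intro r i v u x w
  have h₁ := run_pushU (i := i) (v := t.code ++ (a ++ v)) (u := u) (x := x) (w := w) (r := r)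
    (fun _ => none)
  have h₂ := run_move (i := i) (v := a ++ v) (u := none :: u) (x := x) (w := w) (r := r)
    true false t
  obtain ⟨m, hm, r', h₃⟩ := h (some false, r.2) i v (recorded true t.code (none :: u)) x w
  obtain ⟨k, hk, h₄⟩ := run_restoreU (i := i) (v := b ++ v) (u := u)
    (x := x) (w := w) (r := r') t.code
  rw [Bin.length_code] at hk
  have := t.size_pos
  refine ⟨_, ?_, _, by simpa [Program.dip] using h₁.seq (h₂.seq (h₃.seq h₄))⟩
  omega

/-- Remove the top bit and branch on it. -/
def ifTop (p q : Program) : Program := .seq popV (.ite (fun r => r.1 == some true) p q)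

theorem Maps.ifTop_true {p a b n} (h : Maps p a b n) (q) :
    Maps (ifTop p q) (true :: a) b (n + 2) := by
  intro r i v u x w
  obtain ⟨m, hm, r', h'⟩ := h (some true, r.2) i v u x w
  exact ⟨1 + (m + 1), by omega, r', Run.seq run_popV (Run.ite_true rfl h')⟩

theorem Maps.ifTop_false {q a b n} (h : Maps q a b n) (p) :
    Maps (ifTop p q) (false :: a) b (n + 2) := by
  intro r i v u x w
  obtain ⟨m, hm, r', h'⟩ := h (some false, r.2) i v u x w
  exact ⟨1 + (m + 1), by omega, r', Run.seq run_popV (Run.ite_false rfl h')⟩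

/-- Remove the top bit, and as long as it is `true`, run `p` and repeat. -/
def whileTop (p : Program) : Program :=
  .seq popV (.loop (fun r => r.1 == some true) (.seq p popV))

theorem maps_whileTop_false (p a) : Maps (whileTop p) (false :: a) a 2 :=
  fun _ _ _ _ _ _ => ⟨2, le_rfl, _, Run.seq (n := 1) (m := 1) run_popV (Run.loop_done rfl)⟩

theorem Maps.whileTop_true {p a b c n m} (h : Maps p a b n) (hl : Maps (whileTop p) b c m) :
    Maps (whileTop p) (true :: a) c (n + m + 2) := by
  intro r i v u x w
  obtain ⟨k, hk, r', h'⟩ := h (some true, r.2) i v u x w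
  obtain ⟨l, hl, r'', h''⟩ := hl r' i v u x w
  cases h'' with
  | seq h₁ h₂ =>
    exact ⟨_, by omega, _, Run.seq run_popV (Run.loop_step rfl (Run.seq h' h₁) h₂)⟩

end Program

end XMLPolicy

namespace XMLPolicy

open Program

/-! ### Functions computable in polynomial time on encoded data -/

/-- Types whose elements are represented by binary trees. -/
class Enc (α : Type) where
  enc : α → Bin

open Enc (enc)

/-- The number of nodes of the representation of `a`. -/
def sz {α : Type} [Enc α] (a : α) : ℕ := (enc a).size

instance : Enc Unit := ⟨fun _ => .nil⟩
instance : Enc Bool := ⟨fun b => if b then .cons .nil .nil else .nil⟩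
instance {α β : Type} [Enc α] [Enc β] : Enc (α × β) := ⟨fun p => .cons (enc p.1) (enc p.2)⟩

/-- A list is represented by its right spine. -/
def encList {α : Type} [Enc α] : List α → Bin
  | [] => .nil
  | a :: l => .cons (enc a) (encList l)

instance {α : Type} [Enc α] : Enc (List α) := ⟨encList⟩

/-- Natural numbers are represented in unary. -/
def encNat : ℕ → Bin
  | 0 => .nil
  | n + 1 => .cons .nil (encNat n)

instance : Enc ℕ := ⟨encNat⟩

variable {α β γ δ : Type} [Enc α] [Enc β] [Enc γ] [Enc δ]

theorem sz_pos (a : α) : 1 ≤ sz a := Bin.size_pos _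
theorem sz_pair (a : α) (b : β) : sz (a, b) = sz a + sz b + 1 := rfl
theorem sz_nil : sz ([] : List α) = 1 := rfl
theorem sz_cons (a : α) (l : List α) : sz (a :: l) = sz a + sz l + 1 := rfl
theorem sz_bool_le (b : Bool) : sz b ≤ 3 := by cases b <;> decide

theorem length_lt_sz (l : List α) : l.length < sz l := by
  induction l with
  | nil => exact sz_pos _
  | cons a l ih => rw [sz_cons, List.length_cons]; omega

theorem sz_append (l m : List α) : sz (l ++ m) + 1 = sz l + sz m := by
  induction l with
  | nil => rw [List.nil_append, sz_nil]; omega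
  | cons a l ih => rw [List.cons_append, sz_cons, sz_cons]; omega

theorem sz_le_of_mem {a : α} {l : List α} (h : a ∈ l) : sz a ≤ sz l := by
  induction l with
  | nil => cases h
  | cons b l ih =>
    rw [sz_cons]
    rcases List.mem_cons.1 h with rfl | h
    · omega
    · have := ih h; omega

theorem eval_le_eval (p : Polynomial ℕ) {a b : ℕ} (h : a ≤ b) : p.eval a ≤ p.eval b := by
  rw [Polynomial.eval_eq_sum_range, Polynomial.eval_eq_sum_range]
  gcongr

/-- `PB g`: the function `g` is bounded by a polynomial in the size of its argument. -/
def PB (g : α → ℕ) : Prop := ∃ P : Polynomial ℕ, ∀ a, g a ≤ P.eval (sz a)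

namespace PB

theorem const (n : ℕ) : PB fun _ : α => n := ⟨Polynomial.C n, fun _ => by simp⟩

theorem sz : PB fun a : α => sz a := ⟨Polynomial.X, fun _ => by simp⟩

theorem mono {f g : α → ℕ} (hg : PB g) (h : ∀ a, f a ≤ g a) : PB f :=
  let ⟨P, hP⟩ := hg
  ⟨P, fun a => (h a).trans (hP a)⟩

theorem add {f g : α → ℕ} (hf : PB f) (hg : PB g) : PB fun a => f a + g a :=
  let ⟨P, hP⟩ := hf
  let ⟨Q, hQ⟩ := hg
  ⟨P + Q, fun a => by rw [Polynomial.eval_add]; exact add_le_add (hP a) (hQ a)⟩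

theorem mul {f g : α → ℕ} (hf : PB f) (hg : PB g) : PB fun a => f a * g a :=
  let ⟨P, hP⟩ := hf
  let ⟨Q, hQ⟩ := hg
  ⟨P * Q, fun a => by rw [Polynomial.eval_mul]; exact Nat.mul_le_mul (hP a) (hQ a)⟩

theorem eval {f : α → ℕ} (P : Polynomial ℕ) (hf : PB f) : PB fun a => P.eval (f a) :=
  let ⟨Q, hQ⟩ := hf
  ⟨P.comp Q, fun a => by rw [Polynomial.eval_comp]; exact eval_le_eval P (hQ a)⟩

theorem comp {g : β → ℕ} {f : α → β} (hg : PB g) (hf : PB fun a => XMLPolicy.sz (f a)) :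
    PB fun a => g (f a) :=
  let ⟨P, hP⟩ := hg
  (hf.eval P).mono fun a => hP (f a)

end PB

/-- `Poly f`: some program replaces the code of `a` on top of the main stack by the code of `f a`
in time polynomial in the size of `a`, and the size of `f a` is polynomially bounded. -/
@[fun_prop]
def Poly (f : α → β) : Prop :=
  (∃ (p : Program) (t : α → ℕ), PB t ∧ ∀ a, Maps p (enc a).code (enc (f a)).code (t a)) ∧
    PB fun a => sz (f a)

namespace Poly

/-- Conversions between types that do not change the representation. -/
theorem of_enc_eq {f : α → β} (h : ∀ a, enc (f a) = enc a) : Poly f := by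
  refine ⟨⟨skip, _, PB.const 1, fun a => ?_⟩, PB.sz.mono fun a => ?_⟩
  · rw [h]; exact maps_skip _
  · simp [sz, h]

@[fun_prop]
theorem id' : Poly (fun a : α => a) := of_enc_eq fun _ => rfl

@[fun_prop]
theorem const (b : β) : Poly (fun _ : α => b) := by
  refine ⟨⟨.seq drop (emit (enc b).code), fun a => 9 * sz a + (sz b + 1),
    ((PB.const 9).mul PB.sz).add (PB.const _), fun a => ?_⟩, PB.const _⟩
  have h := (maps_drop (enc a)).seq (maps_emit (enc b).code)
  rwa [Bin.length_code] at h

@[fun_prop]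
theorem comp {g : β → γ} {f : α → β} (hg : Poly g) (hf : Poly f) : Poly (fun a => g (f a)) := by
  obtain ⟨⟨p, t, ht, hp⟩, hs⟩ := hf
  obtain ⟨⟨p', t', ht', hp'⟩, hs'⟩ := hg
  exact ⟨⟨.seq p p', fun a => t a + t' (f a), ht.add (ht'.comp hs), fun a => (hp a).seq (hp' _)⟩,
    hs'.comp hs⟩

@[fun_prop]
theorem prodMk {f : α → β} {g : α → γ} (hf : Poly f) (hg : Poly g) :
    Poly (fun a => (f a, g a)) := by
  obtain ⟨⟨p, t, ht, hp⟩, hs⟩ := hf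
  obtain ⟨⟨p', t', ht', hp'⟩, hs'⟩ := hg
  refine ⟨⟨.seq dup (.seq p' (.seq swap (.seq p (emit [true])))),
    fun a => 21 * sz a + (t' a + (15 * (sz (g a) + sz a) + (t a + 2))), ?_, fun a => ?_⟩, ?_⟩
  · exact ((PB.const _).mul PB.sz).add (ht'.add
      (((PB.const _).mul (hs'.add PB.sz)).add (ht.add (PB.const _))))
  · refine (maps_dup (enc a)).seq (((hp' a).append (enc a).code).seq
      ((maps_swap (enc (g a)) (enc a)).seq (((hp a).append (enc (g a)).code).seq ?_)))
    exact (maps_emit [true]).append _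
  · exact ((hs.add hs').add (PB.const 1)).mono fun a => le_of_eq (sz_pair _ _)

@[fun_prop]
theorem fst : Poly (fun p : α × β => p.1) := by
  refine ⟨⟨ifTop (.seq swap drop) skip, fun p => 15 * (sz p.1 + sz p.2) + 9 * sz p.2 + 2, ?_,
    fun p => ?_⟩, PB.sz.mono fun p => ?_⟩
  · refine ((PB.const 26).mul PB.sz).mono fun p => ?_
    rw [show sz p = sz p.1 + sz p.2 + 1 from rfl]; omega
  · refine Maps.ifTop_true ((maps_swap (enc p.1) (enc p.2)).seq ?_) _
    exact (maps_drop (enc p.2)).append (enc p.1).code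
  · have : sz p = sz p.1 + sz p.2 + 1 := rfl
    beta_reduce; omega

@[fun_prop]
theorem snd : Poly (fun p : α × β => p.2) := by
  refine ⟨⟨ifTop drop skip, fun p => 9 * sz p.1 + 2, ?_,
    fun p => ?_⟩, PB.sz.mono fun p => ?_⟩
  · refine ((PB.const 9).mul PB.sz).mono fun p => ?_
    rw [show sz p = sz p.1 + sz p.2 + 1 from rfl]; omega
  · exact Maps.ifTop_true ((maps_drop (enc p.1)).append (enc p.2).code) _
  · have : sz p = sz p.1 + sz p.2 + 1 := rfl
    beta_reduce; omega

/-- Case distinction on whether the representation of `l x` is a leaf. In the other case it is the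
representation of some `e`, and the second branch may use `e`. -/
theorem cases {l : γ → δ} {g : γ → β} {h : γ × α → β} {F : γ → β} (hl : Poly l) (hg : Poly g)
    (hh : Poly h) (H : ∀ x, (enc (l x) = .nil ∧ F x = g x) ∨
      ∃ e : α, enc (l x) = enc e ∧ enc (l x) ≠ .nil ∧ F x = h (x, e)) : Poly F := by
  obtain ⟨⟨p₀, t₀, ht₀, hp₀⟩, hs₀⟩ := hl.prodMk (id' (α := γ))
  obtain ⟨⟨p₁, t₁, ht₁, hp₁⟩, hs₁⟩ := hg
  obtain ⟨⟨p₂, t₂, ht₂, hp₂⟩, hs₂⟩ := hh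
  obtain ⟨P, hP⟩ := ht₂
  obtain ⟨Q, hQ⟩ := hs₂
  have hsz : ∀ x (e : α), enc (l x) = enc e → sz (x, e) ≤ sz (l x, x) := by
    intro x e he
    rw [sz_pair, sz_pair, sz, sz, sz, he]
    omega
  refine ⟨⟨.seq p₀ (ifTop (ifTop (.seq (emit [true]) (.seq swap (.seq (emit [true]) p₂))) p₁) skip),
    fun x => t₀ x + ((2 + (15 * sz (l x, x) + (2 + P.eval (sz (l x, x))))) + t₁ x + 2 + 2), ?_,
    fun x => ?_⟩, ?_⟩
  · exact ht₀.add ((((PB.const _).add (((PB.const _).mul hs₀).add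
      ((PB.const _).add (PB.eval P hs₀)))).add ht₁).add (PB.const _) |>.add (PB.const _))
  · refine (hp₀ x).seq (Maps.ifTop_true ?_ _)
    rcases H x with ⟨he, hF⟩ | ⟨e, he, hn, hF⟩
    · simp only [he, hF, Bin.code, List.cons_append, List.nil_append]
      exact Maps.ifTop_false ((hp₁ x).mono (by omega)) _
    · have hm : Maps (.seq (emit [true]) (.seq swap (.seq (emit [true]) p₂)))
          ((enc (l x)).code.tail ++ (enc x).code) (enc (F x)).code
          (2 + (15 * (sz (l x) + sz x) + (2 + t₂ (x, e)))) := by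
        have htop : (enc (l x)).code = true :: (enc (l x)).code.tail := by
          cases hc : enc (l x) with
          | nil => exact absurd hc hn
          | cons a b => rfl
        refine ((maps_emit [true]).append _).seq ?_
        rw [hF]
        have h₁ := maps_swap (enc (l x)) (enc x)
        have h₂ := ((maps_emit [true]).append ((enc x).code ++ (enc (l x)).code)).seq
          (n := 2) (m := t₂ (x, e)) (q := p₂) (c := (enc (h (x, e))).code) (by
            have := hp₂ (x, e)
            simp only [enc, Bin.code] at this
            simpa [he] using this)
        refine Maps.seq (b := (enc x).code ++ (enc (l x)).code) ?_ h₂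
        rw [htop] at h₁ ⊢
        simpa [sz] using h₁
      have htop : (enc (l x)).code ++ (enc x).code
          = true :: ((enc (l x)).code.tail ++ (enc x).code) := by
        cases hc : enc (l x) with
        | nil => exact absurd hc hn
        | cons a b => rfl
      rw [htop]
      refine Maps.ifTop_true (hm.mono ?_) _ |>.mono (Nat.le_refl _)
      have h₁ := (hP (x, e)).trans (eval_le_eval P (hsz x e he))
      rw [sz_pair] at h₁ ⊢
      omega
  · refine (hs₁.add (PB.eval Q hs₀)).mono fun x => ?_
    rcases H x with ⟨-, hF⟩ | ⟨e, he, -, hF⟩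
    · rw [hF]; omega
    · have h₁ := (hQ (x, e)).trans (eval_le_eval Q (hsz x e he))
      beta_reduce at h₁ ⊢
      rw [hF]; omega

end Poly

end XMLPolicy

namespace XMLPolicy

open Program
open Enc (enc)

variable {α β γ δ : Type} [Enc α] [Enc β] [Enc γ] [Enc δ]

namespace Poly

theorem list_cases {l : γ → List α} {g : γ → β} {h : γ → α → List α → β} {F : γ → β}
    (hl : Poly l) (hg : Poly g) (hh : Poly fun p : γ × α × List α => h p.1 p.2.1 p.2.2)
    (h₁ : ∀ x, l x = [] → F x = g x) (h₂ : ∀ x a t, l x = a :: t → F x = h x a t) : Poly F := by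
  refine cases hl hg hh fun x => ?_
  cases hc : l x with
  | nil => exact Or.inl ⟨rfl, h₁ x hc⟩
  | cons a t =>
    refine Or.inr ⟨(a, t), rfl, ?_, h₂ x a t hc⟩
    change Bin.cons _ _ ≠ _
    simp

theorem bool_cases {l : γ → Bool} {g h : γ → β} (hl : Poly l) (hg : Poly g) (hh : Poly h) :
    Poly (fun x => bif l x then h x else g x) := by
  refine cases (α := Unit × Unit) (h := fun p => h p.1) hl hg ?_ fun x => ?_
  · exact hh.comp (f := fun p : γ × Unit × Unit => p.1) (by fun_prop)
  · cases hc : l x with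
    | false => exact Or.inl ⟨rfl, rfl⟩
    | true =>
      refine Or.inr ⟨((), ()), rfl, ?_, rfl⟩
      change Bin.cons _ _ ≠ _
      simp

/-- A loop over a list is polynomial if its body is and if the size of the state stays
polynomially bounded. -/
theorem foldl_of_bounded {l : γ → List α} {d : γ → δ} {s : δ → α → δ} (hl : Poly l) (hd : Poly d)
    (hs : Poly fun p : α × δ => s p.2 p.1) {B : γ → ℕ} (hB : PB B)
    (hb : ∀ x l₁ l₂, l x = l₁ ++ l₂ → sz (l₁.foldl s (d x)) ≤ B x) :
    Poly (fun x => (l x).foldl s (d x)) := by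
  obtain ⟨⟨p₀, t₀, ht₀, hp₀⟩, hs₀⟩ := hl.prodMk hd
  obtain ⟨⟨p, t, ⟨P, hP⟩, hp⟩, -⟩ := hs
  let body : Program := .seq swap (dip (.seq (emit [true]) p))
  let N : γ → ℕ := fun x => 30 * sz (l x) + (P.eval (sz (l x) + B x + 1)) + 4
  have key : ∀ x l₂ l₁, l x = l₁ ++ l₂ → Maps (whileTop body)
      ((enc l₂).code ++ (enc (l₁.foldl s (d x))).code) (enc ((l x).foldl s (d x))).code
      (l₂.length * N x + 2) := by
    intro x l₂
    induction l₂ with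
    | nil =>
      intro l₁ h
      rw [h, List.append_nil]
      exact (maps_whileTop_false body _).mono (by omega)
    | cons a l₂ ih =>
      intro l₁ h
      have h' : l x = (l₁ ++ [a]) ++ l₂ := by simp [h]
      have ih := ih (l₁ ++ [a]) h'
      set b := l₁.foldl s (d x) with hbdef
      rw [List.foldl_append, List.foldl_cons, List.foldl_nil, ← hbdef] at ih
      have hbody : Maps body ((enc a).code ++ ((enc l₂).code ++ (enc b).code))
          ((enc l₂).code ++ (enc (s b a)).code)
          (15 * (sz a + sz l₂) + (15 * sz l₂ + (2 + t (a, b)))) := by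
        have h₁ := (maps_swap (enc a) (enc l₂)).append (enc b).code
        have h₂ : Maps (.seq (emit [true]) p) ((enc a).code ++ (enc b).code) (enc (s b a)).code
            (2 + t (a, b)) := ((maps_emit [true]).append _).seq (hp (a, b))
        rw [List.append_assoc, List.append_assoc] at h₁
        exact h₁.seq (h₂.dip (enc l₂))
      have hsize : sz a + sz l₂ + 1 ≤ sz (l x) := by
        have := sz_append l₁ (a :: l₂)
        rw [← h, sz_cons] at this
        have := sz_pos l₁
        omega
      have ht : t (a, b) ≤ P.eval (sz (l x) + B x + 1) := by
        refine (hP (a, b)).trans (eval_le_eval P ?_)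
        have := hb x l₁ (a :: l₂) h
        rw [← hbdef] at this
        rw [sz_pair]
        omega
      have := hbody.whileTop_true ih
      have hcode : (enc (a :: l₂)).code ++ (enc b).code
          = true :: ((enc a).code ++ ((enc l₂).code ++ (enc b).code)) := by
        change (Bin.cons (enc a) (enc l₂)).code ++ _ = _
        simp [Bin.code]
      rw [hcode]
      refine this.mono ?_
      have hN : N x = 30 * sz (l x) + (P.eval (sz (l x) + B x + 1)) + 4 := rfl
      rw [List.length_cons, Nat.succ_mul l₂.length]
      omega
  have hlsz : PB fun x => sz (l x) := hs₀.mono fun x => by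
    beta_reduce; rw [sz_pair]; omega
  refine ⟨⟨.seq p₀ (.seq popV (whileTop body)), fun x => t₀ x + (1 + (sz (l x) * N x + 2)), ?_,
    fun x => ?_⟩, ?_⟩
  · refine ht₀.add ((PB.const _).add ((hlsz.mul ?_).add (PB.const _)))
    exact (((PB.const _).mul hlsz).add (PB.eval P ((hlsz.add hB).add (PB.const _)))).add
      (PB.const _)
  · refine (hp₀ x).seq (Maps.seq (b := (enc (l x)).code ++ (enc (d x)).code) ?_ ?_)
    · intro r i v u y w
      exact ⟨1, le_rfl, _, run_popV⟩
    · refine (key x (l x) [] rfl).mono ?_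
      have := Nat.mul_le_mul_right (N x) (length_lt_sz (l x)).le
      omega
  · exact hB.mono fun x => hb x (l x) [] (by simp)

/-- A loop over a list whose body may use the argument `x` is polynomial if its body is and if
each round increases the size of the state by at most a polynomial in the size of `x`. -/
theorem foldl {l : γ → List α} {d : γ → β} {s : γ → β → α → β} (hl : Poly l) (hd : Poly d)
    (hs : Poly fun p : γ × β × α => s p.1 p.2.1 p.2.2) {B : γ → ℕ} (hB : PB B)
    (hb : ∀ x b, ∀ a ∈ l x, sz (s x b a) ≤ sz b + B x) :
    Poly (fun x => (l x).foldl (s x) (d x)) := by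
  have hfold : ∀ (m : List α) x b,
      m.foldl (fun (q : γ × β) a => (q.1, s q.1 q.2 a)) (x, b) = (x, m.foldl (s x) b) := by
    intro m
    induction m with
    | nil => intro x b; rfl
    | cons a m ih => intro x b; rw [List.foldl_cons, ih]; rfl
  have hsize : ∀ x (m : List α), (∀ a ∈ m, a ∈ l x) → ∀ b,
      sz (m.foldl (s x) b) ≤ sz b + m.length * B x := by
    intro x m
    induction m with
    | nil => intro _ b; simp
    | cons a m ih =>
      intro hm b
      have h₁ := ih (fun a' h => hm a' (List.mem_cons_of_mem _ h)) (s x b a)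
      have h₂ := hb x b a (hm a List.mem_cons_self)
      rw [List.foldl_cons, List.length_cons, Nat.succ_mul]
      omega
  have hlsz : PB fun x => sz (l x) := hl.2
  have hmain : Poly fun x => (l x).foldl (fun (q : γ × β) a => (q.1, s q.1 q.2 a)) (x, d x) := by
    refine foldl_of_bounded (B := fun x => sz x + (sz (d x) + sz (l x) * B x) + 1) hl (by fun_prop)
      ?_ ((PB.sz.add (hd.2.add (hlsz.mul hB))).add (PB.const 1)) ?_
    · exact Poly.prodMk (by fun_prop)
        (hs.comp (f := fun p : α × γ × β => (p.2.1, p.2.2, p.1)) (by fun_prop))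
    · intro x l₁ l₂ h
      rw [hfold, sz_pair]
      have h₁ := hsize x l₁ (fun a ha => by rw [h]; exact List.mem_append_left _ ha) (d x)
      have h₂ : l₁.length ≤ sz (l x) := by
        refine le_trans ?_ (length_lt_sz (l x)).le
        rw [h]; simp
      have := Nat.mul_le_mul_right (B x) h₂
      omega
  refine (snd.comp hmain).comp id' |> fun h => ?_
  simpa only [hfold] using h

/-! ### Lists -/

theorem cons {f : γ → α} {g : γ → List α} (hf : Poly f) (hg : Poly g) :
    Poly (fun x => f x :: g x) :=
  comp (g := fun p : α × List α => p.1 :: p.2) (of_enc_eq fun _ => rfl) (hf.prodMk hg)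

theorem foldl_cons_append {α : Type} (l m : List α) :
    l.foldl (fun b a => a :: b) m = l.reverse ++ m := by
  induction l generalizing m with
  | nil => rfl
  | cons a l ih => simp [ih]

theorem reverse {f : γ → List α} (hf : Poly f) : Poly (fun x => (f x).reverse) := by
  have := foldl (l := f) (d := fun _ => ([] : List α)) (s := fun _ b a => a :: b) hf (const _)
    (cons (by fun_prop) (by fun_prop)) (B := fun x => sz (f x) + 1) (hf.2.add (PB.const 1))
    fun x b a ha => by
      have := sz_le_of_mem ha
      rw [sz_cons]; omega
  simpa only [foldl_cons_append, List.append_nil] using this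

theorem append {f g : γ → List α} (hf : Poly f) (hg : Poly g) : Poly (fun x => f x ++ g x) := by
  have := foldl (l := fun x => (f x).reverse) (d := g) (s := fun _ b a => a :: b) hf.reverse hg
    (cons (by fun_prop) (by fun_prop)) (B := fun x => sz (f x) + 1) (hf.2.add (PB.const 1))
    fun x b a ha => by
      have := sz_le_of_mem (List.mem_reverse.1 ha)
      rw [sz_cons]; omega
  simpa only [foldl_cons_append, List.reverse_reverse] using this

theorem foldl_append_flatMap {α β : Type} (f : α → List β) (l : List α) (m : List β) :
    l.foldl (fun b a => b ++ f a) m = m ++ l.flatMap f := by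
  induction l generalizing m with
  | nil => simp
  | cons a l ih => simp [ih]

theorem flatMap {l : γ → List α} {f : γ → α → List β} (hl : Poly l)
    (hf : Poly fun p : γ × α => f p.1 p.2) : Poly (fun x => (l x).flatMap (f x)) := by
  obtain ⟨P, hP⟩ := hf.2
  have := foldl (l := l) (d := fun _ => ([] : List β)) (s := fun x b a => b ++ f x a) hl (const _)
    (append (by fun_prop) (hf.comp (f := fun p : γ × List β × α => (p.1, p.2.2)) (by fun_prop)))
    (B := fun x => P.eval (sz x + sz (l x) + 1))
    (PB.eval P ((PB.sz.add hl.2).add (PB.const 1)))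
    fun x b a ha => by
      have h₁ := sz_append b (f x a)
      have h₂ := (hP (x, a)).trans (eval_le_eval P (b := sz x + sz (l x) + 1) (by
        have := sz_le_of_mem ha
        rw [sz_pair]; omega))
      change sz (f x a) ≤ _ at h₂
      omega
  simpa only [foldl_append_flatMap, List.nil_append] using this

theorem map {l : γ → List α} {f : γ → α → β} (hl : Poly l)
    (hf : Poly fun p : γ × α => f p.1 p.2) : Poly (fun x => (l x).map (f x)) := by
  simp only [List.map_eq_flatMap]
  exact flatMap hl (cons hf (const []))

theorem tail {f : γ → List α} (hf : Poly f) : Poly (fun x => (f x).tail) :=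
  list_cases (h := fun _ _ t => t) hf (const []) (by fun_prop)
    (fun x h => by simp [h]) (fun x a t h => by simp [h])

theorem headD {f : γ → List α} (hf : Poly f) (a : α) : Poly (fun x => (f x).headD a) :=
  list_cases (h := fun _ a _ => a) hf (const a) (by fun_prop)
    (fun x h => by simp [h]) (fun x a t h => by simp [h])

end Poly

/-! ### Predicates decidable in polynomial time -/

open Classical in
/-- `PolyPred p`: the truth value of `p` is computable in polynomial time. -/
def PolyPred (p : α → Prop) : Prop := Poly fun a => (decide (p a) : Bool)

/-- Types with equality decidable in polynomial time. -/
class PolyEq (α : Type) [Enc α] : Prop where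
  eq : PolyPred fun p : α × α => p.1 = p.2

theorem PolyPred.comp {p : β → Prop} {f : α → β} (hp : PolyPred p) (hf : Poly f) :
    PolyPred fun a => p (f a) := Poly.comp hp hf

theorem PolyPred.const (p : Prop) : PolyPred fun _ : α => p := Poly.const _

theorem PolyPred.congr {p q : α → Prop} (hp : PolyPred p) (h : ∀ a, q a ↔ p a) : PolyPred q := by
  have : q = p := funext fun a => propext (h a)
  rwa [this]

theorem Poly.ite {p : γ → Prop} [∀ x, Decidable (p x)] {f g : γ → β} (hp : PolyPred p)
    (hf : Poly f) (hg : Poly g) : Poly (fun x => if p x then f x else g x) := by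
  have := Poly.bool_cases hp hg hf
  convert this using 2 with x
  by_cases h : p x <;> simp [h]

namespace PolyPred

variable {p q : γ → Prop}

theorem ite {r : γ → Prop} (hr : PolyPred r) (hp : PolyPred p) (hq : PolyPred q) :
    PolyPred fun x => (r x → p x) ∧ (¬ r x → q x) := by
  classical
  have := Poly.ite hr hp hq
  unfold PolyPred
  convert this using 2 with x
  by_cases h : r x <;> simp [h]

theorem not (hp : PolyPred p) : PolyPred fun x => ¬ p x :=
  (ite hp (const False) (const True)).congr fun x => by tauto

theorem and (hp : PolyPred p) (hq : PolyPred q) : PolyPred fun x => p x ∧ q x :=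
  (ite hp hq (const False)).congr fun x => by tauto

theorem or (hp : PolyPred p) (hq : PolyPred q) : PolyPred fun x => p x ∨ q x :=
  (ite hp (const True) hq).congr fun x => by tauto

theorem imp (hp : PolyPred p) (hq : PolyPred q) : PolyPred fun x => p x → q x :=
  (ite hp hq (const True)).congr fun x => by tauto

theorem eq [PolyEq α] {f g : γ → α} (hf : Poly f) (hg : Poly g) : PolyPred fun x => f x = g x :=
  PolyEq.eq.comp (hf.prodMk hg)

theorem ball {l : γ → List α} {P : γ → α → Prop} (hl : Poly l)
    (hP : PolyPred fun y : γ × α => P y.1 y.2) : PolyPred fun x => ∀ a ∈ l x, P x a := by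
  classical
  have := Poly.foldl (l := l) (d := fun _ => true)
    (s := fun x b a => if P x a then b else false) hl (Poly.const _)
    (Poly.ite (hP.comp (f := fun y : γ × Bool × α => (y.1, y.2.2)) (by fun_prop)) (by fun_prop)
      (Poly.const _))
    (B := fun _ => 3) (PB.const _) (fun x b a _ => (sz_bool_le _).trans (by omega))
  unfold PolyPred
  convert this using 2 with x
  have key : ∀ (m : List α) (b : Bool),
      m.foldl (fun b a => if P x a then b else false) b = (b && decide (∀ a ∈ m, P x a)) := by
    intro m
    induction m with
    | nil => intro b; simp
    | cons a m ih =>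
      intro b
      rw [List.foldl_cons, ih]
      by_cases h : P x a <;> simp [h]
  rw [key, Bool.true_and, decide_eq_decide]

theorem bex {l : γ → List α} {P : γ → α → Prop} (hl : Poly l)
    (hP : PolyPred fun y : γ × α => P y.1 y.2) : PolyPred fun x => ∃ a ∈ l x, P x a :=
  (ball (P := fun x a => ¬ P x a) hl hP.not).not.congr fun x => by push Not; rfl

theorem mem [PolyEq α] {f : γ → α} {l : γ → List α} (hf : Poly f) (hl : Poly l) :
    PolyPred fun x => f x ∈ l x :=
  (bex (P := fun x a => f x = a) hl
    (eq (hf.comp Poly.fst) Poly.snd)).congr fun x => by simp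

end PolyPred

instance : PolyEq Bool := ⟨by
  have h₁ : PolyPred fun p : Bool × Bool => p.1 = true := by
    unfold PolyPred
    simpa using Poly.fst (α := Bool) (β := Bool)
  have h₂ : PolyPred fun p : Bool × Bool => p.2 = true := by
    unfold PolyPred
    simpa using Poly.snd (α := Bool) (β := Bool)
  refine (h₁.ite h₂ h₂.not).congr fun p => ?_
  obtain ⟨a, b⟩ := p
  cases a <;> cases b <;> simp⟩

instance [PolyEq α] [PolyEq β] : PolyEq (α × β) := ⟨by
  refine (PolyPred.and (PolyPred.eq (f := fun p : (α × β) × (α × β) => p.1.1)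
    (g := fun p => p.2.1) (by fun_prop) (by fun_prop))
    (PolyPred.eq (f := fun p => p.1.2) (g := fun p => p.2.2) (by fun_prop) (by fun_prop))).congr ?_
  rintro ⟨⟨a, b⟩, ⟨c, d⟩⟩
  simp⟩

/-- Types whose elements are distinguished by a polynomial-time map into a type with
polynomial-time equality. -/
theorem PolyEq.of_injective [PolyEq β] {f : α → β} (hf : Poly f) (hi : Function.Injective f) :
    PolyEq α := ⟨by
  refine (PolyPred.eq (f := fun p : α × α => f p.1) (g := fun p => f p.2) (by fun_prop)
    (by fun_prop)).congr fun p => hi.eq_iff.symm⟩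

instance [PolyEq α] : PolyEq (List α) := ⟨by
  classical
  -- The state of the loop over the first list: whether the part read so far agrees with the
  -- second list, and the rest of the second list.
  let s : List α × List α → Bool × List α → α → Bool × List α := fun _ q a =>
    match q.2 with
    | [] => (false, [])
    | b :: m => (if a = b then q.1 else false, m)
  have hs : Poly fun y : (List α × List α) × (Bool × List α) × α => s y.1 y.2.1 y.2.2 := by
    refine Poly.list_cases (l := fun y : (List α × List α) × (Bool × List α) × α => y.2.1.2)
      (g := fun _ => (false, ([] : List α)))
      (h := fun y b m => (if y.2.2 = b then y.2.1.1 else false, m)) (by fun_prop) (by fun_prop)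
      ?_ ?_ ?_
    · exact Poly.prodMk (Poly.ite (PolyPred.eq (by fun_prop) (by fun_prop)) (by fun_prop)
        (by fun_prop)) (by fun_prop)
    · intro y hy; simp [s, hy]
    · intro y a t hy; simp [s, hy]
  have hfold := Poly.foldl (l := fun p : List α × List α => p.1) (d := fun p => (true, p.2))
    (by fun_prop) (by fun_prop) hs (PB.const 6) (by
      rintro x ⟨c, m⟩ a -
      cases m with
      | nil =>
        have : s x (c, []) a = (false, []) := rfl
        have h₁ := sz_bool_le c
        have h₂ := sz_pos c
        rw [this, sz_pair, sz_pair]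
        have := sz_bool_le false
        omega
      | cons b m =>
        have : s x (c, b :: m) a = (if a = b then c else false, m) := rfl
        have h₁ := sz_bool_le (if a = b then c else false)
        rw [this, sz_pair, sz_pair, sz_cons]
        omega)
  have key : ∀ x (l m : List α) (c : Bool),
      (let q := l.foldl (s x) (c, m); q.1 = true ∧ q.2 = []) ↔ c = true ∧ l = m := by
    intro x l
    induction l with
    | nil =>
      intro m c
      simp [eq_comm]
    | cons a l ih =>
      intro m c
      rw [List.foldl_cons]
      cases m with
      | nil => 
        have : s x (c, []) a = (false, []) := rfl
        rw [this, ih]; simp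
      | cons b m =>
        have : s x (c, b :: m) a = (if a = b then c else false, m) := rfl
        rw [this, ih]
        by_cases h : a = b <;> simp [h]
  have hnil : PolyPred fun m : List α => m = [] :=
    Poly.list_cases (h := fun _ _ _ => false) Poly.id' (Poly.const true) (Poly.const _)
      (fun x h => by simp [h]) (fun x a t h => by simp [h])
  refine ((PolyPred.eq (Poly.fst.comp hfold) (Poly.const true)).and
    (hnil.comp (Poly.snd.comp hfold))).congr fun p => ?_
  have := key p p.1 p.2 true
  simpa using this.symm⟩

end XMLPolicy

namespace XMLPolicy

open Program Prog
open Enc (enc)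

/-! ### From programs to Turing machines -/

/-- A numbering of the input alphabet. -/
def Sym.index : Sym → ℕ
  | .bit false => 0
  | .bit true => 1
  | .endLabel => 2
  | .endList => 3
  | .text => 4
  | .empty => 5
  | .seq => 6
  | .alt => 7
  | .star => 8
  | .insert => 9
  | .delete => 10
  | .replace => 11
  | .replaceText => 12

/-- The symbols in the order of their numbers. -/
def Sym.all : List Sym :=
  [.bit false, .bit true, .endLabel, .endList, .text, .empty, .seq, .alt, .star, .insert, .delete,
    .replace, .replaceText]

theorem Sym.getD_index (s d : Sym) : Sym.all.getD s.index d = s := by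
  rcases s with ⟨_ | _⟩ | _ <;> rfl

instance : Enc Sym := ⟨fun s => enc s.index⟩

theorem Sym.mem_all (s : Sym) : s ∈ Sym.all := by
  rcases s with ⟨_ | _⟩ | _ <;> simp [Sym.all]

theorem Sym.sz_le (s : Sym) : sz s ≤ 25 := by
  rcases s with ⟨_ | _⟩ | _ <;> decide

namespace Program

/-- Push the code of the input symbol in the register on the main stack. -/
def emitSym : List Sym → Program
  | [] => skip
  | s :: l => .ite (fun r => r.2 == some s) (emit (enc s).code) (emitSym l)

theorem run_emitSym {s : Sym} {l : List Sym} (h : s ∈ l) (b i v u x w) :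
    ∃ n ≤ l.length + 26, ∃ r', Run (emitSym l) (b, some s) (mkStore i v u x w) n r'
      (mkStore i ((enc s).code ++ v) u x w) := by
  induction l with
  | nil => cases h
  | cons t l ih =>
    by_cases hst : s = t
    · subst hst
      obtain ⟨n, hn, r', hr⟩ := maps_emit (enc s).code (b, some s) i v u x w
      rw [Bin.length_code] at hn
      have : (enc s).size ≤ 25 := s.sz_le
      exact ⟨n + 1, by simp; omega, r', Run.ite_true (by simp) hr⟩
    · obtain ⟨n, hn, r', hr⟩ := ih ((List.mem_cons.1 h).resolve_left hst)
      exact ⟨n + 1, by simp; omega, r', Run.ite_false (by simp [hst]) hr⟩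

abbrev popInp : Program := .pop .inp fun r s => (r.1, s)

theorem run_popInp {r i v u x w} : Run popInp r (mkStore i v u x w) 1 (r.1, i.head?)
    (mkStore i.tail v u x w) := by
  have := @Run.pop _ _ Stk.Alph Reg .inp (fun r s => (r.1, s)) r (mkStore i v u x w)
  rwa [update_mkStore_inp] at this

/-- Read the rest of the input, consing the codes of the symbols to the list on the main stack. -/
def readLoop : Program :=
  .loop (fun r => r.2.isSome) (.seq (emitSym Sym.all) (.seq (pushV fun _ => true) popInp))

/-- Reading the input symbol by symbol builds the reversed word on the main stack. -/
def readInput : Program := .seq (pushV fun _ => false) (.seq popInp readLoop)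

theorem run_readLoop (i : List Sym) : ∀ (l : List Sym) (b : Option Bool) (v u x w),
    ∃ n ≤ i.length * 42 + 1, ∃ r', Run readLoop (b, i.head?)
      (mkStore i.tail ((enc l).code ++ v) u x w) n r'
      (mkStore [] ((enc (i.reverse ++ l)).code ++ v) u x w) := by
  induction i with
  | nil => exact fun l b v u x w => ⟨1, by simp, _, Run.loop_done rfl⟩
  | cons s i ih =>
    intro l b v u x w
    obtain ⟨n, hn, r', h₁⟩ := run_emitSym s.mem_all b i ((enc l).code ++ v) u x w
    have h₂ := run_pushV (r := r') (i := i) (v := (enc s).code ++ ((enc l).code ++ v)) (u := u)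
      (x := x) (w := w) (fun _ => true)
    obtain ⟨m, hm, r'', h₃⟩ := ih (s :: l) r'.1 v u x w
    refine ⟨(n + (1 + 1)) + m + 1, ?_, r'', ?_⟩
    · have : Sym.all.length = 13 := rfl
      rw [List.length_cons]; omega
    · have hcode : (enc (s :: l)).code ++ v
          = true :: ((enc s).code ++ ((enc l).code ++ v)) := by
        change (Bin.cons (enc s) (enc l)).code ++ v = _
        simp [Bin.code]
      rw [hcode] at h₃
      have h₄ := Run.loop_step (c := fun r : Reg => r.2.isSome) (r := (b, some s)) rfl
        (h₁.seq (h₂.seq run_popInp)) h₃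
      simpa [readLoop] using h₄

/-- Leave on the main stack a single bit in place of the code of a truth value, and clear the
register. -/
def answer : Program :=
  .seq (ifTop (.seq popV (.seq popV (pushV fun _ => true))) (pushV fun _ => false))
    (.load fun _ => (none, none))

theorem run_answer (b : Bool) (r) : ∃ n ≤ 6, Run answer r (mkStore [] (enc b).code [] [] []) n
    (none, none) (mkStore [] [b] [] [] []) := by
  cases b with
  | false =>
    have h : Maps (pushV fun _ => false) [] [false] 1 :=
      fun r _ _ _ _ _ => ⟨1, le_rfl, r, run_pushV _⟩
    obtain ⟨n, hn, r', h'⟩ := h.ifTop_false (.seq popV (.seq popV (pushV fun _ => true)))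
      r [] [] [] [] []
    exact ⟨n + 1, by omega, h'.seq Run.load⟩
  | true =>
    have h : Maps (.seq popV (.seq popV (pushV fun _ => true))) [false, false] [true] 3 :=
      fun r _ _ _ _ _ => ⟨1 + (1 + 1), le_rfl, _, run_popV.seq (run_popV.seq (run_pushV _))⟩
    obtain ⟨n, hn, r', h'⟩ := h.ifTop_true (pushV fun _ => false) r [] [] [] [] []
    exact ⟨n + 1, by omega, h'.seq Run.load⟩

/-- The Turing machine of a program, with the input on `inp` and the output on `val`. -/
def machine (p : Program) : Turing.FinTM2 where
  K := Stk
  k₀ := .inp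
  k₁ := .val
  Γ := Stk.Alph
  Λ := Option (Lab p)
  main := some p.entry
  ΛFin := letI := labFintype p; inferInstance
  σ := Reg
  initialState := (none, none)
  m l := match l with
    | none => .halt
    | some l => Prog.code p some none l

theorem initList_machine (p : Program) (s : List Sym) :
    Turing.initList (machine p) s = ⟨some (some p.entry), (none, none), mkStore s [] [] [] []⟩ := by
  unfold Turing.initList
  congr 1
  funext k
  cases k <;> rfl

theorem haltList_machine (p : Program) (s : List Bool) :
    Turing.haltList (machine p) s = ⟨none, (none, none), mkStore [] s [] [] []⟩ := by
  unfold Turing.haltList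
  congr 1
  funext k
  cases k <;> rfl

theorem iterate_step_machine {p : Program} {w : List Sym} {c : List Bool} {n : ℕ}
    (h : Run p (none, none) (mkStore w [] [] [] []) n (none, none) (mkStore [] c [] [] [])) :
    (flip bind (machine p).step)^[n + 1] (some (Turing.initList (machine p) w)) =
      some (Turing.haltList (machine p) c) := by
  have hrun := h.iterate_step (machine p).m some none (fun l => rfl)
  rw [initList_machine, haltList_machine, Function.iterate_succ_apply']
  exact (congrArg (flip bind (Turing.TM2.step (machine p).m)) hrun).trans rfl

end Program

theorem sz_list_sym_le (l : List Sym) : sz l ≤ 26 * l.length + 1 := by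
  induction l with
  | nil => rw [sz_nil]; simp
  | cons s l ih =>
    have := s.sz_le
    rw [sz_cons, List.length_cons]; omega

/-- A language that is decided in polynomial time on encoded words is in `PTIME`. -/
theorem inPTIME_of_polyPred {L : Language Sym} (h : PolyPred fun w : List Sym => w ∈ L) :
    InPTIME L := by
  classical
  have hrev : PolyPred fun w : List Sym => w.reverse ∈ L :=
    h.comp (f := fun w : List Sym => w.reverse) (Poly.reverse Poly.id')
  obtain ⟨⟨p, t, ⟨P, hP⟩, hp⟩, -⟩ := hrev
  let prog : Program := .seq readInput (.seq p answer)
  have key : ∀ w : List Sym, ∃ n ≤ (w.length * 42 + 3) + (P.eval (26 * w.length + 1) + 6),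
      Run prog (none, none) (mkStore w [] [] [] []) n (none, none)
        (mkStore [] [decide (w ∈ L)] [] [] []) := by
    intro w
    obtain ⟨n, hn, r, h₁⟩ := run_readLoop w [] none [] [] [] []
    obtain ⟨m, hm, r', h₂⟩ := hp w.reverse r [] [] [] [] []
    obtain ⟨k, hk, h₃⟩ := run_answer (decide (w ∈ L)) r'
    have hm' : m ≤ P.eval (26 * w.length + 1) := by
      refine hm.trans ((hP _).trans (eval_le_eval P ?_))
      simpa using sz_list_sym_le w.reverse
    refine ⟨(1 + (1 + n)) + (m + k), by omega, ?_⟩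
    refine Run.seq (Run.seq (run_pushV _) (Run.seq run_popInp h₁)) (Run.seq ?_ h₃)
    simpa using h₂
  refine ⟨⟨⟨machine prog, Equiv.refl Sym, Equiv.refl Bool⟩,
    (Polynomial.X * 42 + 3) + (P.comp (26 * Polynomial.X + 1) + 6) + 1, fun w => ?_⟩⟩
  have hex := key w
  refine ⟨⟨hex.choose + 1, ?_⟩, ?_⟩
  · have hin : List.map (Equiv.refl Sym).invFun (id w) = w := by simp
    exact (congrArg (fun l => (flip bind (machine prog).step)^[hex.choose + 1]
      (some (Turing.initList (machine prog) l))) hin).trans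
        (iterate_step_machine hex.choose_spec.2)
  · have := hex.choose_spec.1
    simp only [Polynomial.eval_add, Polynomial.eval_mul, Polynomial.eval_comp, Polynomial.eval_X,
      Polynomial.eval_ofNat, Polynomial.eval_one, id]
    omega

end XMLPolicy

namespace XMLPolicy

open Relation

/-! ### Labels along the edges of a tree -/

/-- `B` is a subelement type of `A`. -/
def DTD.Edge (D : DTD) (A B : Label) : Prop := A ∈ D.ele ∧ B ∈ (D.rg A).subs

/-- `B` is `A` or a type of proper descendants of `A`-nodes. -/
abbrev DTD.Reach (D : DTD) : Label → Label → Prop := ReflTransGen D.Edge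

theorem DTD.not_edge_of_reach {D : DTD} {A B : Label} (h : D.Reach B A) : ¬ D.Edge A B :=
  fun he => D.acyclic A (TransGen.head' he h)

theorem Content.mem_subs_of_mem_language {c : Content} {w : List (Option Label)} {B : Label}
    (hw : w ∈ c.language) (hB : some B ∈ w) : B ∈ c.subs := by
  cases c with
  | text =>
    change w = [none] at hw
    simp [hw] at hB
  | empty =>
    change w = [] at hw
    simp [hw] at hB
  | seq Bs =>
    change w = Bs.map some at hw
    simpa [hw, Content.subs] using hB
  | alt Bs =>
    obtain ⟨B', hB', rfl⟩ := hw
    simp only [List.mem_singleton, Option.some.injEq] at hB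
    exact hB ▸ hB'
  | star B' =>
    have := hw _ hB
    simpa [Content.subs] using this

/-- What a node contributes to the number of children of its parent that satisfy some condition:
its label, or the string value of a `str`-node. -/
abbrev Key := Label ⊕ Option String

namespace XMLTree

/-- The key of a node. -/
def key (t : XMLTree) (m : ℕ) : Key :=
  match t.lab m with
  | some B => .inl B
  | none => .inr (t.val m)

theorem key_of_lab {t : XMLTree} {m : ℕ} {B : Label} (h : t.lab m = some B) : t.key m = .inl B := by
  simp [key, h]

theorem key_of_text {t : XMLTree} {m : ℕ} (h : t.lab m = none) : t.key m = .inr (t.val m) := by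
  simp [key, h]

/-- The edges that lead from a `C`-node to a child whose key satisfies `Q`. -/
def marked (t : XMLTree) (C : Label) (Q : Key → Prop) : Set (ℕ × ℕ) :=
  {e | e ∈ t.edges ∧ t.lab e.1 = some C ∧ Q (t.key e.2)}

/-- The number of edges that lead from a `C`-node to a child whose key satisfies `Q`. -/
noncomputable def count (t : XMLTree) (C : Label) (Q : Key → Prop) : ℕ := (t.marked C Q).ncard

/-- The counts are invariant under isomorphism. -/
theorem Iso.count_eq {t₁ t₂ : XMLTree} (h : t₁.Iso t₂)
    (h₁ : ∀ x y, (x, y) ∈ t₁.edges → x ∈ t₁.nodes ∧ y ∈ t₁.nodes)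
    (h₂ : ∀ x y, (x, y) ∈ t₂.edges → x ∈ t₂.nodes ∧ y ∈ t₂.nodes) (C : Label) (Q : Key → Prop) :
    t₁.count C Q = t₂.count C Q := by
  obtain ⟨f, hf, -, he, hl, hv⟩ := h
  have hkey : ∀ x ∈ t₁.nodes, t₁.key x = t₂.key (f x) := by
    intro x hx
    have h := hl x hx
    cases hc : t₁.lab x with
    | none => rw [key_of_text hc, key_of_text (h ▸ hc), hv x hx hc]
    | some B => rw [key_of_lab hc, key_of_lab (h ▸ hc)]
  refine Set.ncard_congr (fun e _ => (f e.1, f e.2)) ?_ ?_ ?_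
  · rintro ⟨x, y⟩ ⟨hxy, hC, hQ⟩
    obtain ⟨hx, hy⟩ := h₁ x y hxy
    exact ⟨(he x hx y hy).1 hxy, by rw [← hC]; exact (hl x hx).symm, by
      simpa [← hkey y hy] using hQ⟩
  · rintro ⟨x, y⟩ ⟨x', y'⟩ ⟨hxy, -⟩ ⟨hxy', -⟩ heq
    obtain ⟨hx, hy⟩ := h₁ x y hxy
    obtain ⟨hx', hy'⟩ := h₁ x' y' hxy'
    simp only [Prod.mk.injEq] at heq
    rw [hf.injOn hx hx' heq.1, hf.injOn hy hy' heq.2]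
  · rintro ⟨x, y⟩ ⟨hxy, hC, hQ⟩
    obtain ⟨hx, hy⟩ := h₂ x y hxy
    obtain ⟨x, hx', rfl⟩ := hf.surjOn hx
    obtain ⟨y, hy', rfl⟩ := hf.surjOn hy
    exact ⟨(x, y), ⟨(he x hx' y hy').2 hxy, (hl x hx').trans hC, by
      simpa [hkey y hy'] using hQ⟩, rfl⟩

end XMLTree

/-- The properties of instances of `D` at `X` on which the counting argument rests. -/
structure DTD.Sound (D : DTD) (X : Label) (t : XMLTree) : Prop where
  edges_finite : t.edges.Finite
  edges_mem : ∀ x y, (x, y) ∈ t.edges → x ∈ t.nodes ∧ y ∈ t.nodes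
  unique : ∀ x x' y, (x, y) ∈ t.edges → (x', y) ∈ t.edges → x = x'
  edge_lab : ∀ x y, (x, y) ∈ t.edges →
    ∃ A, t.lab x = some A ∧ ∀ B, t.lab y = some B → D.Edge A B
  reach : ∀ n ∈ t.nodes, ∀ A, t.lab n = some A → D.Reach X A

theorem DTD.ConformsAt.edge_lab {D : DTD} {X : Label} {t : XMLTree} (h : D.ConformsAt X t)
    {x y : ℕ} (hxy : (x, y) ∈ t.edges) :
    ∃ A, t.lab x = some A ∧ ∀ B, t.lab y = some B → D.Edge A B := by
  obtain ⟨hx, hy⟩ := h.isTree.edges_mem x y hxy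
  cases hc : t.lab x with
  | none => exact absurd hxy ((h.text_leaf x hx hc).2 y)
  | some A =>
    refine ⟨A, rfl, fun B hB => ⟨h.lab_mem x hx A hc, ?_⟩⟩
    obtain ⟨l, -, hl, hw⟩ := h.children x hx A hc
    exact Content.mem_subs_of_mem_language hw (hB ▸ List.mem_map_of_mem ((hl y).2 hxy))

theorem DTD.reach_of_path {D : DTD} {t : XMLTree}
    (h : ∀ x y, (x, y) ∈ t.edges → ∃ A, t.lab x = some A ∧ ∀ B, t.lab y = some B → D.Edge A B)
    {n m : ℕ} (hnm : ReflTransGen (fun x y => (x, y) ∈ t.edges) n m) {A B : Label}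
    (hA : t.lab n = some A) (hB : t.lab m = some B) : D.Reach A B := by
  induction hnm generalizing B with
  | refl => rw [hA] at hB; rw [Option.some.inj hB]
  | tail _ he ih =>
    obtain ⟨A', hA', hE⟩ := h _ _ he
    exact (ih hA').tail (hE B hB)

theorem DTD.ConformsAt.sound {D : DTD} {X : Label} {t : XMLTree} (h : D.ConformsAt X t) :
    D.Sound X t where
  edges_finite := (h.isTree.finite.prod h.isTree.finite).subset fun e he =>
    h.isTree.edges_mem e.1 e.2 he
  edges_mem := h.isTree.edges_mem
  unique x x' y hx hx' := by
    have hy := (h.isTree.edges_mem x y hx).2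
    have hr : y ≠ t.root := by
      rintro rfl
      exact h.isTree.root_no_parent x hx
    exact (h.isTree.unique_parent y hy hr).unique hx hx'
  edge_lab _ _ hxy := h.edge_lab hxy
  reach n hn A hA := DTD.reach_of_path (fun _ _ => h.edge_lab) (h.isTree.reachable n hn)
    h.root_lab hA

/-! ### The effect of an update on the counts -/

open Classical in
/-- The number `1` if `p` holds, and `0` otherwise. -/
noncomputable def truth (p : Prop) : ℕ := if p then 1 else 0

theorem truth_of {p : Prop} (h : p) : truth p = 1 := if_pos h

theorem truth_of_not {p : Prop} (h : ¬ p) : truth p = 0 := if_neg h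

/-- The contribution to the count for `C` and `Q` of an edge from an `A`-node to a child with key
`k`, where `none` stands for no edge. -/
noncomputable def indicator (A C : Label) (Q : Key → Prop) (k : Option Key) : ℕ :=
  truth (A = C ∧ ∃ x, k = some x ∧ Q x)

theorem indicator_none (A C : Label) (Q) : indicator A C Q none = 0 := by
  simp [indicator, truth]

theorem indicator_of_ne {A C : Label} (h : A ≠ C) (Q k) : indicator A C Q k = 0 := by
  simp [indicator, truth, h]

theorem indicator_some (A C : Label) (Q) (k : Key) :
    indicator A C Q (some k) = truth (A = C ∧ Q k) := by
  have : (∃ x, some k = some x ∧ Q x) ↔ Q k :=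
    ⟨fun ⟨x, h, hx⟩ => by cases h; exact hx, fun h => ⟨k, rfl, h⟩⟩
  simp only [indicator, this]

theorem ncard_union_truth {α : Type*} {S : Set α} (hS : S.Finite) {a : α} (ha : a ∉ S) (p : Prop) :
    (S ∪ {x | x = a ∧ p}).ncard = S.ncard + truth p := by
  by_cases hp : p
  · simp only [hp, and_true, truth_of]
    rw [Set.union_comm, show {x | x = a} ∪ S = insert a S from rfl,
      Set.ncard_insert_of_notMem ha hS]
  · simp [hp, truth_of_not]

namespace DTD.Sound

variable {D : DTD} {X : Label} {t : XMLTree}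

theorem insert (ht : D.Sound X t) {n : ℕ} {u : XMLTree} {A B : Label} (hn : n ∈ t.nodes)
    (hd : Disjoint t.nodes u.nodes) (hA : t.lab n = some A) (hu : D.ConformsAt B u)
    (hE : D.Edge A B) :
    D.Sound X ((Update.insert n u).apply t) ∧ ∀ C Q, ¬ D.Reach B C →
      ((Update.insert n u).apply t).count C Q = t.count C Q + indicator A C Q (some (.inl B)) := by
  have hus := hu.sound
  have hr := hu.isTree.root_mem
  have hdt : ∀ m ∈ t.nodes, m ∉ u.nodes := fun m h h' => Set.disjoint_left.1 hd h h'
  have hnt : ∀ m ∈ u.nodes, m ∉ t.nodes := fun m h h' => Set.disjoint_left.1 hd h' h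
  refine ⟨⟨?_, ?_, ?_, ?_, ?_⟩, fun C Q hC => ?_⟩
  · exact (ht.edges_finite.union hus.edges_finite).union (Set.finite_singleton _)
  · rintro x y ((h | h) | h)
    · exact ⟨Or.inl (ht.edges_mem x y h).1, Or.inl (ht.edges_mem x y h).2⟩
    · exact ⟨Or.inr (hus.edges_mem x y h).1, Or.inr (hus.edges_mem x y h).2⟩
    · cases h; exact ⟨Or.inl hn, Or.inr hr⟩
  · rintro x x' y ((h | h) | h) ((h' | h') | h')
    · exact ht.unique x x' y h h'
    · exact absurd (hus.edges_mem x' y h').2 (hdt y (ht.edges_mem x y h).2)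
    · cases h'; exact absurd hr (hdt _ (ht.edges_mem _ _ h).2)
    · exact absurd (hus.edges_mem x y h).2 (hdt y (ht.edges_mem x' y h').2)
    · exact hus.unique x x' y h h'
    · cases h'; exact absurd h (hu.isTree.root_no_parent _)
    · cases h; exact absurd hr (hdt _ (ht.edges_mem _ _ h').2)
    · cases h; exact absurd h' (hu.isTree.root_no_parent _)
    · cases h; cases h'; rfl
  · rintro x y ((h | h) | h)
    · obtain ⟨hx, hy⟩ := ht.edges_mem x y h
      simpa [Update.apply, hdt x hx, hdt y hy] using ht.edge_lab x y h
    · obtain ⟨hx, hy⟩ := hus.edges_mem x y h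
      simpa [Update.apply, hx, hy] using hus.edge_lab x y h
    · cases h
      refine ⟨A, by simpa [Update.apply, hdt n hn] using hA, fun B' hB' => ?_⟩
      simp only [Update.apply, hr, if_true, hu.root_lab, Option.some.injEq] at hB'
      exact hB' ▸ hE
  · rintro m (h | h) A' hA'
    · exact ht.reach m h A' (by simpa [Update.apply, hdt m h] using hA')
    · exact ((ht.reach n hn A hA).tail hE).trans
        (hus.reach m h A' (by simpa [Update.apply, h] using hA'))
  · have hkt : ∀ m ∈ t.nodes, ((Update.insert n u).apply t).key m = t.key m := by
      intro m hm
      simp [XMLTree.key, Update.apply, hdt m hm]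
    have hkr : ((Update.insert n u).apply t).key u.root = .inl B := by
      simp [XMLTree.key, Update.apply, hr, hu.root_lab]
    have hset : ((Update.insert n u).apply t).marked C Q
        = t.marked C Q ∪ {e | e = (n, u.root) ∧ (A = C ∧ Q (.inl B))} := by
      ext ⟨x, y⟩
      constructor
      · rintro ⟨(h | h) | h, h₁, h₂⟩
        · obtain ⟨hx, hy⟩ := ht.edges_mem x y h
          exact Or.inl ⟨h, by simpa [Update.apply, hdt x hx] using h₁, by
            simpa [hkt y hy] using h₂⟩
        · obtain ⟨hx, hy⟩ := hus.edges_mem x y h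
          exact absurd (hus.reach x hx C (by simpa [Update.apply, hx] using h₁)) hC
        · cases h
          refine Or.inr ⟨rfl, ?_, by simpa [hkr] using h₂⟩
          simpa [Update.apply, hdt n hn, hA] using h₁
      · rintro (⟨h, h₁, h₂⟩ | ⟨h, h₁, h₂⟩)
        · obtain ⟨hx, hy⟩ := ht.edges_mem x y h
          exact ⟨Or.inl (Or.inl h), by simpa [Update.apply, hdt x hx] using h₁, by
            simpa [hkt y hy] using h₂⟩
        · cases h
          exact ⟨Or.inr rfl, by simpa [Update.apply, hdt n hn, hA] using h₁, by
            simpa [hkr] using h₂⟩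
    rw [XMLTree.count, hset, ncard_union_truth]
    · rw [XMLTree.count, indicator_some]
    · exact ht.edges_finite.subset fun e he => he.1
    · exact fun he => hnt _ hr (ht.edges_mem _ _ he.1).2

theorem notMem_desc (ht : D.Sound X t) {p n : ℕ} {B : Label} (hp : (p, n) ∈ t.edges)
    (hB : t.lab n = some B) : p ∉ t.desc n := by
  intro h
  obtain ⟨A, hA, hE⟩ := ht.edge_lab p n hp
  exact DTD.not_edge_of_reach (DTD.reach_of_path ht.edge_lab h hB hA) (hE B hB)

theorem delete (ht : D.Sound X t) {p n : ℕ} {A B : Label} (hp : (p, n) ∈ t.edges)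
    (hA : t.lab p = some A) (hB : t.lab n = some B) :
    D.Sound X ((Update.delete n).apply t) ∧ ∀ C Q, ¬ D.Reach B C →
      ((Update.delete n).apply t).count C Q + indicator A C Q (some (.inl B)) = t.count C Q := by
  refine ⟨⟨?_, ?_, ?_, ?_, ?_⟩, fun C Q hC => ?_⟩
  · exact ht.edges_finite.subset fun e he => he.1
  · rintro x y ⟨h, h₁, h₂⟩
    exact ⟨⟨(ht.edges_mem x y h).1, h₁⟩, ⟨(ht.edges_mem x y h).2, h₂⟩⟩
  · exact fun x x' y h h' => ht.unique x x' y h.1 h'.1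
  · exact fun x y h => ht.edge_lab x y h.1
  · exact fun m hm => ht.reach m hm.1
  · have hset : t.marked C Q = ((Update.delete n).apply t).marked C Q
        ∪ {e | e = (p, n) ∧ (A = C ∧ Q (.inl B))} := by
      ext ⟨x, y⟩
      constructor
      · rintro ⟨h, h₁, h₂⟩
        by_cases hxy : (x, y) = (p, n)
        · cases hxy
          refine Or.inr ⟨rfl, ?_, by rwa [XMLTree.key_of_lab hB] at h₂⟩
          exact Option.some.inj (hA.symm.trans h₁)
        · have hx : x ∉ t.desc n := fun hx => hC (DTD.reach_of_path ht.edge_lab hx hB h₁)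
          refine Or.inl ⟨⟨h, hx, fun hy => ?_⟩, h₁, h₂⟩
          rcases ReflTransGen.cases_tail hy with rfl | ⟨z, hz, hzy⟩
          · exact hxy (by rw [ht.unique x p y h hp])
          · exact hx (ht.unique z x y hzy h ▸ hz)
      · rintro (⟨h, h₁, h₂⟩ | ⟨h, h₁, h₂⟩)
        · exact ⟨h.1, h₁, h₂⟩
        · cases h
          exact ⟨hp, h₁ ▸ hA, by rwa [XMLTree.key_of_lab hB]⟩
    rw [XMLTree.count, XMLTree.count, hset, ncard_union_truth]
    · rw [indicator_some]
    · exact ht.edges_finite.subset fun e he => he.1.1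
    · exact fun he => he.1.2.2 ReflTransGen.refl

/-- A replacement is a deletion followed by an insertion. -/
theorem replace_apply (ht : D.Sound X t) {p n : ℕ} (hp : (p, n) ∈ t.edges) (u : XMLTree) :
    (Update.replace n u).apply t = (Update.insert p u).apply ((Update.delete n).apply t) := by
  have : {e : ℕ × ℕ | (e.1, n) ∈ t.edges ∧ e.2 = u.root} = {(p, u.root)} := by
    ext ⟨x, y⟩
    constructor
    · rintro ⟨h, rfl⟩
      rw [ht.unique x p n h hp]; rfl
    · intro h
      cases h
      exact ⟨hp, rfl⟩
  simp only [Update.apply, this]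

theorem replaceText (ht : D.Sound X t) {p n : ℕ} {A : Label} (hp : (p, n) ∈ t.edges)
    (hA : t.lab p = some A) (hn : t.lab n = none) (s : String) :
    D.Sound X ((Update.replaceText n s).apply t) ∧ ∀ C Q,
      ((Update.replaceText n s).apply t).count C Q + indicator A C Q (some (.inr (t.val n)))
        = t.count C Q + indicator A C Q (some (.inr (some s))) := by
  refine ⟨⟨ht.edges_finite, ht.edges_mem, ht.unique, ht.edge_lab, ht.reach⟩, fun C Q => ?_⟩
  have hkey : ∀ m, m ≠ n → ((Update.replaceText n s).apply t).key m = t.key m := by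
    intro m hm
    simp [XMLTree.key, Update.apply, hm]
  have hkn : ((Update.replaceText n s).apply t).key n = .inr (some s) := by
    simp [XMLTree.key, Update.apply, hn]
  have hpar : ∀ x y, (x, y) ∈ t.edges → (x, y) ≠ (p, n) → y ≠ n := by
    rintro x y h hne rfl
    exact hne (by rw [ht.unique x p y h hp])
  let S := t.marked C Q \ {(p, n)}
  have h₁ : t.marked C Q = S ∪ {e | e = (p, n) ∧ (A = C ∧ Q (.inr (t.val n)))} := by
    ext ⟨x, y⟩
    constructor
    · intro h
      by_cases hxy : (x, y) = (p, n)
      · obtain ⟨h, h₁, h₂⟩ := h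
        cases hxy
        exact Or.inr ⟨rfl, Option.some.inj (hA.symm.trans h₁), by
          rwa [XMLTree.key_of_text hn] at h₂⟩
      · exact Or.inl ⟨h, hxy⟩
    · rintro (⟨h, -⟩ | ⟨h, h₁, h₂⟩)
      · exact h
      · cases h
        exact ⟨hp, h₁ ▸ hA, by rwa [XMLTree.key_of_text hn]⟩
  have h₂ : ((Update.replaceText n s).apply t).marked C Q
      = S ∪ {e | e = (p, n) ∧ (A = C ∧ Q (.inr (some s)))} := by
    ext ⟨x, y⟩
    constructor
    · rintro ⟨h, h₁, h₂⟩
      by_cases hxy : (x, y) = (p, n)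
      · cases hxy
        exact Or.inr ⟨rfl, Option.some.inj (hA.symm.trans h₁), by rwa [hkn] at h₂⟩
      · exact Or.inl ⟨⟨h, h₁, by rwa [hkey y (hpar x y h hxy)] at h₂⟩, hxy⟩
    · rintro (⟨⟨h, h₁, h₂⟩, hxy⟩ | ⟨h, h₁, h₂⟩)
      · exact ⟨h, h₁, by rwa [hkey y (hpar x y h hxy)]⟩
      · cases h
        exact ⟨hp, h₁ ▸ hA, by rwa [hkn]⟩
  have hS : S.Finite := ht.edges_finite.subset fun e he => he.1.1
  rw [XMLTree.count, XMLTree.count, h₂, h₁, ncard_union_truth hS (by simp [S]),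
    ncard_union_truth hS (by simp [S])]
  rw [indicator_some, indicator_some]
  omega

end DTD.Sound

/-- The type of the node whose children an update access type changes. -/
def UAT.src : UAT → Label
  | .insert A _ => A
  | .delete A _ => A
  | .replace A _ _ => A
  | .replaceText A => A

/-- `u.Change o n`: an update of type `u` may take away a child with key `o` and add a child with
key `n`. -/
inductive UAT.Change : UAT → Option Key → Option Key → Prop
  | insert (A B) : Change (.insert A B) none (some (.inl B))
  | delete (A B) : Change (.delete A B) (some (.inl B)) none
  | replace (A) {B B'} (h : B ≠ B') : Change (.replace A B B') (some (.inl B)) (some (.inl B'))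
  | replaceText (A v s) : Change (.replaceText A) (some (.inr v)) (some (.inr (some s)))

/-- Every update of a valid type changes the counts by exchanging one child of one node, except
for the counts at types that may occur inside the subtrees which it removes or adds. -/
theorem DTD.Sound.effect {D : DTD} {X : Label} {t : XMLTree} (ht : D.Sound X t) {op : Update}
    {u : UAT} (hu : u ∈ D.validUATs) (hv : op.ValidOn t) (hm : D.Matches t op u) :
    D.Sound X (op.apply t) ∧ D.Reach X u.src ∧ ∃ o n, u.Change o n ∧ (o = n → op.apply t = t) ∧
      ∀ C Q, (∀ B, o = some (.inl B) ∨ n = some (.inl B) → ¬ D.Reach B C) →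
        (op.apply t).count C Q + indicator u.src C Q o = t.count C Q + indicator u.src C Q n := by
  cases op <;> cases u <;> simp only [DTD.Matches] at hm
  case insert.insert n v A B =>
    obtain ⟨hn, hd⟩ := hv
    obtain ⟨hA, hc⟩ := hm
    obtain ⟨hAe, hrg⟩ := hu
    have hE : D.Edge A B := ⟨hAe, by simp [hrg, Content.subs]⟩
    obtain ⟨h₁, h₂⟩ := ht.insert hn hd hA hc hE
    refine ⟨h₁, ht.reach n hn A hA, none, _, .insert A B, by simp, fun C Q h => ?_⟩
    rw [h₂ C Q (h B (Or.inr rfl)), indicator_none]; rfl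
  case delete.delete n A B =>
    obtain ⟨hB, p, hp, hA⟩ := hm
    obtain ⟨h₁, h₂⟩ := ht.delete hp hA hB
    refine ⟨h₁, ht.reach p (ht.edges_mem p n hp).1 A hA, _, none, .delete A B, by simp,
      fun C Q h => ?_⟩
    rw [← h₂ C Q (h B (Or.inl rfl)), indicator_none]; rfl
  case replace.replace n v A B B' =>
    obtain ⟨hn, hd⟩ := hv
    obtain ⟨hB, hc, hne, p, hp, hA⟩ := hm
    obtain ⟨hAe, Bs, hrg, hBs, hBs', -⟩ := hu
    have hE : D.Edge A B' := ⟨hAe, by simpa [hrg, Content.subs] using hBs'⟩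
    obtain ⟨h₁, h₂⟩ := ht.delete hp hA hB
    obtain ⟨h₃, h₄⟩ := h₁.insert (n := p) (u := v) ⟨(ht.edges_mem p n hp).1, ht.notMem_desc hp hB⟩
      (hd.mono_left fun m hm => hm.1) hA hc hE
    rw [ht.replace_apply hp]
    refine ⟨h₃, ht.reach p (ht.edges_mem p n hp).1 A hA, _, _, .replace A hne, by simp [hne],
      fun C Q h => ?_⟩
    rw [h₄ C Q (h B' (Or.inr rfl)), ← h₂ C Q (h B (Or.inl rfl))]
    simp only [UAT.src]
    omega
  case replaceText.replaceText n s A =>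
    obtain ⟨hn, p, hp, hA⟩ := hm
    obtain ⟨h₁, h₂⟩ := ht.replaceText hp hA hn s
    refine ⟨h₁, ht.reach p (ht.edges_mem p n hp).1 A hA, _, _, .replaceText A (t.val n) s, ?_,
      fun C Q _ => h₂ C Q⟩
    intro h
    simp only [Option.some.injEq, Sum.inr.injEq] at h
    simp only [Update.apply, ← h, Function.update_eq_self]

theorem UAT.Change.edge {D : DTD} {u : UAT} {o n : Option Key} (h : u.Change o n)
    (hu : u ∈ D.validUATs) {B : Label} (hB : o = some (.inl B) ∨ n = some (.inl B)) :
    D.Edge u.src B := by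
  cases h with
  | insert A B' =>
    obtain ⟨hA, hrg⟩ := hu
    obtain rfl : B' = B := by simpa using hB
    exact ⟨hA, by simp [UAT.src, hrg, Content.subs]⟩
  | delete A B' =>
    obtain ⟨hA, hrg⟩ := hu
    obtain rfl : B' = B := by simpa using hB
    exact ⟨hA, by simp [UAT.src, hrg, Content.subs]⟩
  | replace A h' =>
    obtain ⟨hA, Bs, hrg, h₁, h₂, -⟩ := hu
    refine ⟨hA, ?_⟩
    simp only [Option.some.injEq, Sum.inl.injEq] at hB
    rcases hB with rfl | rfl <;> simpa [UAT.src, hrg, Content.subs]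
  | replaceText A v s => simp at hB

theorem DTD.Sound.not_iso {D : DTD} {X : Label} {t : XMLTree} (ht : D.Sound X t) {op : Update}
    {u : UAT} (hu : u ∈ D.validUATs) (hv : op.ValidOn t) (hm : D.Matches t op u)
    (hne : op.apply t ≠ t) : ¬ (op.apply t).Iso t := by
  intro hiso
  obtain ⟨hs, -, o, n, hch, heq, hcount⟩ := ht.effect hu hv hm
  have key := fun k => hcount u.src (fun x => some x = k)
    fun B hB h => D.not_edge_of_reach h (hch.edge hu hB)
  simp only [hiso.count_eq hs.edges_mem ht.edges_mem] at key
  have key : ∀ k, indicator u.src u.src (fun x => some x = k) o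
      = indicator u.src u.src (fun x => some x = k) n := fun k => by
    have := key k; omega
  refine hne (heq ?_)
  have h₁ := key o
  have h₂ := key n
  cases o <;> cases n <;> simp [indicator, truth] at h₁ h₂ ⊢
  exact h₁.symm

end XMLPolicy

namespace XMLPolicy

open Relation

/-! ### Policies without a bypass are consistent -/

theorem wellFounded_of_finite {α : Type*} {r : α → α → Prop} [IsStrictOrder α r] {S : Set α}
    (hS : S.Finite) (h : ∀ a b, r a b → a ∈ S) : WellFounded r := by
  have hfin := Set.wellFoundedOn_iff.1 (hS.wellFoundedOn (r := r))
  have hmem : ∀ a ∈ S, Acc r a := by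
    intro a ha
    have := hfin.apply a
    induction this with
    | intro a _ ih =>
      exact ⟨a, fun b hb => ih b ⟨hb, h b a hb, ha⟩ (h b a hb)⟩
  exact ⟨fun a => ⟨a, fun b hb => hmem b (h b a hb)⟩⟩

theorem DTD.wellFounded_ancestors (D : DTD) : WellFounded (TransGen D.Edge) := by
  have : IsStrictOrder Label (TransGen D.Edge) :=
    { irrefl := D.acyclic, trans := fun _ _ _ => TransGen.trans }
  refine wellFounded_of_finite D.ele.finite_toSet fun A B h => ?_
  obtain ⟨_, h, -⟩ := TransGen.head'_iff.1 h
  exact h.1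

namespace Policy

variable {D : DTD} (P : Policy D)

/-- The policy allows to replace `B`-children of `A`-nodes by `B'`-trees. -/
def Replaces (A B B' : Label) : Prop := UAT.replace A B B' ∈ P.allowed

/-- The policy allows to replace an `E`-child of a `C`-node by any other `E`-tree, by deleting and
inserting or by a cycle of replacements. -/
def Resets (C E : Label) : Prop :=
  (UAT.insert C E ∈ P.allowed ∧ UAT.delete C E ∈ P.allowed) ∨ TransGen (P.Replaces C) E E

/-- A forbidden update type which can be simulated: either a replacement that is the composition of
allowed replacements, or one below a node which can be replaced as a whole. -/
def Bypass : Prop :=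
  ∃ u ∈ P.forbidden, D.Reach D.rt u.src ∧
    ((∃ A B B', u = .replace A B B' ∧ TransGen (P.Replaces A) B B') ∨
      ∃ C E, D.Reach D.rt C ∧ P.Resets C E ∧ D.Reach E u.src)

/-- What an allowed update does to the counts of an instance at `X`: its type, the key of the child
that is taken away, and the key of the child that is added. -/
structure Event (X : Label) where
  type : UAT
  old : Option Key
  new : Option Key
  allowed : type ∈ P.allowed
  change : type.Change old new
  reach : D.Reach X type.src

variable {P}

/-- `B` is the label of a subtree that is removed or added. -/
def Event.Moves {X : Label} (ev : P.Event X) (B : Label) : Prop :=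
  ev.old = some (.inl B) ∨ ev.new = some (.inl B)

theorem Event.edge {X : Label} (ev : P.Event X) {B : Label} (h : ev.Moves B) :
    D.Edge ev.type.src B := ev.change.edge (P.allowed_valid ev.allowed) h

/-- The counting balance of an allowed sequence. -/
theorem AllowedSeq.balance {X : Label} (ops : List Update) : ∀ {t : XMLTree}, D.Sound X t →
    P.AllowedSeq t ops → ∃ evs : List (P.Event X), D.Sound X (Update.applySeq t ops) ∧
      ∀ C Q, (∀ ev ∈ evs, ∀ B, ev.Moves B → ¬ D.Reach B C) →
        (Update.applySeq t ops).count C Q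
            + (evs.map fun ev => indicator ev.type.src C Q ev.old).sum
          = t.count C Q + (evs.map fun ev => indicator ev.type.src C Q ev.new).sum := by
  induction ops with
  | nil => exact fun ht _ => ⟨[], ht, fun C Q _ => rfl⟩
  | cons op ops ih =>
    rintro t ht ⟨hv, ⟨u, hu, hm⟩, hs⟩
    obtain ⟨ht', hr, o, n, hch, -, hc⟩ := ht.effect (P.allowed_valid hu) hv hm
    obtain ⟨evs, hsound, hb⟩ := ih ht' hs
    refine ⟨⟨u, o, n, hu, hch, hr⟩ :: evs, hsound, fun C Q h => ?_⟩
    have h₁ := hc C Q (h _ List.mem_cons_self)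
    have h₂ := hb C Q fun ev hev => h ev (List.mem_cons_of_mem _ hev)
    simp only [List.map_cons, List.sum_cons, Update.applySeq]
    omega

theorem Event.sum_le {X : Label} {C : Label} {Q : Key → Prop} (evs : List (P.Event X))
    (h : ∀ ev ∈ evs, indicator ev.type.src C Q ev.old ≤ indicator ev.type.src C Q ev.new) :
    (evs.map fun ev => indicator ev.type.src C Q ev.old).sum
      ≤ (evs.map fun ev => indicator ev.type.src C Q ev.new).sum :=
  List.sum_le_sum h

theorem Event.sum_lt {X : Label} {C : Label} {Q : Key → Prop} {evs : List (P.Event X)}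
    (h : ∀ ev ∈ evs, indicator ev.type.src C Q ev.old ≤ indicator ev.type.src C Q ev.new)
    {ev : P.Event X} (hev : ev ∈ evs)
    (hlt : indicator ev.type.src C Q ev.old < indicator ev.type.src C Q ev.new) :
    (evs.map fun ev => indicator ev.type.src C Q ev.old).sum
      < (evs.map fun ev => indicator ev.type.src C Q ev.new).sum :=
  List.sum_lt_sum _ _ h ⟨ev, hev, hlt⟩

theorem sum_indicator_eq_zero {X : Label} {C : Label} {Q : Key → Prop} {evs : List (P.Event X)}
    {k : P.Event X → Option Key} (h : ∀ ev ∈ evs, indicator ev.type.src C Q (k ev) = 0) :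
    (evs.map fun ev => indicator ev.type.src C Q (k ev)).sum = 0 := by
  rw [List.sum_eq_zero]
  intro n hn
  obtain ⟨ev, hev, rfl⟩ := List.mem_map.1 hn
  exact h ev hev

/-- The types that an allowed sequence of replacements can turn `B` into. -/
def upSet (P : Policy D) (A B : Label) (k : Key) : Prop :=
  ∃ E, k = .inl E ∧ ReflTransGen (P.Replaces A) B E

/-- At an `A`-node whose children are alternatives, allowed updates stay within an up-set. -/
theorem Event.upSet_le {X : Label} (ev : P.Event X) {A : Label} {Bs : List Label}
    (hA : D.rg A = .alt Bs) (B : Label) :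
    indicator ev.type.src A (P.upSet A B) ev.old
      ≤ indicator ev.type.src A (P.upSet A B) ev.new := by
  by_cases hsrc : ev.type.src = A
  · obtain ⟨u, o, n, hu, hch, hr⟩ := ev
    have hval := P.allowed_valid hu
    cases hch with
    | insert A' B' =>
      have hsrc : A' = A := hsrc
      have : D.rg A' = .star B' := hval.2
      rw [hsrc, hA] at this
      cases this
    | delete A' B' =>
      have hsrc : A' = A := hsrc
      have : D.rg A' = .star B' := hval.2
      rw [hsrc, hA] at this
      cases this
    | replaceText A' =>
      have hsrc : A' = A := hsrc
      have : D.rg A' = .text := hval.2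
      rw [hsrc, hA] at this
      cases this
    | @replace A' E E' hne =>
      have hsrc : A' = A := hsrc
      subst hsrc
      rw [indicator_some, indicator_some]
      change truth (A' = A' ∧ _) ≤ truth (A' = A' ∧ _)
      by_cases h : P.upSet A' B (.inl E)
      · have : P.upSet A' B (.inl E') := by
          obtain ⟨E₁, h₁, h₂⟩ := h
          cases h₁
          exact ⟨E', rfl, h₂.tail hu⟩
        rw [truth_of (p := _ ∧ P.upSet A' B (.inl E')) ⟨rfl, this⟩]
        unfold truth; split <;> omega
      · rw [truth_of_not (p := _ ∧ P.upSet A' B (.inl E)) fun h' => h h'.2]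
        omega
  · rw [indicator_of_ne hsrc, indicator_of_ne hsrc]

/-- The key step: in a sequence which yields the result of a forbidden update `u₀` at `A`-nodes, no
update can move a subtree with an `A`-node in it. Otherwise take such updates at a type `C` as close
to the root as possible. The `C`-nodes are then not affected by any other moves, so that the counts
of their children change only in one direction, while `u₀` does not change them. -/
theorem not_reach_of_balance (hP : ¬ P.Bypass) {u₀ : UAT} (hu₀ : u₀ ∈ P.forbidden)
    {o₀ n₀ : Option Key} (hch : u₀.Change o₀ n₀) (hr : D.Reach D.rt u₀.src)
    {evs : List (P.Event D.rt)}
    (hbal : ∀ C Q, (∀ ev ∈ evs, ∀ B, ev.Moves B → ¬ D.Reach B C) →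
      (∀ B, o₀ = some (.inl B) ∨ n₀ = some (.inl B) → ¬ D.Reach B C) →
      (evs.map fun ev => indicator ev.type.src C Q ev.new).sum + indicator u₀.src C Q o₀
        = (evs.map fun ev => indicator ev.type.src C Q ev.old).sum + indicator u₀.src C Q n₀) :
    ∀ ev ∈ evs, ∀ B, ev.Moves B → ¬ D.Reach B u₀.src := by
  have hval₀ := P.forbidden_valid hu₀
  have claim : ∀ C, D.Reach C u₀.src → ∀ ev ∈ evs, ev.type.src = C →
      ∀ B, ev.Moves B → ¬ D.Reach B u₀.src := by
    intro C
    induction C using D.wellFounded_ancestors.induction with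
    | h C ih =>
    rintro hC ⟨u, o, n, hu, hchu, hru⟩ hev hsrc B hB hBA
    have hCB : D.Edge C B := hsrc ▸ Event.edge _ hB
    have hmoves : ∀ ev ∈ evs, ∀ B', ev.Moves B' → ¬ D.Reach B' C := by
      intro ev' hev' B' hB' hB'C
      exact ih ev'.type.src (TransGen.head' (ev'.edge hB') hB'C)
        (hB'C.head (ev'.edge hB') |>.trans hC) ev' hev' rfl B' hB' (hB'C.trans hC)
    have hmoves₀ : ∀ B', o₀ = some (.inl B') ∨ n₀ = some (.inl B') → ¬ D.Reach B' C :=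
      fun B' hB' h => D.not_edge_of_reach (h.trans hC) (hch.edge hval₀ hB')
    have hne : u₀.src ≠ C := by
      rintro rfl
      exact D.not_edge_of_reach hBA hCB
    have hb := fun Q => hbal C Q hmoves hmoves₀
    simp only [indicator_of_ne hne, Nat.add_zero] at hb
    have hrC : D.Reach D.rt C := hsrc ▸ hru
    have hreset : ¬ P.Resets C B := fun h => hP ⟨u₀, hu₀, hr, Or.inr ⟨C, B, hrC, h, hBA⟩⟩
    have hval := P.allowed_valid hu
    cases hchu with
    | insert C' B' =>
      obtain rfl : B' = B := by simpa [Event.Moves] using hB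
      have hsrc : C' = C := hsrc
      subst hsrc
      have hdel : UAT.delete C' B' ∉ P.allowed := fun h => hreset (Or.inl ⟨hu, h⟩)
      have hzero : ∀ ev ∈ evs, indicator ev.type.src C' (· = .inl B') ev.old = 0 := by
        rintro ⟨u', o', n', hu', hch', hr'⟩ -
        by_cases hs : u'.src = C'
        · have hval' := P.allowed_valid hu'
          cases hch' with
          | insert => exact indicator_none _ _ _
          | delete C₁ B₁ =>
            have hs : C₁ = C' := hs
            subst hs
            rw [indicator_some, truth_of_not]
            rintro ⟨-, h⟩
            cases h
            exact hdel hu'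
          | replace C₁ h =>
            have hs : C₁ = C' := hs
            subst hs
            obtain ⟨-, Bs, hrg, -⟩ := hval'
            rw [hval.2] at hrg
            cases hrg
          | replaceText C₁ v s =>
            rw [indicator_some, truth_of_not]
            rintro ⟨-, h⟩
            cases h
        · exact indicator_of_ne hs _ _
      refine (Event.sum_lt (fun ev h => ?_) hev ?_).ne' (hb (· = .inl B'))
      · rw [hzero ev h]; omega
      · simp [UAT.src, indicator_none, indicator_some, truth]
    | delete C' B' =>
      obtain rfl : B' = B := by simpa [Event.Moves] using hB
      have hsrc : C' = C := hsrc
      subst hsrc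
      have hins : UAT.insert C' B' ∉ P.allowed := fun h => hreset (Or.inl ⟨h, hu⟩)
      have hzero : ∀ ev ∈ evs, indicator ev.type.src C' (· = .inl B') ev.new = 0 := by
        rintro ⟨u', o', n', hu', hch', hr'⟩ -
        by_cases hs : u'.src = C'
        · have hval' := P.allowed_valid hu'
          cases hch' with
          | delete => exact indicator_none _ _ _
          | insert C₁ B₁ =>
            have hs : C₁ = C' := hs
            subst hs
            rw [indicator_some, truth_of_not]
            rintro ⟨-, h⟩
            cases h
            exact hins hu'
          | replace C₁ h =>
            have hs : C₁ = C' := hs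
            subst hs
            obtain ⟨-, Bs, hrg, -⟩ := hval'
            rw [hval.2] at hrg
            cases hrg
          | replaceText C₁ v s =>
            rw [indicator_some, truth_of_not]
            rintro ⟨-, h⟩
            cases h
        · exact indicator_of_ne hs _ _
      refine (List.sum_lt_sum (l := evs) _ _ (fun ev h => ?_) ⟨_, hev, ?_⟩).ne (hb (· = .inl B'))
      · rw [hzero ev h]; omega
      · simp [UAT.src, indicator_none, indicator_some, truth]
    | @replace C' E E' hEE =>
      have hsrc : C' = C := hsrc
      subst hsrc
      obtain ⟨-, Bs, hrg, -⟩ := hval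
      refine (Event.sum_lt (fun ev _ => ev.upSet_le hrg E') hev ?_).ne' (hb (P.upSet C' E'))
      have hnot : ¬ P.upSet C' E' (.inl E) := by
        rintro ⟨E₁, h₁, h₂⟩
        cases h₁
        have hB : E = B ∨ E' = B := by simpa [Event.Moves] using hB
        rcases hB with rfl | rfl
        · exact hreset (Or.inr (TransGen.head' hu h₂))
        · exact hreset (Or.inr (TransGen.tail' h₂ hu))
      have hyes : P.upSet C' E' (.inl E') := ⟨E', rfl, .refl⟩
      simp [UAT.src, indicator_some, truth, hnot, hyes]
    | replaceText C' v s => simp [Event.Moves] at hB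
  intro ev hev B hB h
  exact claim ev.type.src (h.head (ev.edge hB)) ev hev rfl B hB h

theorem consistent_of_not_bypass (hP : ¬ P.Bypass) : P.Consistent := by
  rintro t ht ⟨op, ops, hv, ⟨u₀, hu₀, hm⟩, hne, hseq, hiso⟩
  have hs := DTD.ConformsAt.sound ht
  have hval₀ := P.forbidden_valid hu₀
  obtain ⟨hs₀, hr, o₀, n₀, hch, heq, hc₀⟩ := hs.effect hval₀ hv hm
  obtain ⟨evs, hs', hb⟩ := AllowedSeq.balance ops hs hseq
  have hbal : ∀ C Q, (∀ ev ∈ evs, ∀ B, ev.Moves B → ¬ D.Reach B C) →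
      (∀ B, o₀ = some (.inl B) ∨ n₀ = some (.inl B) → ¬ D.Reach B C) →
      (evs.map fun ev => indicator ev.type.src C Q ev.new).sum + indicator u₀.src C Q o₀
        = (evs.map fun ev => indicator ev.type.src C Q ev.old).sum + indicator u₀.src C Q n₀ := by
    intro C Q h₁ h₂
    have e₁ := hb C Q h₁
    have e₂ := hc₀ C Q h₂
    have e₃ := hiso.count_eq hs'.edges_mem hs₀.edges_mem C Q
    omega
  have hmoves := not_reach_of_balance hP hu₀ hch hr hbal
  have hb := fun Q => hbal u₀.src Q hmoves
    fun B hB h => D.not_edge_of_reach h (hch.edge hval₀ hB)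
  cases hch with
  | insert A B =>
    -- No allowed update adds a `B`-child to an `A`-node, because such updates are forbidden.
    have hzero : ∀ ev ∈ evs, indicator ev.type.src A (· = .inl B) ev.new = 0 := by
      rintro ⟨u', o', n', hu', hch', hr'⟩ -
      by_cases hs : u'.src = A
      · have hval' := P.allowed_valid hu'
        cases hch' with
        | delete => exact indicator_none _ _ _
        | insert C₁ B₁ =>
          have hs : C₁ = A := hs
          subst hs
          rw [indicator_some, truth_of_not]
          rintro ⟨-, h⟩
          cases h
          exact Set.disjoint_left.1 P.disjoint hu' hu₀
        | replace C₁ h =>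
          have hs : C₁ = A := hs
          subst hs
          obtain ⟨-, Bs, hrg, -⟩ := hval'
          rw [hval₀.2] at hrg
          cases hrg
        | replaceText C₁ v s =>
          rw [indicator_some, truth_of_not]
          rintro ⟨-, h⟩
          cases h
      · exact indicator_of_ne hs _ _
    have := hb (· = .inl B)
    simp only [show (UAT.insert A B).src = A from rfl] at this
    rw [sum_indicator_eq_zero hzero, indicator_none, indicator_some, truth_of ⟨rfl, rfl⟩] at this
    omega
  | delete A B =>
    -- No allowed update takes a `B`-child from an `A`-node, because such updates are forbidden.
    have hzero : ∀ ev ∈ evs, indicator ev.type.src A (· = .inl B) ev.old = 0 := by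
      rintro ⟨u', o', n', hu', hch', hr'⟩ -
      by_cases hs : u'.src = A
      · have hval' := P.allowed_valid hu'
        cases hch' with
        | insert => exact indicator_none _ _ _
        | delete C₁ B₁ =>
          have hs : C₁ = A := hs
          subst hs
          rw [indicator_some, truth_of_not]
          rintro ⟨-, h⟩
          cases h
          exact Set.disjoint_left.1 P.disjoint hu' hu₀
        | replace C₁ h =>
          have hs : C₁ = A := hs
          subst hs
          obtain ⟨-, Bs, hrg, -⟩ := hval'
          rw [hval₀.2] at hrg
          cases hrg
        | replaceText C₁ v s =>
          rw [indicator_some, truth_of_not]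
          rintro ⟨-, h⟩
          cases h
      · exact indicator_of_ne hs _ _
    have := hb (· = .inl B)
    simp only [show (UAT.delete A B).src = A from rfl] at this
    rw [sum_indicator_eq_zero hzero, indicator_none, indicator_some, truth_of ⟨rfl, rfl⟩] at this
    omega
  | @replace A B B' hBB =>
    -- The children with labels in the up-set of `B` do not become fewer by allowed updates, but the
    -- forbidden one would take such a child away.
    obtain ⟨-, Bs, hrg, -⟩ := hval₀
    have hle := Event.sum_le evs fun ev _ => ev.upSet_le hrg B
    have hnot : ¬ P.upSet A B (.inl B') := by
      rintro ⟨E, h₁, h₂⟩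
      cases h₁
      rcases reflTransGen_iff_eq_or_transGen.1 h₂ with h | h
      · exact hBB h.symm
      · exact hP ⟨_, hu₀, hr, Or.inl ⟨A, B, B', rfl, h⟩⟩
    have hyes : P.upSet A B (.inl B) := ⟨B, rfl, .refl⟩
    have := hb (P.upSet A B)
    simp only [show (UAT.replace A B B').src = A from rfl] at this
    rw [indicator_some, indicator_some, truth_of ⟨rfl, hyes⟩,
      truth_of_not fun h => hnot h.2] at this
    omega
  | replaceText A v s =>
    -- No allowed update changes the text below an `A`-node, because such updates are forbidden.
    have hnone : ∀ ev ∈ evs, ev.type.src ≠ A := by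
      rintro ⟨u', o', n', hu', hch', hr'⟩ - hs
      have hval' := P.allowed_valid hu'
      have hrg₀ : D.rg A = .text := hval₀.2
      cases hch' with
      | insert C₁ B₁ =>
        have hs : C₁ = A := hs
        have hrg : D.rg C₁ = .star B₁ := hval'.2
        rw [hs, hrg₀] at hrg
        cases hrg
      | delete C₁ B₁ =>
        have hs : C₁ = A := hs
        have hrg : D.rg C₁ = .star B₁ := hval'.2
        rw [hs, hrg₀] at hrg
        cases hrg
      | replace C₁ h =>
        have hs : C₁ = A := hs
        obtain ⟨-, Bs, hrg, -⟩ := hval'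
        rw [hs, hrg₀] at hrg
        cases hrg
      | replaceText C₁ v s =>
        have hs : C₁ = A := hs
        subst hs
        exact Set.disjoint_left.1 P.disjoint hu' hu₀
    have := hb (· = .inr v)
    simp only [show (UAT.replaceText A).src = A from rfl] at this
    rw [sum_indicator_eq_zero fun ev h => indicator_of_ne (hnone ev h) _ _,
      sum_indicator_eq_zero fun ev h => indicator_of_ne (hnone ev h) _ _, indicator_some,
      indicator_some, truth_of ⟨rfl, rfl⟩] at this
    by_cases h : (Sum.inr (some s) : Key) = .inr v
    · rw [heq (by rw [h])] at hne
      exact hne ⟨id, Set.bijOn_id _, rfl, fun _ _ _ _ => Iff.rfl, fun _ _ => rfl, fun _ _ _ => rfl⟩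
    · rw [truth_of_not fun h' => h h'.2] at this
      omega

end Policy

end XMLPolicy

namespace XMLPolicy

open Relation

/-! ### Building instances -/

namespace XMLTree

/-- The tree `t` with the tree `s` as an additional child of `c`. -/
noncomputable def att (t : XMLTree) (c : ℕ) (s : XMLTree) : XMLTree := (Update.insert c s).apply t

/-- The tree with a single node. -/
def single (k : ℕ) (x : Option Label) (v : Option String) : XMLTree where
  nodes := {k}
  edges := ∅
  lab _ := x
  root := k
  val _ := v

theorem single_isTree (k x v) : (single k x v).IsTree where
  finite := Set.finite_singleton k
  root_mem := rfl
  edges_mem _ _ h := h.elim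
  root_no_parent _ h := h
  unique_parent y hy h := absurd hy h
  reachable y hy := by
    obtain rfl : y = k := hy
    exact .refl

section att

variable {t s u : XMLTree} {c a : ℕ}

theorem att_assoc (t s u : XMLTree) (c a : ℕ) : t.att c (s.att a u) = (t.att c s).att a u := by
  simp only [att, Update.apply, XMLTree.mk.injEq, true_and]
  refine ⟨Set.union_assoc _ _ _ |>.symm, ?_, ?_, ?_⟩
  · ext e
    simp only [Set.mem_union]
    tauto
  · funext m
    by_cases h₁ : m ∈ u.nodes <;> by_cases h₂ : m ∈ s.nodes <;> simp [h₁, h₂]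
  · funext m
    by_cases h₁ : m ∈ u.nodes <;> by_cases h₂ : m ∈ s.nodes <;> simp [h₁, h₂]

theorem att_nodes : (t.att c s).nodes = t.nodes ∪ s.nodes := rfl

theorem att_root : (t.att c s).root = t.root := rfl

theorem mem_att_edges {x y : ℕ} : (x, y) ∈ (t.att c s).edges ↔
    ((x, y) ∈ t.edges ∨ (x, y) ∈ s.edges) ∨ x = c ∧ y = s.root := by
  simp only [att, Update.apply, Set.mem_union, Set.mem_singleton_iff, Prod.mk.injEq]

theorem att_lab_left (hd : Disjoint t.nodes s.nodes) {m : ℕ} (hm : m ∈ t.nodes) :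
    (t.att c s).lab m = t.lab m := by
  simp [att, Update.apply, Set.disjoint_left.1 hd hm]

theorem att_lab_right {m : ℕ} (hm : m ∈ s.nodes) : (t.att c s).lab m = s.lab m := by
  simp [att, Update.apply, hm]

theorem att_val_left (hd : Disjoint t.nodes s.nodes) {m : ℕ} (hm : m ∈ t.nodes) :
    (t.att c s).val m = t.val m := by
  simp [att, Update.apply, Set.disjoint_left.1 hd hm]

theorem att_val_right {m : ℕ} (hm : m ∈ s.nodes) : (t.att c s).val m = s.val m := by
  simp [att, Update.apply, hm]

theorem mem_att_edges_left (hs : s.IsTree) (hd : Disjoint t.nodes s.nodes)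
    {x y : ℕ} (hx : x ∈ t.nodes) : (x, y) ∈ (t.att c s).edges ↔
      (x, y) ∈ t.edges ∨ x = c ∧ y = s.root := by
  rw [mem_att_edges]
  have : (x, y) ∉ s.edges := fun h => Set.disjoint_left.1 hd hx (hs.edges_mem x y h).1
  tauto

theorem mem_att_edges_right (ht : t.IsTree) (hd : Disjoint t.nodes s.nodes) (hc : c ∈ t.nodes)
    {x y : ℕ} (hx : x ∈ s.nodes) : (x, y) ∈ (t.att c s).edges ↔ (x, y) ∈ s.edges := by
  rw [mem_att_edges]
  have h₁ : (x, y) ∉ t.edges := fun h => Set.disjoint_right.1 hd hx (ht.edges_mem x y h).1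
  have h₂ : x ≠ c := by
    rintro rfl
    exact Set.disjoint_right.1 hd hx hc
  tauto

theorem IsTree.att (ht : t.IsTree) (hs : s.IsTree) (hd : Disjoint t.nodes s.nodes)
    (hc : c ∈ t.nodes) : (t.att c s).IsTree where
  finite := ht.finite.union hs.finite
  root_mem := Or.inl ht.root_mem
  edges_mem x y h := by
    rcases mem_att_edges.1 h with (h | h) | ⟨rfl, rfl⟩
    · exact ⟨Or.inl (ht.edges_mem x y h).1, Or.inl (ht.edges_mem x y h).2⟩
    · exact ⟨Or.inr (hs.edges_mem x y h).1, Or.inr (hs.edges_mem x y h).2⟩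
    · exact ⟨Or.inl hc, Or.inr hs.root_mem⟩
  root_no_parent x h := by
    rcases mem_att_edges.1 h with (h | h) | ⟨-, h⟩
    · exact ht.root_no_parent x h
    · exact Set.disjoint_left.1 hd ht.root_mem (hs.edges_mem _ _ h).2
    · exact Set.disjoint_left.1 hd ht.root_mem (h ▸ hs.root_mem)
  unique_parent y hy hne := by
    rcases hy with hy | hy
    · obtain ⟨x, hx, hu⟩ := ht.unique_parent y hy hne
      refine ⟨x, mem_att_edges.2 (Or.inl (Or.inl hx)), fun x' hx' => ?_⟩
      rcases mem_att_edges.1 hx' with (h | h) | ⟨-, h⟩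
      · exact hu x' h
      · exact absurd (hs.edges_mem _ _ h).2 (Set.disjoint_left.1 hd hy)
      · exact absurd (h ▸ hs.root_mem) (Set.disjoint_left.1 hd hy)
    · by_cases hr : y = s.root
      · subst hr
        refine ⟨c, mem_att_edges.2 (Or.inr ⟨rfl, rfl⟩), fun x' hx' => ?_⟩
        rcases mem_att_edges.1 hx' with (h | h) | ⟨h, -⟩
        · exact absurd (ht.edges_mem _ _ h).2 (Set.disjoint_right.1 hd hy)
        · exact absurd h (hs.root_no_parent x')
        · exact h
      · obtain ⟨x, hx, hu⟩ := hs.unique_parent y hy hr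
        refine ⟨x, mem_att_edges.2 (Or.inl (Or.inr hx)), fun x' hx' => ?_⟩
        rcases mem_att_edges.1 hx' with (h | h) | ⟨-, h⟩
        · exact absurd (ht.edges_mem _ _ h).2 (Set.disjoint_right.1 hd hy)
        · exact hu x' h
        · exact absurd h hr
  reachable y hy := by
    have hl : ∀ z ∈ t.nodes,
        ReflTransGen (fun x y => (x, y) ∈ (t.att c s).edges) (t.att c s).root z := fun z hz =>
      (ht.reachable z hz).lift id fun x y h => mem_att_edges.2 (Or.inl (Or.inl h))
    rcases hy with hy | hy
    · exact hl y hy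
    · exact ((hl c hc).tail (mem_att_edges.2 (Or.inr ⟨rfl, rfl⟩))).trans
        ((hs.reachable y hy).lift id fun x y h => mem_att_edges.2 (Or.inl (Or.inr h)))

/-- The labels of the children of `n` are listed by `ls`. -/
def ChildList (t : XMLTree) (n : ℕ) (ls : List (Option Label)) : Prop :=
  ∃ l : List ℕ, l.Nodup ∧ (∀ m, m ∈ l ↔ (n, m) ∈ t.edges) ∧ l.map t.lab = ls

theorem exists_perm_map {α β : Type*} {f : α → β} {m m' : List β} (h : m.Perm m') :
    ∀ l : List α, l.map f = m → ∃ l', l.Perm l' ∧ l'.map f = m' := by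
  induction h with
  | nil => exact fun l hl => ⟨l, .refl _, hl⟩
  | cons x _ ih =>
    intro l hl
    obtain ⟨a, l, rfl, rfl, rfl⟩ := List.map_eq_cons_iff.1 hl
    obtain ⟨l', h₁, rfl⟩ := ih l rfl
    exact ⟨a :: l', h₁.cons a, rfl⟩
  | swap x y l =>
    intro l hl
    obtain ⟨a, l, rfl, rfl, h⟩ := List.map_eq_cons_iff.1 hl
    obtain ⟨b, l, rfl, rfl, rfl⟩ := List.map_eq_cons_iff.1 h
    exact ⟨b :: a :: l, .swap _ _ _, rfl⟩
  | trans _ _ ih₁ ih₂ =>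
    intro l hl
    obtain ⟨l₁, h₁, h₂⟩ := ih₁ l hl
    obtain ⟨l₂, h₃, h₄⟩ := ih₂ l₁ h₂
    exact ⟨l₂, h₁.trans h₃, h₄⟩

theorem ChildList.perm {n : ℕ} {ls ls' : List (Option Label)} (h : t.ChildList n ls)
    (hp : ls.Perm ls') : t.ChildList n ls' := by
  obtain ⟨l, hn, hm, rfl⟩ := h
  obtain ⟨l', hl', rfl⟩ := exists_perm_map hp l rfl
  exact ⟨l', hl'.nodup_iff.1 hn, fun m => by rw [← hm, hl'.mem_iff], rfl⟩

theorem ChildList.att (h : t.ChildList c ls) (ht : t.IsTree) (hs : s.IsTree)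
    (hd : Disjoint t.nodes s.nodes) (hc : c ∈ t.nodes) :
    (t.att c s).ChildList c (s.lab s.root :: ls) := by
  obtain ⟨l, hn, hm, rfl⟩ := h
  have hlt : ∀ m ∈ l, m ∈ t.nodes := fun m h => (ht.edges_mem _ _ ((hm m).1 h)).2
  refine ⟨s.root :: l, List.nodup_cons.2 ⟨fun h => ?_, hn⟩, fun m => ?_, ?_⟩
  · exact Set.disjoint_left.1 hd (hlt _ h) hs.root_mem
  · rw [mem_att_edges_left hs hd hc, List.mem_cons, hm]
    tauto
  · rw [List.map_cons, att_lab_right hs.root_mem]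
    congr 1
    exact List.map_congr_left fun m h => att_lab_left hd (hlt m h)

theorem ChildList.att_left {n : ℕ} (h : t.ChildList n ls) (ht : t.IsTree) (hs : s.IsTree)
    (hd : Disjoint t.nodes s.nodes) (hn : n ∈ t.nodes) (hne : n ≠ c) :
    (t.att c s).ChildList n ls := by
  obtain ⟨l, hl, hm, rfl⟩ := h
  refine ⟨l, hl, fun m => ?_, ?_⟩
  · rw [mem_att_edges_left hs hd hn, hm]
    tauto
  · exact List.map_congr_left fun m h => att_lab_left hd (ht.edges_mem _ _ ((hm m).1 h)).2

theorem ChildList.att_right {n : ℕ} (h : s.ChildList n ls) (ht : t.IsTree) (hs : s.IsTree)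
    (hd : Disjoint t.nodes s.nodes) (hc : c ∈ t.nodes) (hn : n ∈ s.nodes) :
    (t.att c s).ChildList n ls := by
  obtain ⟨l, hl, hm, rfl⟩ := h
  refine ⟨l, hl, fun m => ?_, ?_⟩
  · rw [mem_att_edges_right ht hd hc hn, hm]
  · exact List.map_congr_left fun m h => att_lab_right (hs.edges_mem _ _ ((hm m).1 h)).2

end att

end XMLTree

/-- `t` is a tree with root label `x` (or a single `str`-node) that is an instance of `D`, except
that the children of the nodes in `H` may be arbitrary. -/
structure DTD.Partial (D : DTD) (x : Option Label) (H : Set ℕ) (t : XMLTree) : Prop where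
  isTree : t.IsTree
  root_lab : t.lab t.root = x
  lab_mem : ∀ n ∈ t.nodes, ∀ B, t.lab n = some B → B ∈ D.ele
  children : ∀ n ∈ t.nodes, n ∉ H → ∀ B, t.lab n = some B →
    ∃ ls ∈ (D.rg B).language, t.ChildList n ls
  text_leaf : ∀ n ∈ t.nodes, t.lab n = none → (t.val n).isSome ∧ ∀ m, (n, m) ∉ t.edges

namespace DTD

variable {D : DTD}

theorem conformsAt_iff {A : Label} {t : XMLTree} :
    D.ConformsAt A t ↔ D.Partial (some A) ∅ t := by
  constructor
  · intro h
    refine ⟨h.isTree, h.root_lab, h.lab_mem, fun n hn _ B hB => ?_, h.text_leaf⟩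
    obtain ⟨l, h₁, h₂, h₃⟩ := h.children n hn B hB
    exact ⟨_, h₃, l, h₁, h₂, rfl⟩
  · intro h
    refine ⟨h.isTree, h.root_lab, h.lab_mem, fun n hn B hB => ?_, h.text_leaf⟩
    obtain ⟨_, h₃, l, h₁, h₂, rfl⟩ := h.children n hn (Set.notMem_empty n) B hB
    exact ⟨l, h₁, h₂, h₃⟩

namespace Partial

theorem single {A : Label} (hA : A ∈ D.ele) (k : ℕ) :
    D.Partial (some A) {k} (XMLTree.single k (some A) none) where
  isTree := XMLTree.single_isTree _ _ _
  root_lab := rfl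
  lab_mem n hn B hB := by
    cases hB
    exact hA
  children n hn h := absurd hn h
  text_leaf n hn h := by cases h

theorem text (k : ℕ) (v : String) : D.Partial none ∅ (XMLTree.single k none (some v)) where
  isTree := XMLTree.single_isTree _ _ _
  root_lab := rfl
  lab_mem n hn B hB := by cases hB
  children n hn h B hB := by cases hB
  text_leaf n hn h := ⟨rfl, fun m hm => hm⟩

theorem att {x y : Option Label} {H K : Set ℕ} {t s : XMLTree} {c : ℕ} {A : Label}
    (ht : D.Partial x H t) (hs : D.Partial y K s) (hd : Disjoint t.nodes s.nodes)
    (hc : c ∈ t.nodes) (hcH : c ∈ H) (hA : t.lab c = some A) :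
    D.Partial x (H ∪ K) (t.att c s) where
  isTree := ht.isTree.att hs.isTree hd hc
  root_lab := by
    rw [XMLTree.att_root, XMLTree.att_lab_left hd ht.isTree.root_mem, ht.root_lab]
  lab_mem n hn B hB := by
    rcases hn with hn | hn
    · rw [XMLTree.att_lab_left hd hn] at hB
      exact ht.lab_mem n hn B hB
    · rw [XMLTree.att_lab_right hn] at hB
      exact hs.lab_mem n hn B hB
  children n hn hH B hB := by
    rcases hn with hn | hn
    · rw [XMLTree.att_lab_left hd hn] at hB
      obtain ⟨ls, h₁, h₂⟩ := ht.children n hn (fun h => hH (Or.inl h)) B hB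
      refine ⟨ls, h₁, h₂.att_left ht.isTree hs.isTree hd hn ?_⟩
      rintro rfl
      exact hH (Or.inl hcH)
    · rw [XMLTree.att_lab_right hn] at hB
      obtain ⟨ls, h₁, h₂⟩ := hs.children n hn (fun h => hH (Or.inr h)) B hB
      exact ⟨ls, h₁, h₂.att_right ht.isTree hs.isTree hd hc hn⟩
  text_leaf n hn hn' := by
    rcases hn with hn | hn
    · rw [XMLTree.att_lab_left hd hn] at hn'
      obtain ⟨h₁, h₂⟩ := ht.text_leaf n hn hn'
      refine ⟨by rwa [XMLTree.att_val_left hd hn], fun m hm => ?_⟩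
      rcases (XMLTree.mem_att_edges_left hs.isTree hd hn).1 hm with h | ⟨rfl, -⟩
      · exact h₂ m h
      · rw [hA] at hn'; cases hn'
    · rw [XMLTree.att_lab_right hn] at hn'
      obtain ⟨h₁, h₂⟩ := hs.text_leaf n hn hn'
      refine ⟨by rwa [XMLTree.att_val_right hn], fun m hm => ?_⟩
      exact h₂ m ((XMLTree.mem_att_edges_right ht.isTree hd hc hn).1 hm)

theorem close {x : Option Label} {H K : Set ℕ} {t : XMLTree} {c : ℕ} {A : Label}
    {ls ls' : List (Option Label)} (ht : D.Partial x H t) (hA : t.lab c = some A)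
    (hl : t.ChildList c ls) (hp : ls.Perm ls') (hls : ls' ∈ (D.rg A).language)
    (hK : ∀ n ∈ H, n ≠ c → n ∈ K) : D.Partial x K t where
  isTree := ht.isTree
  root_lab := ht.root_lab
  lab_mem := ht.lab_mem
  children n hn hnK B hB := by
    by_cases h : n = c
    · subst h
      rw [hA] at hB
      cases hB
      exact ⟨ls', hls, hl.perm hp⟩
    · exact ht.children n hn (fun hH => hnK (hK n hH h)) B hB
  text_leaf := ht.text_leaf

end Partial

theorem wellFounded_descendants (D : DTD) :
    WellFounded (fun B A : Label => TransGen D.Edge A B) := by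
  have : IsStrictOrder Label (fun B A : Label => TransGen D.Edge A B) :=
    { irrefl := D.acyclic, trans := fun _ _ _ h h' => h'.trans h }
  refine wellFounded_of_finite D.ele.finite_toSet fun B A h => ?_
  obtain ⟨_, -, h⟩ := TransGen.tail'_iff.1 h
  exact D.subs_mem _ h.1 _ h.2

/-- Attach instances of given types, which exist outside any finite set of nodes. -/
theorem Partial.attach_all {x : Option Label} {t : XMLTree} {c : ℕ} {A : Label} {F : Set ℕ}
    (hF : F.Finite) (ht : D.Partial x {c} t) (hc : c ∈ t.nodes) (hA : t.lab c = some A)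
    (hl : t.ChildList c []) (hd : Disjoint t.nodes F) (Bs : List Label)
    (h : ∀ B ∈ Bs, ∀ F : Set ℕ, F.Finite → ∃ s, D.Partial (some B) ∅ s ∧ Disjoint s.nodes F) :
    ∃ t', D.Partial x {c} t' ∧ c ∈ t'.nodes ∧ t'.lab c = some A ∧
      t'.ChildList c (Bs.map some) ∧ Disjoint t'.nodes F := by
  induction Bs with
  | nil => exact ⟨t, ht, hc, hA, hl, hd⟩
  | cons B Bs ih =>
    obtain ⟨t', ht', hc', hA', hl', hd'⟩ := ih fun B hB => h B (List.mem_cons_of_mem _ hB)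
    obtain ⟨s, hs, hds⟩ := h B List.mem_cons_self (F ∪ t'.nodes) (hF.union ht'.isTree.finite)
    rw [Set.disjoint_union_right] at hds
    refine ⟨t'.att c s, ?_, Or.inl hc', ?_, ?_, ?_⟩
    · simpa using ht'.att hs hds.2.symm hc' rfl hA'
    · rw [XMLTree.att_lab_left hds.2.symm hc', hA']
    · have := hl'.att ht'.isTree hs.isTree hds.2.symm hc'
      rwa [hs.root_lab] at this
    · rw [XMLTree.att_nodes, Set.disjoint_union_left]
      exact ⟨hd', hds.1⟩

theorem childList_single (k x v) : (XMLTree.single k x v).ChildList k [] :=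
  ⟨[], List.nodup_nil, fun m => by simp [XMLTree.single], rfl⟩

theorem exists_notMem {F : Set ℕ} (hF : F.Finite) : ∃ k, k ∉ F := hF.exists_notMem

theorem disjoint_single {F : Set ℕ} {k : ℕ} (hk : k ∉ F) (x v) :
    Disjoint (XMLTree.single k x v).nodes F := Set.disjoint_singleton_left.2 hk

/-- Every type has an instance, outside any finite set of nodes. -/
theorem exists_instance {A : Label} (hA : A ∈ D.ele) : ∀ F : Set ℕ, F.Finite →
    ∃ s, D.Partial (some A) ∅ s ∧ Disjoint s.nodes F := by
  induction A using D.wellFounded_descendants.induction with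
  | h A ih =>
  intro F hF
  obtain ⟨k, hk⟩ := exists_notMem hF
  have hsub : ∀ B ∈ (D.rg A).subs, ∀ F : Set ℕ, F.Finite →
      ∃ s, D.Partial (some B) ∅ s ∧ Disjoint s.nodes F := fun B hB =>
    ih B (TransGen.single ⟨hA, hB⟩) (D.subs_mem A hA B hB)
  have h₁ := Partial.single hA k
  have h₂ := childList_single k (some A) none
  have h₃ := disjoint_single hk (some A) none
  have main : ∀ Bs : List Label, (∀ B ∈ Bs, B ∈ (D.rg A).subs) →
      Bs.map some ∈ (D.rg A).language → ∃ s, D.Partial (some A) ∅ s ∧ Disjoint s.nodes F := by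
    intro Bs hBs hlang
    obtain ⟨t', ht', -, hA', hl', hd'⟩ := h₁.attach_all hF rfl rfl h₂ h₃ Bs
      fun B hB => hsub B (hBs B hB)
    exact ⟨t', ht'.close hA' hl' (.refl _) hlang fun n hn hne => absurd hn hne, hd'⟩
  cases hrg : D.rg A with
  | text =>
    obtain ⟨m, hm⟩ := exists_notMem (hF.union (Set.finite_singleton k))
    rw [Set.mem_union, not_or] at hm
    have hd : Disjoint (XMLTree.single k (some A) none).nodes
        (XMLTree.single m none (some default)).nodes :=
      Set.disjoint_singleton.2 fun h => hm.2 h.symm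
    have h₄ := h₁.att (Partial.text m default) hd rfl rfl rfl
    have h₅ := h₂.att h₁.isTree (Partial.text (D := D) m default).isTree hd rfl
    refine ⟨_, h₄.close (ls' := [none]) (A := A) ?_ h₅ (.refl _) ?_ ?_, ?_⟩
    · exact XMLTree.att_lab_left hd rfl
    · rw [hrg]; rfl
    · rintro n (hn | hn) hne
      · exact absurd hn hne
      · exact hn
    · rw [XMLTree.att_nodes, Set.disjoint_union_left]
      exact ⟨h₃, disjoint_single hm.1 _ _⟩
  | empty => exact main [] (by simp) (by rw [hrg]; rfl)
  | seq Bs => exact main Bs (fun B hB => by rw [hrg]; exact hB) (by rw [hrg]; rfl)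
  | alt Bs =>
    have hwf := D.rg_wf A hA
    rw [hrg] at hwf
    obtain ⟨B, hB⟩ := List.exists_mem_of_ne_nil Bs hwf.1
    refine main [B] (fun B' hB' => ?_) ?_
    · rw [hrg, List.mem_singleton.1 hB']; exact hB
    · rw [hrg]; exact ⟨B, hB, rfl⟩
  | star B =>
    refine main [] (by simp) ?_
    rw [hrg]
    intro x hx
    cases hx

/-- A type that can occur below `X` does occur, in an instance that lacks only the children of one
node of that type. -/
theorem exists_context {X A : Label} (hX : X ∈ D.ele) (h : D.Reach X A) : ∀ F : Set ℕ, F.Finite →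
    ∃ t c, D.Partial (some X) {c} t ∧ c ∈ t.nodes ∧ t.lab c = some A ∧ t.ChildList c [] ∧
      Disjoint t.nodes F := by
  induction h with
  | refl =>
    intro F hF
    obtain ⟨k, hk⟩ := exists_notMem hF
    exact ⟨_, k, Partial.single hX k, rfl, rfl, childList_single _ _ _, disjoint_single hk _ _⟩
  | @tail A B _ hE ih =>
    intro F hF
    obtain ⟨t, c, ht, hc, hA, hl, hd⟩ := ih F hF
    have hB : B ∈ D.ele := D.subs_mem A hE.1 B hE.2
    have main : ∀ Bs : List Label, (∀ B' ∈ Bs, B' ∈ (D.rg A).subs) →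
        (∃ ls ∈ (D.rg A).language, (some B :: Bs.map some).Perm ls) →
        ∃ t c, D.Partial (some X) {c} t ∧ c ∈ t.nodes ∧ t.lab c = some B ∧ t.ChildList c [] ∧
          Disjoint t.nodes F := by
      rintro Bs hBs ⟨ls, hls, hperm⟩
      obtain ⟨t', ht', hc', hA', hl', hd'⟩ := ht.attach_all hF hc hA hl hd Bs
        fun B' hB' => exists_instance (D.subs_mem A hE.1 B' (hBs B' hB'))
      obtain ⟨k, hk⟩ := exists_notMem (hF.union ht'.isTree.finite)
      rw [Set.mem_union, not_or] at hk
      have hdk := (disjoint_single hk.2 (some B) none).symm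
      have hs := Partial.single hB k
      have h₁ := ht'.att hs hdk hc' rfl hA'
      have h₂ := hl'.att ht'.isTree hs.isTree hdk hc'
      refine ⟨_, k, h₁.close (c := c) (A := A) ?_ h₂ hperm hls ?_, Or.inr rfl, ?_, ?_, ?_⟩
      · rw [XMLTree.att_lab_left hdk hc', hA']
      · rintro n (hn | hn) hne
        · exact absurd hn hne
        · exact hn
      · exact XMLTree.att_lab_right rfl
      · exact (childList_single _ _ _).att_right ht'.isTree hs.isTree hdk hc' rfl
      · rw [XMLTree.att_nodes, Set.disjoint_union_left]
        exact ⟨hd', disjoint_single hk.1 _ _⟩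
    have hmem := hE.2
    cases hrg : D.rg A with
    | text => rw [hrg] at hmem; cases hmem
    | empty => rw [hrg] at hmem; cases hmem
    | seq Bs =>
      rw [hrg] at hmem
      refine main (Bs.erase B) (fun B' hB' => by rw [hrg]; exact List.mem_of_mem_erase hB')
        ⟨Bs.map some, by rw [hrg]; rfl, ?_⟩
      exact ((List.perm_cons_erase hmem).map some).symm
    | alt Bs =>
      rw [hrg] at hmem
      exact main [] (by simp) ⟨[some B], by rw [hrg]; exact ⟨B, hmem, rfl⟩, .refl _⟩
    | star B' =>
      rw [hrg] at hmem
      obtain rfl : B = B' := by simpa [Content.subs] using hmem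
      refine main [] (by simp) ⟨[some B], ?_, .refl _⟩
      rw [hrg]
      intro x hx
      simpa using hx

end DTD

end XMLPolicy

namespace XMLPolicy

open Relation

/-! ### Policies with a bypass are inconsistent -/

namespace XMLTree

/-- Equality of trees up to the meaningless labels and values outside the nodes. -/
structure Agree (t t' : XMLTree) : Prop where
  nodes : t.nodes = t'.nodes
  edges : t.edges = t'.edges
  root : t.root = t'.root
  lab : ∀ m ∈ t.nodes, t.lab m = t'.lab m
  val : ∀ m ∈ t.nodes, t.val m = t'.val m

theorem Agree.rfl {t : XMLTree} : t.Agree t :=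
  ⟨.refl _, .refl _, .refl _, fun _ _ => .refl _, fun _ _ => .refl _⟩

theorem Agree.symm {t t' : XMLTree} (h : t.Agree t') : t'.Agree t :=
  ⟨h.nodes.symm, h.edges.symm, h.root.symm, fun m hm => (h.lab m (h.nodes ▸ hm)).symm,
    fun m hm => (h.val m (h.nodes ▸ hm)).symm⟩

theorem Agree.trans {t t' t'' : XMLTree} (h : t.Agree t') (h' : t'.Agree t'') : t.Agree t'' :=
  ⟨h.nodes.trans h'.nodes, h.edges.trans h'.edges, h.root.trans h'.root,
    fun m hm => (h.lab m hm).trans (h'.lab m (h.nodes ▸ hm)),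
    fun m hm => (h.val m hm).trans (h'.val m (h.nodes ▸ hm))⟩

theorem Agree.iso {t t' : XMLTree} (h : t.Agree t') : t.Iso t' :=
  ⟨id, h.nodes ▸ Set.bijOn_id _, h.root, fun x _ y _ => by rw [h.edges]; exact Iff.rfl,
    fun x hx => h.lab x hx, fun x hx _ => h.val x hx⟩

variable {t t' v s : XMLTree} {c : ℕ}

theorem Agree.att (h : t.Agree t') (c : ℕ) (s : XMLTree) : (t.att c s).Agree (t'.att c s) where
  nodes := by rw [att_nodes, att_nodes, h.nodes]
  edges := by simp only [XMLTree.att, Update.apply, h.edges]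
  root := h.root
  lab m hm := by
    by_cases hs : m ∈ s.nodes
    · rw [att_lab_right hs, att_lab_right hs]
    · have hm : m ∈ t.nodes := hm.resolve_right hs
      simp only [XMLTree.att, Update.apply, hs, if_false]
      exact h.lab m hm
  val m hm := by
    by_cases hs : m ∈ s.nodes
    · rw [att_val_right hs, att_val_right hs]
    · have hm : m ∈ t.nodes := hm.resolve_right hs
      simp only [XMLTree.att, Update.apply, hs, if_false]
      exact h.val m hm

/-- Deleting an attached tree gives back the original tree. -/
theorem Agree.delete_att (h : t'.Agree (t.att c v)) (ht : t.IsTree) (hv : v.IsTree)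
    (hd : Disjoint t.nodes v.nodes) (hc : c ∈ t.nodes) :
    ((Update.delete v.root).apply t').Agree t := by
  have hdesc : t'.desc v.root = v.nodes := by
    ext m
    simp only [XMLTree.desc, h.edges, Set.mem_ofPred_eq]
    constructor
    · intro hm
      induction hm with
      | refl => exact hv.root_mem
      | tail _ he ih => exact (hv.edges_mem _ _ ((mem_att_edges_right ht hd hc ih).1 he)).2
    · exact fun hm => (hv.reachable m hm).lift id fun x y h => mem_att_edges.2 (Or.inl (Or.inr h))
  have hnodes : ((Update.delete v.root).apply t').nodes = t.nodes := by
    simp only [Update.apply, hdesc, h.nodes, att_nodes, Set.union_sdiff_right]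
    exact hd.sdiff_eq_left
  have hmem : ∀ m ∈ t.nodes, m ∈ t'.nodes := fun m hm => h.nodes ▸ Or.inl hm
  refine ⟨hnodes, ?_, h.root, fun m hm => ?_, fun m hm => ?_⟩
  · ext ⟨x, y⟩
    simp only [Update.apply, hdesc, h.edges, Set.mem_ofPred_eq, mem_att_edges]
    constructor
    · rintro ⟨(h | h) | ⟨rfl, rfl⟩, h₁, h₂⟩
      · exact h
      · exact absurd (hv.edges_mem x y h).1 h₁
      · exact absurd hv.root_mem h₂
    · intro h
      obtain ⟨hx, hy⟩ := ht.edges_mem x y h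
      exact ⟨Or.inl (Or.inl h), Set.disjoint_left.1 hd hx, Set.disjoint_left.1 hd hy⟩
  · rw [hnodes] at hm
    exact (h.lab m (hmem m hm)).trans (att_lab_left hd hm)
  · rw [hnodes] at hm
    exact (h.val m (hmem m hm)).trans (att_val_left hd hm)

theorem replace_apply {p n : ℕ} (hp : ∀ x, (x, n) ∈ t.edges ↔ x = p) (u : XMLTree) :
    (Update.replace n u).apply t = ((Update.delete n).apply t).att p u := by
  have : {e : ℕ × ℕ | (e.1, n) ∈ t.edges ∧ e.2 = u.root} = {(p, u.root)} := by
    ext ⟨x, y⟩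
    simp [hp]
  simp only [XMLTree.att, Update.apply, this]

theorem parent_att (ht : t.IsTree) (hv : v.IsTree) (hd : Disjoint t.nodes v.nodes) (x : ℕ) :
    (x, v.root) ∈ (t.att c v).edges ↔ x = c := by
  rw [mem_att_edges]
  have h₁ : (x, v.root) ∉ t.edges := fun h =>
    Set.disjoint_right.1 hd hv.root_mem (ht.edges_mem _ _ h).2
  have h₂ := hv.root_no_parent x
  tauto

/-- Replacing an attached tree amounts to attaching another tree in its place. -/
theorem Agree.replace_att (h : t'.Agree (t.att c v)) (ht : t.IsTree) (hv : v.IsTree)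
    (hd : Disjoint t.nodes v.nodes) (hc : c ∈ t.nodes) (s : XMLTree) :
    ((Update.replace v.root s).apply t').Agree (t.att c s) := by
  rw [replace_apply (p := c) fun x => by rw [h.edges]; exact parent_att ht hv hd x]
  exact (h.delete_att ht hv hd hc).att c s

end XMLTree

namespace Policy

variable {D : DTD} {P : Policy D}

theorem Replaces.ne {A B B' : Label} (h : P.Replaces A B B') : B ≠ B' := by
  obtain ⟨-, Bs, -, -, -, hne⟩ := P.allowed_valid h
  exact hne

theorem Replaces.mem_ele {A B B' : Label} (h : P.Replaces A B B') : B' ∈ D.ele := by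
  obtain ⟨hA, Bs, hrg, -, hB', -⟩ := P.allowed_valid h
  exact D.subs_mem A hA B' (by rw [hrg]; exact hB')

theorem replace_matches {t T v s : XMLTree} {c : ℕ} {C E E' : Label} (h : t.Agree (T.att c v))
    (hc : c ∈ T.nodes) (hC : T.lab c = some C) (hd : Disjoint T.nodes v.nodes)
    (hv : D.ConformsAt E v) (hs : D.ConformsAt E' s) (hne : E ≠ E')
    (hTs : Disjoint T.nodes s.nodes) (hvs : Disjoint v.nodes s.nodes) :
    (Update.replace v.root s).ValidOn t ∧
      D.Matches t (.replace v.root s) (.replace C E E') := by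
  have hr : v.root ∈ t.nodes := by rw [h.nodes]; exact Or.inr hv.isTree.root_mem
  refine ⟨⟨hr, ?_⟩, ?_, hs, hne, c, ?_, ?_⟩
  · rw [h.nodes, XMLTree.att_nodes, Set.disjoint_union_left]
    exact ⟨hTs, hvs⟩
  · rw [h.lab _ hr, XMLTree.att_lab_right hv.isTree.root_mem, hv.root_lab]
  · rw [h.edges]
    exact XMLTree.mem_att_edges.2 (Or.inr ⟨rfl, rfl⟩)
  · rw [h.lab _ (by rw [h.nodes]; exact Or.inl hc), XMLTree.att_lab_left hd hc, hC]

/-- A path of allowed replacements turns an attached tree into any other of the target type. -/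
theorem exists_ops_of_replaces {T : XMLTree} {c : ℕ} {C : Label} (hT : T.IsTree)
    (hc : c ∈ T.nodes) (hC : T.lab c = some C) {E E' : Label} (h : TransGen (P.Replaces C) E E')
    {s : XMLTree} (hs : D.ConformsAt E' s) (hTs : Disjoint T.nodes s.nodes) :
    ∀ {t v : XMLTree}, t.Agree (T.att c v) → D.ConformsAt E v → Disjoint T.nodes v.nodes →
      Disjoint v.nodes s.nodes →
      ∃ ops, P.AllowedSeq t ops ∧ (Update.applySeq t ops).Agree (T.att c s) := by
  induction h using TransGen.head_induction_on with
  | single h =>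
    intro t v ht hv hTv hvs
    obtain ⟨h₁, h₂⟩ := replace_matches ht hc hC hTv hv hs h.ne hTs hvs
    exact ⟨[.replace v.root s], ⟨h₁, ⟨_, h, h₂⟩, trivial⟩,
      ht.replace_att hT hv.isTree hTv hc s⟩
  | head h _ ih =>
    intro t v ht hv hTv hvs
    obtain ⟨w, hw, hdw⟩ := DTD.exists_instance h.mem_ele (T.nodes ∪ v.nodes ∪ s.nodes)
      ((hT.finite.union hv.isTree.finite).union hs.isTree.finite)
    rw [Set.disjoint_union_right, Set.disjoint_union_right] at hdw
    have hw := DTD.conformsAt_iff.2 hw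
    obtain ⟨h₁, h₂⟩ := replace_matches ht hc hC hTv hv hw h.ne hdw.1.1.symm hdw.1.2.symm
    obtain ⟨ops, h₃, h₄⟩ := ih (ht.replace_att hT hv.isTree hTv hc w) hw hdw.1.1.symm hdw.2
    exact ⟨.replace v.root w :: ops, ⟨h₁, ⟨_, h, h₂⟩, h₃⟩, h₄⟩

/-- If `E`-children of `C`-nodes can be reset, then an `E`-tree attached to a `C`-node can be turned
into any other. -/
theorem exists_ops_of_resets {T : XMLTree} {c : ℕ} {C : Label} (hT : T.IsTree)
    (hc : c ∈ T.nodes) (hC : T.lab c = some C) {E : Label} (h : P.Resets C E)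
    {v s : XMLTree} (hv : D.ConformsAt E v) (hs : D.ConformsAt E s)
    (hTv : Disjoint T.nodes v.nodes) (hTs : Disjoint T.nodes s.nodes) :
    ∃ ops, P.AllowedSeq (T.att c v) ops ∧
      (Update.applySeq (T.att c v) ops).Agree (T.att c s) := by
  have hr : v.root ∈ (T.att c v).nodes := Or.inr hv.isTree.root_mem
  have hrl : (T.att c v).lab v.root = some E := by
    rw [XMLTree.att_lab_right hv.isTree.root_mem, hv.root_lab]
  have hcl : (T.att c v).lab c = some C := by rw [XMLTree.att_lab_left hTv hc, hC]
  have hre : (c, v.root) ∈ (T.att c v).edges := XMLTree.mem_att_edges.2 (Or.inr ⟨rfl, rfl⟩)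
  rcases h with ⟨hi, hd⟩ | h
  · have hdel := XMLTree.Agree.rfl.delete_att hT hv.isTree hTv hc
    have hc' : c ∈ ((Update.delete v.root).apply (T.att c v)).nodes := by rwa [hdel.nodes]
    refine ⟨[.delete v.root, .insert c s], ⟨hr, ⟨_, hd, hrl, c, hre, hcl⟩, ⟨hc', ?_⟩,
      ⟨_, hi, ?_, hs⟩, trivial⟩, hdel.att c s⟩
    · rwa [hdel.nodes]
    · rw [hdel.lab c hc', hC]
  · -- The first step of the cycle leads to a tree that is disjoint from `s`.
    obtain ⟨E₁, h₁, h₂⟩ := TransGen.head'_iff.1 h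
    have h₂ : TransGen (P.Replaces C) E₁ E :=
      (reflTransGen_iff_eq_or_transGen.1 h₂).resolve_left h₁.ne
    obtain ⟨w, hw, hdw⟩ := DTD.exists_instance h₁.mem_ele (T.nodes ∪ v.nodes ∪ s.nodes)
      ((hT.finite.union hv.isTree.finite).union hs.isTree.finite)
    rw [Set.disjoint_union_right, Set.disjoint_union_right] at hdw
    have hw := DTD.conformsAt_iff.2 hw
    obtain ⟨h₃, h₄⟩ := replace_matches .rfl hc hC hTv hv hw h₁.ne hdw.1.1.symm hdw.1.2.symm
    obtain ⟨ops, h₅, h₆⟩ := exists_ops_of_replaces hT hc hC h₂ hs hTs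
      (XMLTree.Agree.rfl.replace_att hT hv.isTree hTv hc w) hw hdw.1.1.symm hdw.2
    exact ⟨.replace v.root w :: ops, ⟨h₃, ⟨_, h₁, h₄⟩, h₅⟩, h₆⟩

/-- Every valid update type at a type `A` that can occur below `E` has a proper application inside
an `E`-tree, whatever the context of this tree is. -/
theorem exists_update {E : Label} (hE : E ∈ D.ele) {u : UAT} (hu : u ∈ D.validUATs)
    (hr : D.Reach E u.src) {F : Set ℕ} (hF : F.Finite) :
    ∃ (s s' : XMLTree) (op : Update), D.ConformsAt E s ∧ D.ConformsAt E s' ∧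
      Disjoint s.nodes F ∧ Disjoint s'.nodes F ∧
      ∀ (T : XMLTree) (c : ℕ), T.IsTree → c ∈ T.nodes → T.nodes ⊆ F →
        op.ValidOn (T.att c s) ∧ D.Matches (T.att c s) op u ∧ op.apply (T.att c s) ≠ T.att c s ∧
          (op.apply (T.att c s)).Agree (T.att c s') := by
  obtain ⟨r, a, hp, ha, hA, hl, hd⟩ := DTD.exists_context hE hr F hF
  have hpr := hp.isTree
  -- Completing the tree `r` by a single child of `a`.
  have hatt : ∀ (x : Option Label) (w : XMLTree), D.Partial x ∅ w → Disjoint w.nodes F →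
      Disjoint r.nodes w.nodes → [x] ∈ (D.rg u.src).language →
      D.ConformsAt E (r.att a w) ∧ Disjoint (r.att a w).nodes F := by
    intro x w hw hwF hrw hx
    have h₁ := hp.att hw hrw ha rfl hA
    have h₂ := hl.att hpr hw.isTree hrw ha
    rw [hw.root_lab] at h₂
    refine ⟨DTD.conformsAt_iff.2 (h₁.close ?_ h₂ (.refl _) hx ?_), ?_⟩
    · rw [XMLTree.att_lab_left hrw ha, hA]
    · rintro n (hn | hn) hne
      · exact absurd hn hne
      · exact hn
    · rw [XMLTree.att_nodes, Set.disjoint_union_left]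
      exact ⟨hd, hwF⟩
  have hempty : [] ∈ (D.rg u.src).language → D.ConformsAt E r := fun h =>
    DTD.conformsAt_iff.2 (hp.close hA hl (.refl _) h fun n hn hne => absurd hn hne)
  have hFr : (F ∪ r.nodes).Finite := hF.union hpr.finite
  -- Facts about the tree `r` within a context `T`.
  have hctx : ∀ (T : XMLTree) (c : ℕ), T.IsTree → c ∈ T.nodes → T.nodes ⊆ F →
      (T.att c r).IsTree ∧ a ∈ (T.att c r).nodes ∧ (T.att c r).lab a = some u.src ∧
      ∀ w : XMLTree, Disjoint w.nodes F → Disjoint r.nodes w.nodes →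
        Disjoint (T.att c r).nodes w.nodes := by
    intro T c hT hc hTF
    have hTr : Disjoint T.nodes r.nodes := (hd.mono_right hTF).symm
    refine ⟨hT.att hpr hTr hc, Or.inr ha, by rw [XMLTree.att_lab_right ha, hA], fun w hw hrw => ?_⟩
    rw [XMLTree.att_nodes, Set.disjoint_union_left]
    exact ⟨(hw.mono_right hTF).symm, hrw⟩
  cases u with
  | insert A B =>
    obtain ⟨hAe, hrg⟩ := hu
    have hB : B ∈ D.ele := D.subs_mem A hAe B (by simp [hrg, Content.subs])
    obtain ⟨w, hw, hdw⟩ := DTD.exists_instance hB _ hFr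
    rw [Set.disjoint_union_right] at hdw
    obtain ⟨h₁, h₂⟩ := hatt _ w hw hdw.1 hdw.2.symm (by
      simp only [UAT.src, hrg]; intro x hx; simpa using hx)
    refine ⟨r, r.att a w, .insert a w, hempty (by
      simp only [UAT.src, hrg]; intro x hx; cases hx), h₁, hd, h₂, fun T c hT hc hTF => ?_⟩
    obtain ⟨h₃, h₄, h₅, h₆⟩ := hctx T c hT hc hTF
    refine ⟨⟨h₄, h₆ w hdw.1 hdw.2.symm⟩, ⟨h₅, DTD.conformsAt_iff.2 hw⟩, fun h => ?_, ?_⟩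
    · have : w.root ∈ ((Update.insert a w).apply (T.att c r)).nodes := Or.inr hw.isTree.root_mem
      rw [h] at this
      exact Set.disjoint_left.1 (h₆ w hdw.1 hdw.2.symm) this hw.isTree.root_mem
    · rw [XMLTree.att_assoc]
      exact .rfl
  | delete A B =>
    obtain ⟨hAe, hrg⟩ := hu
    have hB : B ∈ D.ele := D.subs_mem A hAe B (by simp [hrg, Content.subs])
    obtain ⟨w, hw, hdw⟩ := DTD.exists_instance hB _ hFr
    rw [Set.disjoint_union_right] at hdw
    obtain ⟨h₁, h₂⟩ := hatt _ w hw hdw.1 hdw.2.symm (by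
      simp only [UAT.src, hrg]; intro x hx; simpa using hx)
    refine ⟨r.att a w, r, .delete w.root, h₁, hempty (by
      simp only [UAT.src, hrg]; intro x hx; cases hx), h₂, hd, fun T c hT hc hTF => ?_⟩
    obtain ⟨h₃, h₄, h₅, h₆⟩ := hctx T c hT hc hTF
    have h₆ := h₆ w hdw.1 hdw.2.symm
    have hag := XMLTree.Agree.rfl.delete_att h₃ hw.isTree h₆ h₄
    rw [XMLTree.att_assoc]
    have hrw : w.root ∈ ((T.att c r).att a w).nodes := Or.inr hw.isTree.root_mem
    refine ⟨hrw, ⟨?_, a, XMLTree.mem_att_edges.2 (Or.inr ⟨rfl, rfl⟩), ?_⟩, fun h => ?_, hag⟩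
    · rw [XMLTree.att_lab_right hw.isTree.root_mem, hw.root_lab]
    · rw [XMLTree.att_lab_left h₆ h₄, h₅]; rfl
    · rw [← h, hag.nodes] at hrw
      exact Set.disjoint_left.1 h₆ hrw hw.isTree.root_mem
  | replace A B B' =>
    obtain ⟨hAe, Bs, hrg, hBs, hBs', hne⟩ := hu
    have hB : B ∈ D.ele := D.subs_mem A hAe B (by simpa [hrg, Content.subs] using hBs)
    have hB' : B' ∈ D.ele := D.subs_mem A hAe B' (by simpa [hrg, Content.subs] using hBs')
    obtain ⟨w, hw, hdw⟩ := DTD.exists_instance hB _ hFr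
    obtain ⟨w', hw', hdw'⟩ := DTD.exists_instance hB' _ (hFr.union hw.isTree.finite)
    rw [Set.disjoint_union_right] at hdw
    rw [Set.disjoint_union_right, Set.disjoint_union_right] at hdw'
    obtain ⟨h₁, h₂⟩ := hatt _ w hw hdw.1 hdw.2.symm (by
      simp only [UAT.src, hrg]; exact ⟨B, hBs, rfl⟩)
    obtain ⟨h₁', h₂'⟩ := hatt _ w' hw' hdw'.1.1 hdw'.1.2.symm (by
      simp only [UAT.src, hrg]; exact ⟨B', hBs', rfl⟩)
    refine ⟨r.att a w, r.att a w', .replace w.root w', h₁, h₁', h₂, h₂', fun T c hT hc hTF => ?_⟩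
    obtain ⟨h₃, h₄, h₅, h₆⟩ := hctx T c hT hc hTF
    have hTw := h₆ w hdw.1 hdw.2.symm
    have hTw' := h₆ w' hdw'.1.1 hdw'.1.2.symm
    have hag := XMLTree.Agree.rfl.replace_att h₃ hw.isTree hTw h₄ w'
    rw [XMLTree.att_assoc, XMLTree.att_assoc]
    obtain ⟨h₇, h₈⟩ := replace_matches .rfl h₄ h₅ hTw (DTD.conformsAt_iff.2 hw)
      (DTD.conformsAt_iff.2 hw') hne hTw' hdw'.2.symm
    refine ⟨h₇, h₈, fun h => ?_, hag⟩
    have hrw : w.root ∈ ((T.att c r).att a w).nodes := Or.inr hw.isTree.root_mem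
    rw [← h, hag.nodes] at hrw
    rcases hrw with hrw | hrw
    · exact Set.disjoint_left.1 hTw hrw hw.isTree.root_mem
    · exact Set.disjoint_right.1 hdw'.2 hw.isTree.root_mem hrw
  | replaceText A =>
    obtain ⟨hAe, hrg⟩ := hu
    obtain ⟨k, hk⟩ := hFr.exists_notMem
    rw [Set.mem_union, not_or] at hk
    obtain ⟨v, v', hv⟩ : ∃ v v' : String, v ≠ v' := exists_pair_ne String
    have hrk : ∀ v, Disjoint r.nodes (XMLTree.single k none (some v)).nodes := fun v =>
      (DTD.disjoint_single hk.2 _ _).symm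
    have hlang : [none] ∈ (D.rg A).language := by rw [hrg]; rfl
    obtain ⟨h₁, h₂⟩ := hatt _ _ (.text k v) (DTD.disjoint_single hk.1 _ _) (hrk v) hlang
    obtain ⟨h₁', h₂'⟩ := hatt _ _ (.text k v') (DTD.disjoint_single hk.1 _ _) (hrk v') hlang
    refine ⟨_, _, .replaceText k v', h₁, h₁', h₂, h₂', fun T c hT hc hTF => ?_⟩
    obtain ⟨h₃, h₄, h₅, h₆⟩ := hctx T c hT hc hTF
    rw [XMLTree.att_assoc, XMLTree.att_assoc]
    have hkT : k ∈ ((T.att c r).att a (XMLTree.single k none (some v))).nodes := Or.inr rfl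
    have hTk := h₆ (XMLTree.single k none (some v)) (DTD.disjoint_single hk.1 _ _) (hrk v)
    refine ⟨hkT, ⟨XMLTree.att_lab_right rfl, a, XMLTree.mem_att_edges.2 (Or.inr ⟨rfl, rfl⟩), ?_⟩,
      fun h => ?_, ⟨rfl, rfl, rfl, fun m hm => rfl, fun m hm => ?_⟩⟩
    · rw [XMLTree.att_lab_left hTk h₄, h₅]; rfl
    · have := congrFun (congrArg XMLTree.val h) k
      rw [XMLTree.att_val_right (t := T.att c r) (c := a)
        (s := XMLTree.single k none (some v)) rfl] at this
      simp [Update.apply, XMLTree.single] at this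
      exact hv this.symm
    · by_cases hmk : m = k
      · subst hmk
        rw [XMLTree.att_val_right (s := XMLTree.single m none (some v')) rfl]
        simp [Update.apply, XMLTree.single]
      · simp [Update.apply, hmk, XMLTree.att, XMLTree.single]

/-- Contexts for the children of a resettable type. -/
theorem Resets.language {C E : Label} (h : P.Resets C E) :
    C ∈ D.ele ∧ E ∈ D.ele ∧ [some E] ∈ (D.rg C).language := by
  rcases h with ⟨hi, -⟩ | h
  · obtain ⟨hC, hrg⟩ := P.allowed_valid hi
    refine ⟨hC, D.subs_mem C hC E (by simp [hrg, Content.subs]), ?_⟩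
    rw [hrg]
    intro x hx
    simpa using hx
  · obtain ⟨E', h, -⟩ := TransGen.head'_iff.1 h
    obtain ⟨hC, Bs, hrg, hE, -⟩ := P.allowed_valid h
    refine ⟨hC, D.subs_mem C hC E (by simpa [hrg, Content.subs] using hE), ?_⟩
    rw [hrg]
    exact ⟨E, hE, rfl⟩

theorem not_consistent_of_bypass (h : P.Bypass) : ¬ P.Consistent := by
  intro hcons
  obtain ⟨u, hu, hr, h⟩ := h
  have hval := P.forbidden_valid hu
  -- A tree `s` attached to a context `T` gives an instance.
  have hatt : ∀ {C E : Label} {T s : XMLTree} {c : ℕ}, D.Partial (some D.rt) {c} T → c ∈ T.nodes →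
      T.lab c = some C → T.ChildList c [] → [some E] ∈ (D.rg C).language → D.ConformsAt E s →
      Disjoint T.nodes s.nodes → D.Conforms (T.att c s) := by
    intro C E T s c hT hc hC hl hlang hs hd
    have h₁ := hT.att (DTD.conformsAt_iff.1 hs) hd hc rfl hC
    have h₂ := hl.att hT.isTree hs.isTree hd hc
    rw [hs.root_lab] at h₂
    refine DTD.conformsAt_iff.2 (h₁.close (A := C) ?_ h₂ (.refl _) hlang ?_)
    · rw [XMLTree.att_lab_left hd hc, hC]
    · rintro n (hn | hn) hne
      · exact absurd hn hne
      · exact hn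
  rcases h with ⟨A, B, B', rfl, hB⟩ | ⟨C, E, hrC, hreset, hrE⟩
  · obtain ⟨T, c, hT, hc, hA, hl, -⟩ := DTD.exists_context D.rt_mem hr ∅ Set.finite_empty
    obtain ⟨hAe, Bs, hrg, hBs, hBs', hne⟩ := hval
    obtain ⟨v, hv, hdv⟩ := DTD.exists_instance
      (D.subs_mem A hAe B (by simpa [hrg, Content.subs] using hBs)) T.nodes hT.isTree.finite
    obtain ⟨s, hs, hds⟩ := DTD.exists_instance
      (D.subs_mem A hAe B' (by simpa [hrg, Content.subs] using hBs')) (T.nodes ∪ v.nodes)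
      (hT.isTree.finite.union hv.isTree.finite)
    rw [Set.disjoint_union_right] at hds
    have hv := DTD.conformsAt_iff.2 hv
    have hs := DTD.conformsAt_iff.2 hs
    have hconf : D.Conforms (T.att c v) := hatt hT hc hA hl
      (by simp only [UAT.src, hrg]; exact ⟨B, hBs, rfl⟩) hv hdv.symm
    obtain ⟨h₁, h₂⟩ := replace_matches .rfl hc hA hdv.symm hv hs hne hds.1.symm hds.2.symm
    obtain ⟨ops, h₃, h₄⟩ := exists_ops_of_replaces hT.isTree hc hA hB hs hds.1.symm .rfl hv
      hdv.symm hds.2.symm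
    have hag := XMLTree.Agree.rfl.replace_att hT.isTree hv.isTree hdv.symm hc s
    refine hcons _ hconf ⟨.replace v.root s, ops, h₁, ⟨_, hu, h₂⟩, ?_, h₃,
      (h₄.trans hag.symm).iso⟩
    refine (DTD.ConformsAt.sound hconf).not_iso (P.forbidden_valid hu) h₁ h₂ fun h => ?_
    have hrv : v.root ∈ (T.att c v).nodes := Or.inr hv.isTree.root_mem
    rw [← h, hag.nodes] at hrv
    rcases hrv with hrv | hrv
    · exact Set.disjoint_right.1 hdv.symm hv.isTree.root_mem hrv
    · exact Set.disjoint_right.1 hds.2 hv.isTree.root_mem hrv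
  · obtain ⟨hC, hE, hlang⟩ := hreset.language
    obtain ⟨T, c, hT, hc, hlab, hl, -⟩ := DTD.exists_context D.rt_mem hrC ∅ Set.finite_empty
    obtain ⟨s, s', op, hs, hs', hd, hd', hop⟩ := exists_update hE hval hrE hT.isTree.finite
    obtain ⟨h₁, h₂, h₃, hag⟩ := hop T c hT.isTree hc subset_rfl
    have hconf : D.Conforms (T.att c s) := hatt hT hc hlab hl hlang hs hd.symm
    obtain ⟨ops, h₄, h₅⟩ := exists_ops_of_resets hT.isTree hc hlab hreset hs hs' hd.symm hd'.symm
    exact hcons _ hconf ⟨op, ops, h₁, ⟨u, hu, h₂⟩,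
      (DTD.ConformsAt.sound hconf).not_iso hval h₁ h₂ h₃, h₄, (h₅.trans hag.symm).iso⟩

theorem consistent_iff : P.Consistent ↔ ¬ P.Bypass :=
  ⟨fun h hb => not_consistent_of_bypass hb h, consistent_of_not_bypass⟩

end Policy

end XMLPolicy

namespace XMLPolicy

open Enc (enc)

variable {α β γ : Type} [Enc α] [Enc β] [Enc γ]

/-! ### Symbols, right-hand sides and update access types as data -/

instance : PolyEq Unit := ⟨(PolyPred.const True).congr fun _ => by simp⟩

theorem enc_replicate (n : ℕ) : enc (List.replicate n ()) = enc n := by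
  induction n with
  | zero => rfl
  | succ n ih => exact congrArg (Bin.cons .nil) ih

instance : PolyEq ℕ :=
  .of_injective (.of_enc_eq enc_replicate) (List.replicate_left_injective ())

instance : PolyEq Sym :=
  .of_injective (f := Sym.index) (.of_enc_eq fun _ => rfl) fun s t h => by
    rw [← Sym.getD_index s .text, h, Sym.getD_index]

/-- Case distinction on a symbol. -/
theorem Poly.sym_cases {l : γ → Sym} {F : Sym → γ → β} (hl : Poly l) (hF : ∀ s, Poly (F s)) :
    Poly fun x => F (l x) x := by
  have key : ∀ L : List Sym, ∃ G : γ → β, Poly G ∧ ∀ x, l x ∈ L → G x = F (l x) x := by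
    intro L
    induction L with
    | nil => exact ⟨F .text, hF _, by simp⟩
    | cons s L ih =>
      obtain ⟨G, hG, h⟩ := ih
      refine ⟨fun x => if l x = s then F s x else G x,
        .ite (.eq hl (.const s)) (hF s) hG, fun x hx => ?_⟩
      by_cases hs : l x = s
      · simp [hs]
      · simp only [hs, if_false]
        exact h x ((List.mem_cons.1 hx).resolve_left hs)
  obtain ⟨G, hG, h⟩ := key Sym.all
  rwa [← funext fun x => h x (Sym.mem_all _)]

theorem Poly.filter {l : γ → List α} {p : γ → α → Bool} (hl : Poly l)
    (hp : PolyPred fun y : γ × α => p y.1 y.2 = true) : Poly fun x => (l x).filter (p x) := by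
  have h := Poly.flatMap (f := fun x a => if p x a = true then [a] else []) hl
    (.ite hp (.cons .snd (.const [])) (.const []))
  convert h using 2 with x
  induction l x with
  | nil => rfl
  | cons a l ih => rw [List.filter_cons, List.flatMap_cons, ih]; split <;> rfl

theorem PolyPred.nodup [PolyEq α] {l : γ → List α} (hl : Poly l) :
    PolyPred fun x => (l x).Nodup := by
  classical
  refine (PolyPred.ball (P := fun x a => (l x).filter (fun b => decide (b = a)) = [a]) hl
    (.eq (.filter (l := fun y : γ × α => l y.1) (hl.comp .fst) ?_)
      (.cons .snd (.const [])))).congr fun x => ?_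
  · exact (PolyPred.eq (f := fun z : (γ × α) × α => z.2) (g := fun z => z.1.2) (by fun_prop)
      (by fun_prop)).congr fun z => by simp
  · rw [List.nodup_iff_count_eq_one]
    refine forall₂_congr fun a _ => ?_
    rw [List.filter_eq, ← List.replicate_one, List.replicate_left_inj]

/-- A right-hand side as a symbol and a list of labels. -/
def Content.raw : Content → Sym × List Label
  | .text => (.text, [])
  | .empty => (.empty, [])
  | .seq Bs => (.seq, Bs)
  | .alt Bs => (.alt, Bs)
  | .star B => (.star, [B])

instance : Enc Content := ⟨fun c => enc c.raw⟩

theorem Content.poly_raw : Poly Content.raw := .of_enc_eq fun _ => rfl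

theorem Content.raw_injective : Function.Injective Content.raw := by
  intro c d h
  cases c <;> cases d <;> simp_all [Content.raw]

instance : PolyEq Content := .of_injective Content.poly_raw Content.raw_injective

/-- Only the representation of the value matters. -/
theorem Poly.of_enc {f : γ → α} {g : γ → β} (hg : Poly g) (h : ∀ x, enc (f x) = enc (g x)) :
    Poly f := by
  unfold Poly at hg ⊢
  simpa only [sz, h] using hg

theorem Content.poly_seq : Poly Content.seq :=
  .of_enc (g := fun Bs => (Sym.seq, Bs)) (by fun_prop) fun _ => rfl

theorem Content.poly_alt : Poly Content.alt :=
  .of_enc (g := fun Bs => (Sym.alt, Bs)) (by fun_prop) fun _ => rfl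

theorem Content.poly_star : Poly Content.star :=
  .of_enc (g := fun B => (Sym.star, [B])) (.prodMk (.const _) (.cons .id' (.const []))) fun _ => rfl

/-- Case distinction on a right-hand side. -/
theorem Poly.content_cases {l : γ → Content} {F : γ → Content → β} (hl : Poly l)
    (ht : Poly fun x => F x .text) (he : Poly fun x => F x .empty)
    (hs : Poly fun p : γ × List Label => F p.1 (.seq p.2))
    (ha : Poly fun p : γ × List Label => F p.1 (.alt p.2))
    (hst : Poly fun p : γ × Label => F p.1 (.star p.2)) : Poly fun x => F x (l x) := by
  have hr := Content.poly_raw.comp hl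
  have h₂ : Poly fun x => (x, (l x).raw.2) := .prodMk .id' (Poly.snd.comp hr)
  have h₃ : Poly fun x => (x, (l x).raw.2.headD []) := .prodMk .id' (.headD (Poly.snd.comp hr) [])
  have h := Poly.sym_cases (F := fun s x => match s with
    | .text => F x .text
    | .seq => F x (.seq (l x).raw.2)
    | .alt => F x (.alt (l x).raw.2)
    | .star => F x (.star ((l x).raw.2.headD []))
    | _ => F x .empty) (Poly.fst.comp hr) (by
      rintro ⟨⟩
      case text => exact ht
      case seq => exact hs.comp h₂
      case alt => exact ha.comp h₂
      case star => exact hst.comp h₃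
      all_goals exact he)
  convert h using 2 with x
  cases l x <;> rfl

@[fun_prop]
theorem Content.poly_subs : Poly Content.subs :=
  .of_enc (g := fun c : Content => c.raw.2) (Poly.snd.comp Content.poly_raw) fun c => by
    cases c <;> rfl

theorem Content.polyPred_wellFormed : PolyPred Content.WellFormed := by
  classical
  have h : PolyPred fun p : Content × List Label => p.2 ≠ [] ∧ p.2.Nodup :=
    (PolyPred.eq .snd (.const [])).not.and (.nodup .snd)
  exact .content_cases (F := fun (_ : Content) c => decide c.WellFormed) .id' (.const _) (.const _)
    h h (PolyPred.const True)

/-- An update access type as a symbol and a list of labels. -/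
def UAT.raw : UAT → Sym × List Label
  | .insert A B => (.insert, [A, B])
  | .delete A B => (.delete, [A, B])
  | .replace A B B' => (.replace, [A, B, B'])
  | .replaceText A => (.replaceText, [A])

instance : Enc UAT := ⟨fun u => enc u.raw⟩

theorem UAT.poly_raw : Poly UAT.raw := .of_enc_eq fun _ => rfl

theorem UAT.raw_injective : Function.Injective UAT.raw := by
  intro u v h
  cases u <;> cases v <;> simp_all [UAT.raw]

instance : PolyEq UAT := .of_injective UAT.poly_raw UAT.raw_injective

theorem UAT.poly_insert : Poly fun p : Label × Label => UAT.insert p.1 p.2 :=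
  .of_enc (g := fun p => (Sym.insert, [p.1, p.2]))
    (.prodMk (.const _) (.cons .fst (.cons .snd (.const [])))) fun _ => rfl

theorem UAT.poly_delete : Poly fun p : Label × Label => UAT.delete p.1 p.2 :=
  .of_enc (g := fun p => (Sym.delete, [p.1, p.2]))
    (.prodMk (.const _) (.cons .fst (.cons .snd (.const [])))) fun _ => rfl

theorem UAT.poly_replace : Poly fun p : Label × Label × Label => UAT.replace p.1 p.2.1 p.2.2 :=
  .of_enc (g := fun p => (Sym.replace, [p.1, p.2.1, p.2.2]))
    (.prodMk (.const _) (.cons .fst (.cons (by fun_prop) (.cons (by fun_prop) (.const [])))))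
    fun _ => rfl

theorem UAT.poly_replaceText : Poly UAT.replaceText :=
  .of_enc (g := fun A => (Sym.replaceText, [A])) (.prodMk (.const _) (.cons .id' (.const [])))
    fun _ => rfl

/-- Case distinction on an update access type. -/
theorem Poly.uat_cases {l : γ → UAT} {F : γ → UAT → β} (hl : Poly l)
    (hi : Poly fun p : γ × Label × Label => F p.1 (.insert p.2.1 p.2.2))
    (hd : Poly fun p : γ × Label × Label => F p.1 (.delete p.2.1 p.2.2))
    (hr : Poly fun p : γ × Label × Label × Label => F p.1 (.replace p.2.1 p.2.2.1 p.2.2.2))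
    (ht : Poly fun p : γ × Label => F p.1 (.replaceText p.2)) : Poly fun x => F x (l x) := by
  have h₀ := UAT.poly_raw.comp hl
  have h₁ : Poly fun x => (l x).raw.2.headD [] := .headD (Poly.snd.comp h₀) []
  have h₂ : Poly fun x => (l x).raw.2.tail.headD [] := .headD (.tail (Poly.snd.comp h₀)) []
  have h₃ : Poly fun x => (l x).raw.2.tail.tail.headD [] :=
    .headD (.tail (.tail (Poly.snd.comp h₀))) []
  have h := Poly.sym_cases (F := fun s x => match s with
    | .insert => F x (.insert ((l x).raw.2.headD []) ((l x).raw.2.tail.headD []))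
    | .delete => F x (.delete ((l x).raw.2.headD []) ((l x).raw.2.tail.headD []))
    | .replace => F x (.replace ((l x).raw.2.headD []) ((l x).raw.2.tail.headD [])
        ((l x).raw.2.tail.tail.headD []))
    | _ => F x (.replaceText ((l x).raw.2.headD []))) (Poly.fst.comp h₀) (by
      rintro ⟨⟩
      case insert => exact hi.comp (Poly.prodMk .id' (h₁.prodMk h₂))
      case delete => exact hd.comp (Poly.prodMk .id' (h₁.prodMk h₂))
      case replace => exact hr.comp (Poly.prodMk .id' (h₁.prodMk (h₂.prodMk h₃)))
      all_goals exact ht.comp (Poly.prodMk .id' h₁))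
  convert h using 2 with x
  cases l x <;> rfl

instance : Enc Presentation := ⟨fun I => enc (I.rt, I.rules, I.allowed, I.forbidden)⟩

theorem Presentation.poly_tuple :
    Poly fun I : Presentation => (I.rt, I.rules, I.allowed, I.forbidden) := .of_enc_eq fun _ => rfl

@[fun_prop]
theorem Presentation.poly_rt : Poly Presentation.rt := Poly.fst.comp poly_tuple

@[fun_prop]
theorem Presentation.poly_rules : Poly Presentation.rules :=
  Poly.fst.comp (Poly.snd.comp poly_tuple)

@[fun_prop]
theorem Presentation.poly_allowed : Poly Presentation.allowed :=
  Poly.fst.comp (Poly.snd.comp (Poly.snd.comp poly_tuple))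

@[fun_prop]
theorem Presentation.poly_forbidden : Poly Presentation.forbidden :=
  Poly.snd.comp (Poly.snd.comp (Poly.snd.comp poly_tuple))

end XMLPolicy

namespace XMLPolicy

variable {α β : Type} [Enc α] [Enc β]

/-! ### Reading input words -/

/-- `p` reads an item written by `f` from the front of a word in polynomial time. On words that do
not start with an item it returns an arbitrary item and some rest of the word. -/
structure Parses (f : α → List Sym) (p : List Sym → α × List Sym) : Prop where
  poly : Poly p
  suffix : ∀ w, (p w).2 <:+ w
  decode : ∀ a r, p (f a ++ r) = (a, r)

namespace Parses

theorem pair {f : α → List Sym} {g : β → List Sym} {p : List Sym → α × List Sym}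
    {q : List Sym → β × List Sym} (hp : Parses f p) (hq : Parses g q) :
    Parses (fun x : α × β => f x.1 ++ g x.2)
      (fun w => (((p w).1, (q (p w).2).1), (q (p w).2).2)) where
  poly := by
    have h₁ := Poly.fst.comp hp.poly
    have h₂ := hq.poly.comp (Poly.snd.comp hp.poly)
    exact (h₁.prodMk (Poly.fst.comp h₂)).prodMk (Poly.snd.comp h₂)
  suffix w := (hq.suffix _).trans (hp.suffix w)
  decode x r := by rw [List.append_assoc, hp.decode]; simp [hq.decode]

/-- One round of reading a list: the items read so far, in reverse order, and the rest of the
word. -/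
def manyStep {α : Type} (fin : Sym) (p : List Sym → α × List Sym) (s : List α × List Sym) :
    List α × List Sym :=
  if s.2.headD fin = fin then s else ((p s.2).1 :: s.1, (p s.2).2)

/-- Read items up to the symbol `fin`. There are no more rounds than symbols; rounds after the
end of the list do nothing. -/
def many {α : Type} (fin : Sym) (p : List Sym → α × List Sym) (w : List Sym) :
    List α × List Sym :=
  let s := w.foldl (fun s _ => manyStep fin p s) ([], w)
  (s.1.reverse, s.2.tail)

theorem poly_many (fin : Sym) {p : List Sym → α × List Sym} (hp : Poly p)
    (hs : ∀ w, (p w).2 <:+ w) : Poly (many fin p) := by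
  obtain ⟨P, hP⟩ := hp.2
  have hstep : Poly (manyStep fin p) := by
    have h := hp.comp (f := fun s : List α × List Sym => s.2) .snd
    exact .ite (.eq (.headD .snd fin) (.const _)) .id'
      (.prodMk (.cons (Poly.fst.comp h) .fst) (Poly.snd.comp h))
  have hsz : ∀ {v w : List Sym}, v <:+ w → sz v ≤ sz w := by
    rintro v w ⟨u, rfl⟩
    have := sz_append u v
    have := sz_pos u
    omega
  have hloop : Poly fun w : List Sym =>
      w.foldl (fun s _ => manyStep fin p s) (([] : List α), w) := by
    refine Poly.foldl_of_bounded (s := fun s _ => manyStep fin p s)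
      (B := fun w => 1 + sz w * (P.eval (sz w) + 1) + sz w + 1) .id' (.prodMk (.const _) .id')
      (hstep.comp .snd) ?_ ?_
    · exact (((PB.const 1).add (PB.sz.mul ((PB.eval P PB.sz).add (PB.const 1)))).add PB.sz).add
        (PB.const 1)
    · intro w l₁ l₂ hl
      have key : ∀ (l : List Sym) (s : List α × List Sym), s.2 <:+ w →
          (l.foldl (fun s _ => manyStep fin p s) s).2 <:+ w ∧
          sz (l.foldl (fun s _ => manyStep fin p s) s).1
            ≤ sz s.1 + l.length * (P.eval (sz w) + 1) := by
        intro l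
        induction l with
        | nil => intro s h; exact ⟨h, by simp⟩
        | cons a l ih =>
          intro s h
          have h' : (manyStep fin p s).2 <:+ w ∧
              sz (manyStep fin p s).1 ≤ sz s.1 + (P.eval (sz w) + 1) := by
            unfold manyStep
            split
            · exact ⟨h, by omega⟩
            · refine ⟨(hs _).trans h, ?_⟩
              have h₁ := (hP s.2).trans (eval_le_eval P (hsz h))
              beta_reduce at h₁
              rw [show sz (p s.2) = sz (p s.2).1 + sz (p s.2).2 + 1 from rfl] at h₁
              rw [sz_cons]
              omega
          obtain ⟨h₁, h₂⟩ := ih _ h'.1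
          refine ⟨h₁, h₂.trans ?_⟩
          rw [List.length_cons, Nat.succ_mul]
          omega
      obtain ⟨h₁, h₂⟩ := key l₁ ([], w) List.suffix_rfl
      have h₃ := hsz h₁
      have h₄ : l₁.length ≤ sz w := by
        refine le_trans ?_ (length_lt_sz w).le
        rw [hl]; simp
      have h₅ := Nat.mul_le_mul_right (P.eval (sz w) + 1) h₄
      have h₆ : sz ([] : List α) = 1 := rfl
      simp only [h₆] at h₂
      rw [show ∀ y : List α × List Sym, sz y = sz y.1 + sz y.2 + 1 from fun _ => rfl]
      omega
  exact .prodMk (.reverse (Poly.fst.comp hloop)) (.tail (Poly.snd.comp hloop))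

theorem manyStep_foldl_suffix {α : Type} {fin : Sym} {p : List Sym → α × List Sym}
    (hs : ∀ w, (p w).2 <:+ w) (l : List Sym) (s : List α × List Sym) :
    (l.foldl (fun s _ => manyStep fin p s) s).2 <:+ s.2 := by
  induction l generalizing s with
  | nil => exact List.suffix_rfl
  | cons a l ih =>
    refine (ih (manyStep fin p s)).trans ?_
    unfold manyStep
    split
    · exact List.suffix_rfl
    · exact hs _

/-- Lists whose end is marked by a symbol that does not start an item. -/
theorem list {f : α → List Sym} {p : List Sym → α × List Sym} (hp : Parses f p) (fin : Sym)
    (hf : ∀ a r, (f a ++ r).headD fin ≠ fin) :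
    Parses (fun l : List α => l.flatMap f ++ [fin]) (many fin p) where
  poly := poly_many fin hp.poly hp.suffix
  suffix w := (List.tail_suffix _).trans (manyStep_foldl_suffix hp.suffix w ([], w))
  decode l r := by
    have key : ∀ (l : List α) (acc : List α) (u : List Sym), l.length ≤ u.length →
        u.foldl (fun s _ => manyStep fin p s) (acc, l.flatMap f ++ fin :: r)
          = (l.reverse ++ acc, fin :: r) := by
      intro l acc u
      induction u generalizing l acc with
      | nil =>
        intro h
        obtain rfl := List.length_eq_zero_iff.1 (Nat.le_zero.1 h)
        rfl
      | cons a u ih =>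
        intro h
        cases l with
        | nil =>
          have : manyStep fin p (acc, fin :: r) = (acc, fin :: r) := by simp [manyStep]
          have h := ih [] acc (by simp)
          rw [List.foldl_cons, List.flatMap_nil, List.nil_append, this]
          exact h
        | cons b l =>
          have : manyStep fin p (acc, (b :: l).flatMap f ++ fin :: r)
              = (b :: acc, l.flatMap f ++ fin :: r) := by
            unfold manyStep
            rw [if_neg]
            · simp only [List.flatMap_cons, List.append_assoc]
              rw [hp.decode]
            · simp only [List.flatMap_cons, List.append_assoc]
              exact hf _ _
          rw [List.foldl_cons, this, ih l _ (by simpa using h)]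
          simp
    have hlen : ∀ l : List α, l.length ≤ (l.flatMap f).length := by
      intro l
      induction l with
      | nil => simp
      | cons b l ih =>
        have : f b ≠ [] := fun h => hf b [] (by rw [h]; rfl)
        have := List.length_pos_iff.2 this
        rw [List.flatMap_cons, List.length_append, List.length_cons]
        omega
    have := key l [] (l.flatMap f ++ fin :: r) (by
      have := hlen l
      rw [List.length_append]
      omega)
    simp only [many, List.append_assoc, List.cons_append, List.nil_append, this]
    simp

theorem congr {f g : α → List Sym} {p : List Sym → α × List Sym} (hp : Parses f p)
    (h : ∀ a, g a = f a) : Parses g p := by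
  rwa [show g = f from funext h]

end Parses

/-- The bit written by a symbol. -/
def Sym.toBit : Sym → Bool
  | .bit b => b
  | _ => false

theorem parses_bit : Parses (fun b => [Sym.bit b])
    (fun w => ((w.headD Sym.text).toBit, w.tail)) where
  poly := .prodMk (.sym_cases (F := fun s _ => s.toBit) (.headD .id' Sym.text) fun _ => .const _)
    (.tail .id')
  suffix w := w.tail_suffix
  decode _ _ := rfl

/-- Read a label. -/
def parseLabel : List Sym → Label × List Sym :=
  Parses.many .endLabel fun w => ((w.headD Sym.text).toBit, w.tail)

theorem parses_label : Parses encodeLabel parseLabel :=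
  (parses_bit.list .endLabel (by simp)).congr fun l => by
    rw [encodeLabel, List.map_eq_flatMap]

theorem headD_encodeLabel (l : Label) (r : List Sym) :
    (encodeLabel l ++ r).headD .endList ≠ .endList := by
  cases l <;> simp [encodeLabel]

theorem parses_labels : Parses (encodeList encodeLabel) (Parses.many .endList parseLabel) :=
  (parses_label.list .endList headD_encodeLabel).congr fun _ => rfl

/-- Read a right-hand side. -/
def parseContent (w : List Sym) : Content × List Sym :=
  match w.headD .empty with
  | .text => (.text, w.tail)
  | .seq => (.seq (Parses.many .endList parseLabel w.tail).1,
      (Parses.many .endList parseLabel w.tail).2)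
  | .alt => (.alt (Parses.many .endList parseLabel w.tail).1,
      (Parses.many .endList parseLabel w.tail).2)
  | .star => (.star (parseLabel w.tail).1, (parseLabel w.tail).2)
  | _ => (.empty, w.tail)

theorem parses_content : Parses encodeContent parseContent where
  poly := by
    have ht : Poly fun w : List Sym => w.tail := .tail .id'
    have h₁ := parses_label.poly.comp ht
    have h₂ := parses_labels.poly.comp ht
    refine .sym_cases (F := fun s w => match s with
      | .text => (Content.text, w.tail)
      | .seq => (.seq (Parses.many .endList parseLabel w.tail).1,
          (Parses.many .endList parseLabel w.tail).2)
      | .alt => (.alt (Parses.many .endList parseLabel w.tail).1,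
          (Parses.many .endList parseLabel w.tail).2)
      | .star => (.star (parseLabel w.tail).1, (parseLabel w.tail).2)
      | _ => (.empty, w.tail)) (.headD .id' .empty) ?_
    rintro ⟨⟩
    case seq => exact .prodMk (Content.poly_seq.comp (Poly.fst.comp h₂)) (Poly.snd.comp h₂)
    case alt => exact .prodMk (Content.poly_alt.comp (Poly.fst.comp h₂)) (Poly.snd.comp h₂)
    case star => exact .prodMk (Content.poly_star.comp (Poly.fst.comp h₁)) (Poly.snd.comp h₁)
    all_goals exact .prodMk (.const _) ht
  suffix w := by
    have h := w.tail_suffix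
    unfold parseContent
    split
    · exact h
    · exact (parses_labels.suffix _).trans h
    · exact (parses_labels.suffix _).trans h
    · exact (parses_label.suffix _).trans h
    · exact h
  decode c r := by
    cases c <;> simp [encodeContent, parseContent, parses_labels.decode, parses_label.decode]

theorem parses_rule : Parses encodeRule
    (fun w => (((parseLabel w).1, (parseContent (parseLabel w).2).1),
      (parseContent (parseLabel w).2).2)) :=
  parses_label.pair parses_content

theorem parses_rules : ∃ p, Parses (encodeList encodeRule) p :=
  ⟨_, (parses_rule.list .endList fun a r => by
    rw [encodeRule, List.append_assoc]; exact headD_encodeLabel _ _).congr fun _ => rfl⟩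

/-- Read an update access type. -/
def parseUAT (w : List Sym) : UAT × List Sym :=
  let a := parseLabel w.tail
  let b := parseLabel a.2
  let c := parseLabel b.2
  match w.headD .text with
  | .insert => (.insert a.1 b.1, b.2)
  | .delete => (.delete a.1 b.1, b.2)
  | .replace => (.replace a.1 b.1 c.1, c.2)
  | _ => (.replaceText a.1, a.2)

theorem parses_uat : Parses encodeUAT parseUAT where
  poly := by
    have h₁ : Poly fun w : List Sym => parseLabel w.tail := parses_label.poly.comp (.tail .id')
    have h₂ := parses_label.poly.comp (Poly.snd.comp h₁)
    have h₃ := parses_label.poly.comp (Poly.snd.comp h₂)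
    refine .sym_cases (F := fun s w =>
      let a := parseLabel w.tail
      let b := parseLabel a.2
      let c := parseLabel b.2
      match s with
      | .insert => (UAT.insert a.1 b.1, b.2)
      | .delete => (.delete a.1 b.1, b.2)
      | .replace => (.replace a.1 b.1 c.1, c.2)
      | _ => (.replaceText a.1, a.2)) (.headD .id' .text) ?_
    have h₁₂ := (Poly.fst.comp h₁).prodMk (Poly.fst.comp h₂)
    have h₁₃ := (Poly.fst.comp h₁).prodMk ((Poly.fst.comp h₂).prodMk (Poly.fst.comp h₃))
    rintro ⟨⟩
    case insert => exact (UAT.poly_insert.comp h₁₂).prodMk (Poly.snd.comp h₂)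
    case delete => exact (UAT.poly_delete.comp h₁₂).prodMk (Poly.snd.comp h₂)
    case replace => exact (UAT.poly_replace.comp h₁₃).prodMk (Poly.snd.comp h₃)
    all_goals exact (UAT.poly_replaceText.comp (Poly.fst.comp h₁)).prodMk (Poly.snd.comp h₁)
  suffix w := by
    have h₁ := (parses_label.suffix w.tail).trans w.tail_suffix
    have h₂ := (parses_label.suffix _).trans h₁
    have h₃ := (parses_label.suffix _).trans h₂
    unfold parseUAT
    dsimp only
    split
    exacts [h₂, h₂, h₃, h₁]
  decode u r := by
    cases u <;> simp [encodeUAT, parseUAT, parses_label.decode]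

theorem parses_uats : Parses (encodeList encodeUAT) (Parses.many .endList parseUAT) :=
  (parses_uat.list .endList fun a r => by cases a <;> simp [encodeUAT]).congr fun _ => rfl

/-- Every word that presents a policy is decoded in polynomial time. -/
theorem exists_parse : ∃ p : List Sym → Presentation, Poly p ∧ ∀ I, p I.encode = I := by
  obtain ⟨q, hq⟩ := parses_rules
  have h := parses_label.pair (hq.pair (parses_uats.pair parses_uats))
  obtain ⟨p, hp⟩ : ∃ p, Parses (fun x : Label × List (Label × Content) × List UAT × List UAT =>
    encodeLabel x.1 ++ (encodeList encodeRule x.2.1 ++ (encodeList encodeUAT x.2.2.1 ++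
      encodeList encodeUAT x.2.2.2))) p := ⟨_, h⟩
  refine ⟨fun w => let x := (p w).1; ⟨x.1, x.2.1, x.2.2.1, x.2.2.2⟩,
    .of_enc (Poly.fst.comp hp.poly) fun _ => rfl, fun I => ?_⟩
  have := hp.decode (I.rt, I.rules, I.allowed, I.forbidden) []
  rw [List.append_nil] at this
  simp only [Presentation.encode, this]

/-! ### Writing words -/

theorem poly_encodeLabel : Poly encodeLabel :=
  .append (.map (f := fun (_ : Label) b => Sym.bit b) .id'
    (.comp (g := Sym.bit) (.of_enc_eq fun b => by cases b <;> rfl) .snd)) (.const _)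

theorem poly_encodeList {f : α → List Sym} (hf : Poly f) : Poly (encodeList f) :=
  .append (.flatMap (f := fun (_ : List α) a => f a) .id' (hf.comp .snd)) (.const _)

theorem poly_encodeContent : Poly encodeContent := by
  have h : Poly fun p : Content × List Label => encodeList encodeLabel p.2 :=
    (poly_encodeList poly_encodeLabel).comp .snd
  exact .content_cases (F := fun (_ : Content) c => encodeContent c) .id' (.const _) (.const _)
    (.cons (.const _) h) (.cons (.const _) h) (.cons (.const _) (poly_encodeLabel.comp .snd))

theorem poly_encodeUAT : Poly encodeUAT := by
  have h {γ : Type} [Enc γ] {f : γ → Label} (hf : Poly f) : Poly fun x => encodeLabel (f x) :=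
    poly_encodeLabel.comp hf
  exact .uat_cases (F := fun (_ : UAT) u => encodeUAT u) .id'
    (.cons (.const _) (.append (h (by fun_prop)) (h (by fun_prop))))
    (.cons (.const _) (.append (h (by fun_prop)) (h (by fun_prop))))
    (.cons (.const _) (.append (h (by fun_prop)) (.append (h (by fun_prop)) (h (by fun_prop)))))
    (.cons (.const _) (h (by fun_prop)))

theorem poly_encode : Poly Presentation.encode :=
  .append (poly_encodeLabel.comp (by fun_prop)) (.append
    ((poly_encodeList (f := encodeRule) (.append (poly_encodeLabel.comp .fst)
      (poly_encodeContent.comp .snd))).comp (by fun_prop))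
    (.append ((poly_encodeList poly_encodeUAT).comp (by fun_prop))
      ((poly_encodeList poly_encodeUAT).comp (by fun_prop))))

end XMLPolicy

namespace XMLPolicy

open Relation (ReflTransGen TransGen)

variable {α β γ : Type} [Enc α] [Enc β] [Enc γ]

/-! ### Reachability in finite graphs -/

section Reachability

variable {V : Type}

open Classical in
/-- The vertices in `S` and the targets of the edges in `E` that start in `S`. -/
noncomputable def expand (E : List (V × V)) (S : List V) : List V :=
  S ++ (E.filter fun e => decide (e.1 ∈ S)).map Prod.snd

theorem mem_expand {E : List (V × V)} {S : List V} {x : V} :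
    x ∈ expand E S ↔ x ∈ S ∨ ∃ y ∈ S, (y, x) ∈ E := by
  simp only [expand, List.mem_append, List.mem_map, List.mem_filter, decide_eq_true_eq]
  refine or_congr_right ⟨?_, ?_⟩
  · rintro ⟨⟨y, z⟩, ⟨h₁, h₂⟩, rfl⟩
    exact ⟨y, h₂, h₁⟩
  · rintro ⟨y, h₁, h₂⟩
    exact ⟨_, ⟨h₂, h₁⟩, rfl⟩

/-- The vertices that can be reached from `S`: as many rounds of `expand` as there are edges are
enough, because each of them reaches the target of a new edge until nothing changes. -/
noncomputable def closure (E : List (V × V)) (S : List V) : List V :=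
  E.foldl (fun S _ => expand E S) S

theorem closure_eq (E : List (V × V)) (S : List V) :
    closure E S = (expand E)^[E.length] S := List.foldl_const _ _ _

open Classical in
/-- After `n` rounds, where `n` bounds the number of edges with targets outside `S`, the set is
closed under the edges. -/
theorem closed_iterate (E : List (V × V)) (n : ℕ) : ∀ S : List V,
    (E.countP fun e => decide (e.2 ∉ S)) ≤ n →
    ∀ x y, x ∈ (expand E)^[n] S → (x, y) ∈ E → y ∈ (expand E)^[n] S := by
  have closed : ∀ n, ∀ S : List V, (∀ x y, x ∈ S → (x, y) ∈ E → y ∈ S) →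
      ∀ x y, x ∈ (expand E)^[n] S → (x, y) ∈ E → y ∈ (expand E)^[n] S := by
    intro n
    induction n with
    | zero => exact fun S h => h
    | succ n ih =>
      intro S h
      refine ih _ fun x y hx hy => mem_expand.2 (Or.inl ?_)
      rcases mem_expand.1 hx with hx | ⟨z, hz, hzx⟩
      · exact h x y hx hy
      · exact h x y (h z x hz hzx) hy
  induction n with
  | zero =>
    intro S h x y _ hy
    rw [Nat.le_zero, List.countP_eq_zero] at h
    simpa using h _ hy
  | succ n ih =>
    intro S h
    by_cases hS : ∀ x y, x ∈ S → (x, y) ∈ E → y ∈ S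
    · exact closed _ S hS
    · push Not at hS
      obtain ⟨x, y, hx, hy, hyS⟩ := hS
      refine ih (expand E S) (Nat.le_of_lt_succ (lt_of_lt_of_le ?_ h))
      have hle : ∀ l : List (V × V), (l.countP fun e => decide (e.2 ∉ expand E S))
          ≤ l.countP fun e => decide (e.2 ∉ S) := fun l =>
        List.countP_mono_left fun e _ he => by
          simp only [decide_eq_true_eq] at he ⊢
          exact fun h => he (mem_expand.2 (Or.inl h))
      obtain ⟨l₁, l₂, hl⟩ := List.append_of_mem hy
      have h₁ := hle l₁
      have h₂ := hle l₂
      have hy' : y ∈ expand E S := mem_expand.2 (Or.inr ⟨x, hx, hy⟩)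
      rw [hl] at hy' ⊢
      rw [hl] at h₁ h₂
      simp only [List.countP_append, List.countP_cons, hy', hyS, not_true_eq_false,
        not_false_eq_true, decide_true, decide_false, if_true] at h₁ h₂ ⊢
      simp only [Bool.false_eq_true, if_false, decide_not] at h₁ h₂ ⊢
      omega

theorem mem_closure {E : List (V × V)} {S : List V} {x : V} :
    x ∈ closure E S ↔ ∃ s ∈ S, ReflTransGen (fun a b => (a, b) ∈ E) s x := by
  rw [closure_eq]
  constructor
  · have : ∀ n, ∀ S : List V, ∀ x ∈ (expand E)^[n] S,
        ∃ s ∈ S, ReflTransGen (fun a b => (a, b) ∈ E) s x := by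
      intro n
      induction n with
      | zero => exact fun S x h => ⟨x, h, .refl⟩
      | succ n ih =>
        intro S x hx
        obtain ⟨s, hs, hsx⟩ := ih _ x hx
        rcases mem_expand.1 hs with hs | ⟨y, hy, hys⟩
        · exact ⟨s, hs, hsx⟩
        · exact ⟨y, hy, .head hys hsx⟩
    exact this _ S x
  · rintro ⟨s, hs, h⟩
    have hsub : ∀ n, ∀ S : List V, s ∈ S → s ∈ (expand E)^[n] S := by
      intro n
      induction n with
      | zero => exact fun S h => h
      | succ n ih => exact fun S h => ih _ (mem_expand.2 (Or.inl h))
    induction h with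
    | refl => exact hsub _ S hs
    | tail _ hbc ih => exact closed_iterate E _ S List.countP_le_length _ _ ih hbc

end Reachability

theorem sz_map_snd_filter_le (E : List (α × β)) (p : α × β → Bool) :
    sz ((E.filter p).map Prod.snd) ≤ sz E := by
  induction E with
  | nil => exact le_rfl
  | cons e E ih =>
    have h : sz e = sz e.1 + sz e.2 + 1 := rfl
    rw [List.filter_cons, sz_cons]
    split
    · rw [List.map_cons, sz_cons]; omega
    · omega

theorem poly_closure [PolyEq α] {E : γ → List (α × α)} {S : γ → List α} (hE : Poly E)
    (hS : Poly S) : Poly fun x => closure (E x) (S x) := by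
  classical
  refine .foldl (s := fun x S _ => expand (E x) S) hE hS ?_ (B := fun x => sz (E x)) hE.2 ?_
  · refine .append (by fun_prop) (.map (f := fun _ e => e.2) (.filter
      (hE.comp .fst) ?_) (by fun_prop))
    exact (PolyPred.mem (f := fun z : (γ × List α × α × α) × α × α => z.2.1)
      (l := fun z => z.1.2.1) (by fun_prop) (by fun_prop)).congr fun z => by simp
  · intro x S e _
    have h₁ := sz_append S (((E x).filter fun e => decide (e.1 ∈ S)).map Prod.snd)
    have h₂ := sz_map_snd_filter_le (E x) fun e => decide (e.1 ∈ S)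
    rw [expand]
    omega

namespace PolyPred

theorem reflTransGen [PolyEq α] {E : γ → List (α × α)} {f g : γ → α} (hE : Poly E) (hf : Poly f)
    (hg : Poly g) : PolyPred fun x => ReflTransGen (fun a b => (a, b) ∈ E x) (f x) (g x) :=
  (PolyPred.mem hg (poly_closure hE (.cons hf (.const [])))).congr fun x => by simp [mem_closure]

theorem transGen [PolyEq α] {E : γ → List (α × α)} {f g : γ → α} (hE : Poly E) (hf : Poly f)
    (hg : Poly g) : PolyPred fun x => TransGen (fun a b => (a, b) ∈ E x) (f x) (g x) := by
  refine (PolyPred.bex (P := fun x e => e.1 = f x ∧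
    ReflTransGen (fun a b => (a, b) ∈ E x) e.2 (g x)) hE ?_).congr fun x => ?_
  · exact (PolyPred.eq (by fun_prop) (hf.comp .fst)).and
      (reflTransGen (E := fun y : γ × α × α => E y.1) (hE.comp .fst) (by fun_prop) (hg.comp .fst))
  · rw [Relation.TransGen.head'_iff]
    constructor
    · rintro ⟨b, h₁, h₂⟩
      exact ⟨_, h₁, rfl, h₂⟩
    · rintro ⟨⟨a, b⟩, h₁, rfl, h₂⟩
      exact ⟨b, h₁, h₂⟩

end PolyPred

end XMLPolicy

namespace XMLPolicy

open Relation (ReflTransGen TransGen)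

/-! ### The criterion on presentations -/

namespace Presentation

/-- The edges of the DTD graph. -/
def edges (I : Presentation) : List (Label × Label) :=
  I.rules.flatMap fun r => r.2.subs.map fun B => (r.1, B)

/-- The graph of the allowed replacements. Its vertices are pairs of the type of the parent and the
type of the child that is replaced. -/
def moves (I : Presentation) : List ((Label × Label) × (Label × Label)) :=
  I.allowed.flatMap fun
    | .replace A B B' => [((A, B), (A, B'))]
    | _ => []

/-- The type `u` is valid for the listed rules. -/
def Admits (I : Presentation) : UAT → Prop
  | .insert A B => (A, .star B) ∈ I.rules
  | .delete A B => (A, .star B) ∈ I.rules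
  | .replace A B B' => ∃ r ∈ I.rules, r.1 = A ∧ r.2 = .alt r.2.subs ∧
      B ∈ r.2.subs ∧ B' ∈ r.2.subs ∧ B ≠ B'
  | .replaceText A => (A, .text) ∈ I.rules

/-- The presentation describes some policy over some DTD. -/
structure WellFormed (I : Presentation) : Prop where
  rules_unique : ∀ r ∈ I.rules, ∀ r' ∈ I.rules, r.1 = r'.1 → r.2 = r'.2
  rt_mem : I.rt ∈ I.rules.map Prod.fst
  rules_wf : ∀ r ∈ I.rules, r.2.WellFormed
  edges_mem : ∀ e ∈ I.edges, e.2 ∈ I.rules.map Prod.fst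
  acyclic : ∀ e ∈ I.edges, ¬ TransGen (fun a b => (a, b) ∈ I.edges) e.1 e.1
  allowed_valid : ∀ u ∈ I.allowed, I.Admits u
  forbidden_valid : ∀ u ∈ I.forbidden, I.Admits u
  disjoint : ∀ u ∈ I.allowed, u ∉ I.forbidden

/-- The type is a replacement that is the composition of allowed replacements. -/
def Composed (I : Presentation) : UAT → Prop
  | .replace A B B' => TransGen (fun a b => (a, b) ∈ I.moves) (A, B) (A, B')
  | _ => False

/-- The counterpart of `Policy.Resets`. -/
def Resets (I : Presentation) (C E : Label) : Prop :=
  (.insert C E ∈ I.allowed ∧ .delete C E ∈ I.allowed) ∨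
    TransGen (fun a b => (a, b) ∈ I.moves) (C, E) (C, E)

/-- The counterpart of `Policy.Bypass`. -/
def Bypass (I : Presentation) : Prop :=
  ∃ u ∈ I.forbidden, ReflTransGen (fun a b => (a, b) ∈ I.edges) I.rt u.src ∧
    (I.Composed u ∨ ∃ e ∈ I.edges, ReflTransGen (fun a b => (a, b) ∈ I.edges) I.rt e.1 ∧
      I.Resets e.1 e.2 ∧ ReflTransGen (fun a b => (a, b) ∈ I.edges) e.2 u.src)

variable {I : Presentation}

theorem mem_edges {A B : Label} : (A, B) ∈ I.edges ↔ ∃ c, (A, c) ∈ I.rules ∧ B ∈ c.subs := by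
  simp only [edges, List.mem_flatMap, List.mem_map, Prod.exists, Prod.mk.injEq]
  constructor
  · rintro ⟨_, c, h, _, hB, rfl, rfl⟩
    exact ⟨c, h, hB⟩
  · rintro ⟨c, h, hB⟩
    exact ⟨A, c, h, B, hB, rfl, rfl⟩

theorem mem_moves {p q : Label × Label} :
    (p, q) ∈ I.moves ↔ p.1 = q.1 ∧ .replace p.1 p.2 q.2 ∈ I.allowed := by
  obtain ⟨A, B⟩ := p
  obtain ⟨A', B'⟩ := q
  simp only [moves, List.mem_flatMap]
  constructor
  · rintro ⟨u, hu, h⟩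
    cases u <;> simp at h
    obtain ⟨⟨rfl, rfl⟩, rfl, rfl⟩ := h
    exact ⟨rfl, hu⟩
  · rintro ⟨h, hu⟩
    obtain rfl : A = A' := h
    exact ⟨_, hu, by simp⟩

theorem transGen_moves {A B B' : Label} : TransGen (fun a b => (a, b) ∈ I.moves) (A, B) (A, B') ↔
    TransGen (fun B B' => .replace A B B' ∈ I.allowed) B B' := by
  constructor
  · have : ∀ p q, TransGen (fun a b => (a, b) ∈ I.moves) p q → p.1 = q.1 ∧
        TransGen (fun B B' => .replace p.1 B B' ∈ I.allowed) p.2 q.2 := by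
      intro p q h
      induction h with
      | single h =>
        obtain ⟨h₁, h₂⟩ := mem_moves.1 h
        exact ⟨h₁, .single h₂⟩
      | tail _ h ih =>
        obtain ⟨h₁, h₂⟩ := mem_moves.1 h
        exact ⟨ih.1.trans h₁, ih.2.tail (ih.1 ▸ h₂)⟩
    exact fun h => (this _ _ h).2
  · intro h
    induction h with
    | single h => exact .single (mem_moves.2 ⟨rfl, h⟩)
    | tail _ h ih => exact ih.tail (mem_moves.2 ⟨rfl, h⟩)

/-! ### The criterion is decidable in polynomial time -/

@[fun_prop]
theorem poly_edges : Poly edges := by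
  have h : Poly fun y : Presentation × Label × Content => y.2.2.subs.map fun B => (y.2.1, B) :=
    .map (f := fun (y : Presentation × Label × Content) B => (y.2.1, B))
      (Content.poly_subs.comp (by fun_prop)) (by fun_prop)
  exact .flatMap (f := fun (_ : Presentation) (r : Label × Content) =>
    r.2.subs.map fun B => (r.1, B)) poly_rules h

@[fun_prop]
theorem poly_moves : Poly moves := by
  let F : UAT → List ((Label × Label) × (Label × Label))
    | .replace A B B' => [((A, B), (A, B'))]
    | _ => []
  have h : Poly fun y : Presentation × UAT => F y.2 :=
    .uat_cases (F := fun _ u => F u) .snd (.const []) (.const [])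
      (.cons (by fun_prop) (.const [])) (.const [])
  exact .flatMap (f := fun (_ : Presentation) u => F u) poly_allowed h

theorem poly_src : Poly UAT.src :=
  .uat_cases (F := fun (_ : UAT) u => u.src) .id' (by unfold UAT.src; fun_prop)
    (by unfold UAT.src; fun_prop) (by unfold UAT.src; fun_prop) (by unfold UAT.src; fun_prop)

theorem polyPred_admits : PolyPred fun p : Presentation × UAT => p.1.Admits p.2 := by
  classical
  have hstar : PolyPred fun p : (Presentation × UAT) × Label × Label =>
      (p.2.1, Content.star p.2.2) ∈ p.1.1.rules :=
    .mem (.prodMk (by fun_prop) (Content.poly_star.comp (by fun_prop))) (by fun_prop)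
  have hs : Poly fun y : ((Presentation × UAT) × Label × Label × Label) × Label × Content =>
      y.2.2.subs := Content.poly_subs.comp (by fun_prop)
  refine .uat_cases (F := fun (p : Presentation × UAT) u => decide (p.1.Admits u)) (by fun_prop)
    hstar hstar ?_ ?_
  · exact PolyPred.bex (γ := (Presentation × UAT) × Label × Label × Label) (α := Label × Content)
      (l := fun p => p.1.1.rules) (P := fun p r => r.1 = p.2.1 ∧ r.2 = .alt r.2.subs ∧
        p.2.2.1 ∈ r.2.subs ∧ p.2.2.2 ∈ r.2.subs ∧ p.2.2.1 ≠ p.2.2.2) (by fun_prop)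
      ((PolyPred.eq (by fun_prop) (by fun_prop)).and
        ((PolyPred.eq (by fun_prop) (Content.poly_alt.comp hs)).and
          ((PolyPred.mem (by fun_prop) hs).and ((PolyPred.mem (by fun_prop) hs).and
            (PolyPred.eq (by fun_prop) (by fun_prop)).not))))
  · exact PolyPred.mem (f := fun p : (Presentation × UAT) × Label => (p.2, Content.text))
      (l := fun p => p.1.1.rules) (by fun_prop) (by fun_prop)

theorem polyPred_wellFormed : PolyPred WellFormed := by
  have heads : Poly fun I : Presentation => I.rules.map Prod.fst :=
    .map (f := fun (_ : Presentation) (r : Label × Content) => r.1) (by fun_prop) (by fun_prop)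
  have h₁ : PolyPred fun I : Presentation =>
      ∀ r ∈ I.rules, ∀ r' ∈ I.rules, r.1 = r'.1 → r.2 = r'.2 :=
    .ball (l := rules) (P := fun I r => ∀ r' ∈ I.rules, r.1 = r'.1 → r.2 = r'.2) (by fun_prop)
      (.ball (l := fun y => y.1.rules) (P := fun (y : Presentation × Label × Content) r' =>
          y.2.1 = r'.1 → y.2.2 = r'.2)
        (by fun_prop) ((PolyPred.eq (by fun_prop) (by fun_prop)).imp
          (PolyPred.eq (by fun_prop) (by fun_prop))))
  have h₂ : PolyPred fun I : Presentation => I.rt ∈ I.rules.map Prod.fst :=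
    .mem (by fun_prop) heads
  have h₃ : PolyPred fun I : Presentation => ∀ r ∈ I.rules, r.2.WellFormed :=
    .ball (l := rules) (P := fun _ r => r.2.WellFormed) (by fun_prop)
      (Content.polyPred_wellFormed.comp (by fun_prop))
  have h₄ : PolyPred fun I : Presentation => ∀ e ∈ I.edges, e.2 ∈ I.rules.map Prod.fst :=
    .ball (l := edges) (P := fun I e => e.2 ∈ I.rules.map Prod.fst) (by fun_prop)
      (.mem (by fun_prop) (heads.comp .fst))
  have h₅ : PolyPred fun I : Presentation =>
      ∀ e ∈ I.edges, ¬ TransGen (fun a b => (a, b) ∈ I.edges) e.1 e.1 :=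
    .ball (l := edges) (P := fun I e => ¬ TransGen (fun a b => (a, b) ∈ I.edges) e.1 e.1)
      (by fun_prop)
      (PolyPred.transGen (E := fun y : Presentation × Label × Label => y.1.edges) (by fun_prop)
        (by fun_prop) (by fun_prop)).not
  have h₆ : PolyPred fun I : Presentation => ∀ u ∈ I.allowed, I.Admits u :=
    .ball (P := Admits) (by fun_prop) polyPred_admits
  have h₇ : PolyPred fun I : Presentation => ∀ u ∈ I.forbidden, I.Admits u :=
    .ball (P := Admits) (by fun_prop) polyPred_admits
  have h₈ : PolyPred fun I : Presentation => ∀ u ∈ I.allowed, u ∉ I.forbidden :=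
    .ball (l := allowed) (P := fun I u => u ∉ I.forbidden) (by fun_prop)
      (PolyPred.mem (by fun_prop) (by fun_prop)).not
  exact (h₁.and (h₂.and (h₃.and (h₄.and (h₅.and (h₆.and (h₇.and h₈))))))).congr fun I =>
    ⟨fun ⟨a, b, c, d, e, f, g, h⟩ => ⟨a, b, c, d, e, f, g, h⟩,
      fun ⟨a, b, c, d, e, f, g, h⟩ => ⟨a, b, c, d, e, f, g, h⟩⟩

theorem polyPred_composed : PolyPred fun p : Presentation × UAT => p.1.Composed p.2 := by
  classical
  refine .uat_cases (F := fun (p : Presentation × UAT) u => decide (p.1.Composed u)) (by fun_prop)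
    (PolyPred.const False) (PolyPred.const False) ?_ (PolyPred.const False)
  exact PolyPred.transGen (E := fun p : (Presentation × UAT) × Label × Label × Label => p.1.1.moves)
    (f := fun p => (p.2.1, p.2.2.1)) (g := fun p => (p.2.1, p.2.2.2)) (by fun_prop) (by fun_prop)
    (by fun_prop)

theorem polyPred_resets :
    PolyPred fun p : Presentation × Label × Label => p.1.Resets p.2.1 p.2.2 := by
  refine .or (.and (.mem (UAT.poly_insert.comp .snd) (by fun_prop))
    (.mem (UAT.poly_delete.comp .snd) (by fun_prop))) ?_
  exact .transGen (E := fun p : Presentation × Label × Label => p.1.moves)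
    (f := fun p => p.2) (g := fun p => p.2) (by fun_prop) (by fun_prop) (by fun_prop)

theorem polyPred_bypass : PolyPred Bypass := by
  have hsrc : Poly fun y : (Presentation × UAT) × Label × Label => y.1.2.src :=
    poly_src.comp (by fun_prop)
  refine .bex (l := forbidden) (P := fun I u =>
    ReflTransGen (fun a b => (a, b) ∈ I.edges) I.rt u.src ∧
    (I.Composed u ∨ ∃ e ∈ I.edges, ReflTransGen (fun a b => (a, b) ∈ I.edges) I.rt e.1 ∧
      I.Resets e.1 e.2 ∧ ReflTransGen (fun a b => (a, b) ∈ I.edges) e.2 u.src)) (by fun_prop) ?_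
  refine .and (.reflTransGen (E := fun y : Presentation × UAT => y.1.edges) (by fun_prop)
    (by fun_prop) (poly_src.comp .snd)) (.or polyPred_composed ?_)
  refine .bex (l := fun y => y.1.edges) (P := fun (y : Presentation × UAT) e =>
    ReflTransGen (fun a b => (a, b) ∈ y.1.edges) y.1.rt e.1 ∧ y.1.Resets e.1 e.2 ∧
      ReflTransGen (fun a b => (a, b) ∈ y.1.edges) e.2 y.2.src) (by fun_prop) ?_
  refine .and (.reflTransGen (E := fun y : (Presentation × UAT) × Label × Label => y.1.1.edges)
    (by fun_prop) (by fun_prop) (by fun_prop)) (.and ?_ (.reflTransGen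
      (E := fun y : (Presentation × UAT) × Label × Label => y.1.1.edges) (by fun_prop)
      (by fun_prop) hsrc))
  exact polyPred_resets.comp (f := fun y : (Presentation × UAT) × Label × Label => (y.1.1, y.2))
    (by fun_prop)

/-! ### The criterion is correct -/

section Describes

variable {D : DTD} {P : Policy D}

theorem Describes.mem_edges (h : I.Describes D P) {A B : Label} :
    (A, B) ∈ I.edges ↔ D.Edge A B := by
  simp only [Presentation.mem_edges, h.rules_iff, DTD.Edge]
  constructor
  · rintro ⟨c, ⟨hA, rfl⟩, hB⟩
    exact ⟨hA, hB⟩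
  · rintro ⟨hA, hB⟩
    exact ⟨_, ⟨hA, rfl⟩, hB⟩

theorem Describes.edges_eq (h : I.Describes D P) : (fun a b => (a, b) ∈ I.edges) = D.Edge :=
  funext₂ fun _ _ => propext h.mem_edges

theorem Describes.mem_heads (h : I.Describes D P) {A : Label} :
    A ∈ I.rules.map Prod.fst ↔ A ∈ D.ele := by
  simp only [List.mem_map, Prod.exists, h.rules_iff]
  constructor
  · rintro ⟨_, _, h, rfl⟩
    exact h.1
  · exact fun hA => ⟨A, _, ⟨hA, rfl⟩, rfl⟩

theorem Describes.admits (h : I.Describes D P) {u : UAT} : I.Admits u ↔ u ∈ D.validUATs := by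
  cases u with
  | insert A B => exact h.rules_iff _ _
  | delete A B => exact h.rules_iff _ _
  | replaceText A => exact h.rules_iff _ _
  | replace A B B' =>
    constructor
    · rintro ⟨⟨_, c⟩, hr, rfl, hc, hB⟩
      obtain ⟨hA, hc'⟩ := (h.rules_iff _ _).1 hr
      exact ⟨hA, _, hc'.trans hc, hB⟩
    · rintro ⟨hA, Bs, hc, hB⟩
      exact ⟨(A, .alt Bs), (h.rules_iff _ _).2 ⟨hA, hc⟩, rfl, rfl, hB⟩

theorem Describes.wellFormed (h : I.Describes D P) : I.WellFormed where
  rules_unique := by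
    rintro ⟨A, c⟩ hr ⟨A', c'⟩ hr' rfl
    exact ((h.rules_iff _ _).1 hr).2.symm.trans ((h.rules_iff _ _).1 hr').2
  rt_mem := h.mem_heads.2 (h.rt_eq ▸ D.rt_mem)
  rules_wf := by
    rintro ⟨A, c⟩ hr
    obtain ⟨hA, rfl⟩ := (h.rules_iff _ _).1 hr
    exact D.rg_wf A hA
  edges_mem := by
    rintro ⟨A, B⟩ he
    obtain ⟨hA, hB⟩ := h.mem_edges.1 he
    exact h.mem_heads.2 (D.subs_mem A hA B hB)
  acyclic := by
    rintro ⟨A, B⟩ -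
    rw [h.edges_eq]
    exact D.acyclic A
  allowed_valid u hu := h.admits.2 (P.allowed_valid ((h.allowed_iff u).1 hu))
  forbidden_valid u hu := h.admits.2 (P.forbidden_valid ((h.forbidden_iff u).1 hu))
  disjoint u hu hu' := Set.disjoint_left.1 P.disjoint ((h.allowed_iff u).1 hu)
    ((h.forbidden_iff u).1 hu')

theorem Describes.transGen_moves (h : I.Describes D P) {A B B' : Label} :
    TransGen (fun a b => (a, b) ∈ I.moves) (A, B) (A, B') ↔ TransGen (P.Replaces A) B B' := by
  rw [Presentation.transGen_moves]
  simp only [h.allowed_iff]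
  rfl

theorem Describes.resets (h : I.Describes D P) {C E : Label} : I.Resets C E ↔ P.Resets C E := by
  rw [Presentation.Resets, Policy.Resets, h.transGen_moves, h.allowed_iff, h.allowed_iff]

theorem Describes.composed (h : I.Describes D P) {u : UAT} : I.Composed u ↔
    ∃ A B B', u = .replace A B B' ∧ TransGen (P.Replaces A) B B' := by
  cases u with
  | replace A B B' =>
    refine h.transGen_moves.trans ⟨fun h => ⟨A, B, B', rfl, h⟩, ?_⟩
    rintro ⟨_, _, _, ⟨⟩, h⟩
    exact h
  | _ => simp [Composed]

theorem Describes.bypass (h : I.Describes D P) : I.Bypass ↔ P.Bypass := by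
  simp only [Presentation.Bypass, Policy.Bypass, h.edges_eq, h.forbidden_iff, h.rt_eq, h.composed,
    h.resets]
  refine exists_congr fun u => and_congr_right fun _ => and_congr_right fun _ =>
    or_congr_right ⟨?_, ?_⟩
  · rintro ⟨e, -, he⟩
    exact ⟨_, _, he⟩
  · rintro ⟨C, E, h₁, h₂, h₃⟩
    obtain ⟨hC, -, hE⟩ := h₂.language
    exact ⟨(C, E), h.mem_edges.2 ⟨hC, Content.mem_subs_of_mem_language hE (by simp)⟩, h₁, h₂, h₃⟩

theorem WellFormed.exists_describes (h : I.WellFormed) :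
    ∃ (D : DTD) (P : Policy D), I.Describes D P := by
  classical
  obtain ⟨rg, hrg⟩ : ∃ rg : Label → Content, ∀ A c, (A, c) ∈ I.rules → rg A = c := by
    refine ⟨fun A => if h : ∃ c, (A, c) ∈ I.rules then h.choose else .empty, fun A c hc => ?_⟩
    have hex : ∃ c, (A, c) ∈ I.rules := ⟨c, hc⟩
    refine (dif_pos hex).trans ?_
    exact h.rules_unique _ hex.choose_spec _ hc rfl
  have hmem : ∀ A, A ∈ (I.rules.map Prod.fst).toFinset ↔ (A, rg A) ∈ I.rules := by
    intro A
    simp only [List.mem_toFinset, List.mem_map, Prod.exists]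
    constructor
    · rintro ⟨_, c, hc, rfl⟩
      rwa [hrg _ _ hc]
    · exact fun hA => ⟨_, _, hA, rfl⟩
  have hrules : ∀ A c, (A, c) ∈ I.rules ↔ A ∈ (I.rules.map Prod.fst).toFinset ∧ rg A = c := by
    intro A c
    rw [hmem]
    constructor
    · intro hc
      obtain rfl := hrg _ _ hc
      exact ⟨hc, rfl⟩
    · rintro ⟨hc, rfl⟩
      exact hc
  have hedge : ∀ A B, (A ∈ (I.rules.map Prod.fst).toFinset ∧ B ∈ (rg A).subs)
      ↔ (A, B) ∈ I.edges := by
    intro A B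
    rw [mem_edges, hmem]
    constructor
    · exact fun h => ⟨_, h⟩
    · rintro ⟨c, hc, hB⟩
      obtain rfl := hrg _ _ hc
      exact ⟨hc, hB⟩
  let D : DTD :=
    { ele := (I.rules.map Prod.fst).toFinset
      rg := rg
      rt := I.rt
      rt_mem := List.mem_toFinset.2 h.rt_mem
      rg_wf := fun A hA => h.rules_wf _ ((hmem A).1 hA)
      subs_mem := fun A hA B hB => List.mem_toFinset.2 (h.edges_mem (A, B) ((hedge A B).1 ⟨hA, hB⟩))
      acyclic := by
        intro A hA
        simp only [hedge] at hA
        obtain ⟨B, hB, -⟩ := TransGen.head'_iff.1 hA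
        exact h.acyclic _ hB hA }
  have hadm : ∀ u, I.Admits u → u ∈ D.validUATs := by
    intro u hu
    cases u with
    | insert A B => exact (hrules _ _).1 hu
    | delete A B => exact (hrules _ _).1 hu
    | replaceText A => exact (hrules _ _).1 hu
    | replace A B B' =>
      obtain ⟨⟨_, c⟩, hr, rfl, hc, hB⟩ := hu
      obtain ⟨hA, hc'⟩ := (hrules _ _).1 hr
      exact ⟨hA, _, hc'.trans hc, hB⟩
  exact ⟨D,
    { allowed := {u | u ∈ I.allowed}
      forbidden := {u | u ∈ I.forbidden}
      allowed_valid := fun u hu => hadm u (h.allowed_valid u hu)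
      forbidden_valid := fun u hu => hadm u (h.forbidden_valid u hu)
      disjoint := Set.disjoint_left.2 h.disjoint },
    { rt_eq := rfl
      rules_iff := hrules
      allowed_iff := fun _ => Iff.rfl
      forbidden_iff := fun _ => Iff.rfl }⟩

end Describes

theorem exists_consistent_iff :
    (∃ (D : DTD) (P : Policy D), I.Describes D P ∧ P.Consistent) ↔ I.WellFormed ∧ ¬ I.Bypass := by
  constructor
  · rintro ⟨D, P, h, hP⟩
    exact ⟨h.wellFormed, fun hb => P.consistent_iff.1 hP (h.bypass.1 hb)⟩
  · rintro ⟨hw, hb⟩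
    obtain ⟨D, P, h⟩ := hw.exists_describes
    exact ⟨D, P, h, P.consistent_iff.2 fun hP => hb (h.bypass.2 hP)⟩

end Presentation

/-- A word is in the language if it is what encodes its decoding, and if the decoding passes the
test. -/
theorem polyPred_consistencyProblem : PolyPred fun w : List Sym => w ∈ consistencyProblem := by
  obtain ⟨p, hp, hI⟩ := exists_parse
  have h₁ := Presentation.polyPred_wellFormed.comp hp
  have h₂ := Presentation.polyPred_bypass.comp hp
  refine ((PolyPred.eq (poly_encode.comp hp) .id').and (h₁.and h₂.not)).congr fun w => ?_
  constructor
  · rintro ⟨I, D, P, rfl, h⟩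
    rw [hI]
    exact ⟨rfl, Presentation.exists_consistent_iff.1 ⟨D, P, h⟩⟩
  · rintro ⟨hw, h⟩
    obtain ⟨D, P, h⟩ := Presentation.exists_consistent_iff.2 h
    exact ⟨p w, D, P, hw, h⟩

end XMLPolicy

/-- The problem of deciding policy consistency is in `PTIME`. -/
theorem mainTheorem5 : XMLPolicy.InPTIME XMLPolicy.consistencyProblem := by
  exact XMLPolicy.inPTIME_of_polyPred XMLPolicy.polyPred_consistencyProblem
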